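/- Let $N\ge 2$, $\lambda\in\mathbb{R}$, and let $\Omega_0\subset\mathbb{R}^N$ be a compact set whose boundary $\partial\Omega_0$ is of class $C^5$ (that is, near each of its boundary points $\Omega_0$ is, in suitable orthonormal coordinates, the closed region $\{y_N\le f(y')\}$ below the graph of a $C^5$ function $f$). For $x\in\mathbb{R}^N$ and $t>0$ let $$G_{N,\lambda}(x,t)=(2\pi)^{-N}\int_{\mathbb{R}^N}e^{-(|\xi|^4+\lambda|\xi|^2)t+i\langle x,\xi\rangle}\,d\xi$$ be the fundamental solution of $\partial_t+(-\Delta)^2+\lambda(-\Delta)$, and let $$u(x,t)=(G_{N,\lambda}(\cdot,t)*\chi_{\Omega_0})(x)=\int_{\Omega_0}G_{N,\lambda}(x-y,t)\,dy$$ be the solution of $u_t=-\Delta^2u+\lambda\Delta u$ with initial value $u(\cdot,0)=\chi_{\Omega_0}$. Let $a>0$ be the number with $18a^4/11=1$, put $u_b(x,t)=u(x,b^4t)$ for $b>0$, and define $$U(x,t)=u_{3a}(x,t)-3u_{2a}(x,t)+3u_a(x,t),\qquad \Omega(t)=\{x\in\mathbb{R}^N : U(x,t)\ge \tfrac12\}.$$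 Let $d(y,\partial\Omega_0)$ be the signed distance to $\partial\Omega_0$, equal to $\inf_{x\in\partial\Omega_0}|y-x|$ for $y\in\Omega_0$ and to $-\inf_{x\in\partial\Omega_0}|y-x|$ for $y\in\mathbb{R}^N\setminus\Omega_0$. Then there exist $C_0>0$ and $t_0>0$ such that for all $t\in(0,t_0)$ $$\sup_{x\in\partial\Omega(t)}|d(x,\partial\Omega_0)|\le C_0\,t,$$ that is, $|d(x,\partial\Omega_0)|\le C_0t$ for every $x\in\partial\Omega(t)$. -/

import Mathlib

open MeasureTheory

noncomputable section

/-- `HasCkBoundary k Ω`: near each point `x` of its topological boundary, the set `Ω` is, in a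
suitable orthonormal frame with last axis `ν`, the closed region below the graph of a `C^k`
function. Here `y - ⟪ν, y⟫ ν` is the orthogonal projection `y'` of `y` to the hyperplane `ν^⊥` and
`⟪ν, y⟫` is the last coordinate of `y`; only the values of `f` on `ν^⊥` matter. The vector `ν`
points out of `Ω`. -/
def HasCkBoundary {N : ℕ} (k : ℕ) (Ω : Set (EuclideanSpace ℝ (Fin N))) : Prop :=
  ∀ x ∈ frontier Ω, ∃ ν : EuclideanSpace ℝ (Fin N), ‖ν‖ = 1 ∧
    ∃ f : EuclideanSpace ℝ (Fin N) → ℝ, ContDiff ℝ (k : WithTop ℕ∞) f ∧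
      ∃ r : ℝ, 0 < r ∧ ∀ y ∈ Metric.ball x r,
        (y ∈ Ω ↔ inner ℝ ν y ≤ f (y - (inner ℝ ν y : ℝ) • ν))

/-- The integrand `exp (-(|ξ|⁴ + lam |ξ|²) t + i ⟨x, ξ⟩)` of the fundamental solution. -/
def kernelIntegrand {N : ℕ} (lam t : ℝ) (x ξ : EuclideanSpace ℝ (Fin N)) : ℂ :=
  Complex.exp (((-(‖ξ‖ ^ 4 + lam * ‖ξ‖ ^ 2) * t : ℝ) : ℂ) + Complex.I * ((inner ℝ x ξ : ℝ) : ℂ))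

/-- The fundamental solution `G_{N,lam}(x, t)` of `∂ₜ + (-Δ)² + lam (-Δ)`, that is
`(2π)^{-N} ∫ exp (-(|ξ|⁴ + lam |ξ|²) t + i ⟨x, ξ⟩) dξ`. The integral is a real number
(see `ofReal_fundamentalSolution`), and `G` is taken as a real-valued function. -/
def fundamentalSolution {N : ℕ} (lam : ℝ) (x : EuclideanSpace ℝ (Fin N)) (t : ℝ) : ℝ :=
  ((2 * Real.pi) ^ N)⁻¹ * (∫ ξ : EuclideanSpace ℝ (Fin N), kernelIntegrand lam t x ξ).re

theorem ofReal_fundamentalSolution {N : ℕ} (lam : ℝ) (x : EuclideanSpace ℝ (Fin N)) (t : ℝ) :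
    (fundamentalSolution lam x t : ℂ) =
      ((2 * (Real.pi : ℂ)) ^ N)⁻¹ *
        ∫ ξ : EuclideanSpace ℝ (Fin N), kernelIntegrand lam t x ξ := by
  have key : (starRingEnd ℂ) (∫ ξ : EuclideanSpace ℝ (Fin N), kernelIntegrand lam t x ξ) =
      ∫ ξ : EuclideanSpace ℝ (Fin N), kernelIntegrand lam t x ξ := by
    rw [← integral_conj, ← integral_neg_eq_self]
    congr 1
    funext ξ
    simp only [kernelIntegrand, ← Complex.exp_conj, map_add, map_mul, map_neg, Complex.conj_ofReal,
      Complex.conj_I, norm_neg, inner_neg_right, Complex.ofReal_neg, mul_neg, neg_mul, neg_neg]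
  have hre := Complex.conj_eq_iff_re.mp key
  rw [fundamentalSolution, Complex.ofReal_mul, hre]
  push_cast
  rfl

/-- The solution `u(·, t) = G_{N,lam}(·, t) ∗ χ_Ω` of `u_t = -Δ²u + lam Δu` with initial value the
indicator function of `Ω`. -/
def cauchySolution {N : ℕ} (lam : ℝ) (Ω : Set (EuclideanSpace ℝ (Fin N)))
    (x : EuclideanSpace ℝ (Fin N)) (t : ℝ) : ℝ :=
  ∫ y : EuclideanSpace ℝ (Fin N),
    fundamentalSolution lam (x - y) t * Ω.indicator (fun _ => (1 : ℝ)) y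

/-- `u_a(x, t) = u(x, a⁴ t)`. -/
def rescaledSolution {N : ℕ} (lam : ℝ) (Ω : Set (EuclideanSpace ℝ (Fin N))) (a : ℝ)
    (x : EuclideanSpace ℝ (Fin N)) (t : ℝ) : ℝ :=
  cauchySolution lam Ω x (a ^ 4 * t)

/-- The threshold function `U = u_{3a} - 3 u_{2a} + 3 u_a`. -/
def thresholdFunction {N : ℕ} (lam : ℝ) (Ω : Set (EuclideanSpace ℝ (Fin N))) (a : ℝ)
    (x : EuclideanSpace ℝ (Fin N)) (t : ℝ) : ℝ :=
  rescaledSolution lam Ω (3 * a) x t - 3 * rescaledSolution lam Ω (2 * a) x t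
    + 3 * rescaledSolution lam Ω a x t

/-- The thresholded set `Ω(t) = {x | U(x, t) ≥ 1/2}`. -/
def thresholdSet {N : ℕ} (lam : ℝ) (Ω : Set (EuclideanSpace ℝ (Fin N))) (a t : ℝ) :
    Set (EuclideanSpace ℝ (Fin N)) :=
  {x | thresholdFunction lam Ω a x t ≥ 1 / 2}

open Classical in
/-- The signed distance to `∂Ω`, nonnegative on `Ω` and nonpositive off `Ω`. -/
def signedDistBoundary {N : ℕ} (Ω : Set (EuclideanSpace ℝ (Fin N)))
    (y : EuclideanSpace ℝ (Fin N)) : ℝ :=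
  if y ∈ Ω then Metric.infDist y (frontier Ω) else -Metric.infDist y (frontier Ω)

end

/-!
The interface moves only by `O(t)` because the combination `3 u_a - 3 u_{2a} + u_{3a}` cancels the
first two curvature terms of the expansion of `u` at a boundary point.

Write `h = a t^{1/4}`. By scaling, `u(x, (b h)⁴)` is the integral of the self-similar kernel
`profile 0 (lam (b h)²)` over the blow-up `{z | x + b h z ∈ Ω₀}`, and up to `O(h⁴)` this kernel is
`mainProfile + lam (b h)² correctionProfile` (`profile_expansion`). Near a boundary point the blow-up
is the region below a graph, and a volume-preserving shear (`setIntegral_subgraph_eq`) turns it into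
a half-space while the kernel is displaced by the blown-up graph. Comparing that graph with its
tangent plane gives, at scale `b h`, a polynomial `β₁ (b h) + β₂ (b h)²` plus a remainder `O(h³)`
(`FlatGraph.exists_abs_sub_quadratic_le`). The weights `c_b = 3, -3, 1` for `b = 1, 2, 3` satisfy
`∑ c_b = 1` and `∑ c_b b = ∑ c_b b² = 0`, so the polynomial disappears, and with it the constant term
of the correction, whose factor is `b² h²`. If `τ` is the height of the graph over `x` in units of
`h`, what remains is
`U = 1/2 + halfSpaceThreshold (c τ) + O(h³ + h min(|τ|, 1))` with `c` bounded above and below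
(`FlatGraph.exists_abs_graphIntegral_sub_le`).

The function `halfSpaceThreshold` is one-dimensional and explicit, and the decisive fact is that it
vanishes only at the origin, with nonzero slope, and stays away from zero at infinity
(`exists_le_halfSpaceThreshold`). The kernel of `∂ₜ + ∂ₓ⁴` changes sign, so this needs quantitative
bounds for its tail `lineTail`: power series bounds on `[0, 4]`, and beyond `4` the monotonicity of
two quadratic forms in the solutions of the third-order equation satisfied by the profile
(`abs_lineTail_le_of_four_le`). Consequently `U(x, t) = 1/2` forces `|τ| = O(h³)`, hence a distance
`O(h⁴) = O(t)` to the boundary. Away from the boundary `U` is close to `0` or `1`, and compactness of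
the boundary makes all constants uniform. The frontier of the thresholded set lies in `{U = 1/2}`
because `U` is continuous.
-/

open scoped SchwartzMap FourierTransform LineDeriv

/-! ### The symbol and its uniform decay -/

section Kernel

set_option linter.unusedSectionVars false

variable {V : Type*} [NormedAddCommGroup V] [InnerProductSpace ℝ V]

/-- The real exponent of the symbol `exp (-(|ξ|⁴ + μ |ξ|²))`, at `ξ = 2π η`. -/
noncomputable def symbolExponent (μ : ℝ) (η : V) : ℝ :=
  -((2 * Real.pi) ^ 4 * (‖η‖ ^ 2) ^ 2) + -(μ * ((2 * Real.pi) ^ 2 * ‖η‖ ^ 2))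

theorem symbolExponent_le {K μ : ℝ} (hμ : |μ| ≤ K) (η : V) :
    symbolExponent μ η ≤ (K + 1) ^ 2 + 1 - ‖η‖ := by
  have h1 : -(μ * ((2 * Real.pi) ^ 2 * ‖η‖ ^ 2)) ≤ K * ((2 * Real.pi) ^ 2 * ‖η‖ ^ 2) := by
    have : -μ ≤ K := by linarith [neg_abs_le μ]
    have h2 : 0 ≤ (2 * Real.pi) ^ 2 * ‖η‖ ^ 2 := by positivity
    nlinarith
  have hr : (1 : ℝ) ≤ (2 * Real.pi) ^ 2 := by nlinarith [Real.pi_gt_three]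
  set w := (2 * Real.pi) ^ 2 * ‖η‖ ^ 2 with hw
  have hw1 : ‖η‖ ^ 2 ≤ w := by rw [hw]; nlinarith [sq_nonneg ‖η‖]
  have h3 : (2 * Real.pi) ^ 4 * (‖η‖ ^ 2) ^ 2 = w ^ 2 := by rw [hw]; ring
  rw [symbolExponent, h3]
  nlinarith [sq_nonneg (w - (K + 1) / 2), sq_nonneg (‖η‖ - 1 / 2), sq_nonneg (‖η‖ - 1)]

theorem contDiff_symbolExponent (μ : ℝ) : ContDiff ℝ ⊤ (symbolExponent (V := V) μ) := by
  unfold symbolExponent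
  have := contDiff_norm_sq ℝ (E := V) (n := ⊤)
  fun_prop

theorem norm_iteratedFDeriv_symbolExponent_le (n : ℕ) (K : ℝ) :
    ∃ (k : ℕ) (C : ℝ), 1 ≤ C ∧ ∀ μ : ℝ, |μ| ≤ K → ∀ i ≤ n, ∀ η : V,
      ‖iteratedFDeriv ℝ i (symbolExponent μ) η‖ ≤ C * (1 + ‖η‖) ^ k := by
  have hsq := Function.hasTemperateGrowth_norm_sq V
  have hA : Function.HasTemperateGrowth
      (fun η : V => (-(2 * Real.pi) ^ 4 : ℝ) * (‖η‖ ^ 2) ^ 2) :=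
    (Function.HasTemperateGrowth.const _).mul (hsq.pow 2)
  have hB : Function.HasTemperateGrowth (fun η : V => ((2 * Real.pi) ^ 2 : ℝ) * ‖η‖ ^ 2) :=
    (Function.HasTemperateGrowth.const _).mul hsq
  obtain ⟨k₁, C₁, hC₁, h₁⟩ := hA.norm_iteratedFDeriv_le_uniform n
  obtain ⟨k₂, C₂, hC₂, h₂⟩ := hB.norm_iteratedFDeriv_le_uniform n
  refine ⟨k₁ + k₂, C₁ + |K| * C₂ + 1, by nlinarith [mul_nonneg (abs_nonneg K) hC₂], ?_⟩
  intro μ hμ i hi η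
  have e : symbolExponent (V := V) μ = (fun η : V => (-(2 * Real.pi) ^ 4 : ℝ) * (‖η‖ ^ 2) ^ 2)
      + (-μ) • (fun η : V => ((2 * Real.pi) ^ 2 : ℝ) * ‖η‖ ^ 2) := by
    funext η
    simp only [symbolExponent, Pi.add_apply, Pi.smul_apply, smul_eq_mul]
    ring
  have cA : ContDiffAt ℝ i (fun η : V => (-(2 * Real.pi) ^ 4 : ℝ) * (‖η‖ ^ 2) ^ 2) η :=
    (hA.1.of_le (by exact_mod_cast le_top)).contDiffAt
  have cB : ContDiffAt ℝ i (fun η : V => ((2 * Real.pi) ^ 2 : ℝ) * ‖η‖ ^ 2) η :=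
    (hB.1.of_le (by exact_mod_cast le_top)).contDiffAt
  have cB' : ContDiffAt ℝ i ((-μ) • (fun η : V => ((2 * Real.pi) ^ 2 : ℝ) * ‖η‖ ^ 2)) η :=
    cB.const_smul (-μ)
  rw [e, iteratedFDeriv_add_apply cA cB', iteratedFDeriv_const_smul_apply cB]
  have hx : (1 : ℝ) ≤ 1 + ‖η‖ := by linarith [norm_nonneg η]
  have hKμ : |μ| ≤ |K| := hμ.trans (le_abs_self K)
  calc _ ≤ C₁ * (1 + ‖η‖) ^ k₁ + |K| * (C₂ * (1 + ‖η‖) ^ k₂) := by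
        refine (norm_add_le _ _).trans (add_le_add (h₁ i hi η) ?_)
        rw [norm_smul, norm_neg, Real.norm_eq_abs]
        exact mul_le_mul hKμ (h₂ i hi η) (norm_nonneg _) (abs_nonneg _)
    _ ≤ C₁ * (1 + ‖η‖) ^ (k₁ + k₂) + |K| * (C₂ * (1 + ‖η‖) ^ (k₁ + k₂)) := by
        gcongr <;> first | exact hx | omega
    _ ≤ _ := by
        have : 0 ≤ (1 + ‖η‖) ^ (k₁ + k₂) := by positivity
        nlinarith

/-- The symbol `exp (-(|ξ|⁴ + μ |ξ|²))` at `ξ = 2π η`, as a complex-valued function. -/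
noncomputable def symbolFun (μ : ℝ) (η : V) : ℂ := (Real.exp (symbolExponent μ η) : ℝ)

theorem contDiff_symbolFun (μ : ℝ) : ContDiff ℝ ⊤ (symbolFun (V := V) μ) :=
  Complex.ofRealCLM.contDiff.comp (Real.contDiff_exp.comp (contDiff_symbolExponent μ))

theorem one_add_pow_mul_exp_neg_le (m : ℕ) {r : ℝ} (hr : 0 ≤ r) :
    (1 + r) ^ m * Real.exp (-r) ≤ m.factorial * Real.exp 1 := by
  have h := Real.pow_div_factorial_le_exp (1 + r) (by linarith) m
  rw [div_le_iff₀ (by positivity), Real.exp_add] at h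
  have := mul_le_mul_of_nonneg_right h (Real.exp_pos (-r)).le
  rw [Real.exp_neg] at this ⊢
  have he := Real.exp_pos r
  calc _ ≤ _ := this
    _ = _ := by field_simp

/-- All Schwartz seminorms of the symbol are bounded locally uniformly in the parameter `μ`. -/
theorem symbolFun_decay (K : ℝ) (k n : ℕ) : ∃ C : ℝ, ∀ μ : ℝ, |μ| ≤ K → ∀ η : V,
    ‖η‖ ^ k * ‖iteratedFDeriv ℝ n (symbolFun μ) η‖ ≤ C := by
  obtain ⟨l, C, hC, h⟩ := norm_iteratedFDeriv_symbolExponent_le (V := V) n K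
  refine ⟨n.factorial * C ^ n * Real.exp ((K + 1) ^ 2 + 1) *
    ((k + l * n).factorial * Real.exp 1), fun μ hμ η => ?_⟩
  have hx : (1 : ℝ) ≤ 1 + ‖η‖ := by linarith [norm_nonneg η]
  have hD : 1 ≤ C * (1 + ‖η‖) ^ l := one_le_mul_of_one_le_of_one_le hC (one_le_pow₀ hx)
  have e1 : ‖iteratedFDeriv ℝ n (symbolFun μ) η‖ =
      ‖iteratedFDeriv ℝ n (Real.exp ∘ symbolExponent μ) η‖ :=
    (Complex.ofRealLI).norm_iteratedFDeriv_comp_left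
      (Real.contDiff_exp.comp (contDiff_symbolExponent μ)).contDiffAt (n := ⊤)
      (by exact_mod_cast le_top)
  have e2 : ‖iteratedFDeriv ℝ n (Real.exp ∘ symbolExponent μ) η‖ ≤
      n.factorial * Real.exp (symbolExponent μ η) * (C * (1 + ‖η‖) ^ l) ^ n := by
    refine norm_iteratedFDeriv_comp_le (N := ⊤) Real.contDiff_exp (contDiff_symbolExponent μ)
      (by exact_mod_cast le_top) η ?_ ?_
    · intro i _
      rw [norm_iteratedFDeriv_eq_norm_iteratedDeriv, iteratedDeriv_eq_iterate,
        Real.iter_deriv_exp, Real.norm_eq_abs, Real.abs_exp]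
    · intro i hi1 hi
      refine (h μ hμ i hi η).trans ?_
      exact le_self_pow₀ hD (by omega)
  have e3 : Real.exp (symbolExponent μ η) ≤ Real.exp ((K + 1) ^ 2 + 1) * Real.exp (-‖η‖) := by
    rw [← Real.exp_add]
    exact Real.exp_le_exp.2 ((symbolExponent_le hμ η).trans (by linarith))
  have e4 := one_add_pow_mul_exp_neg_le (k + l * n) (norm_nonneg η)
  rw [e1]
  calc _ ≤ (1 + ‖η‖) ^ k * (n.factorial * (Real.exp ((K + 1) ^ 2 + 1) * Real.exp (-‖η‖)) *
        (C * (1 + ‖η‖) ^ l) ^ n) := by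
        refine mul_le_mul (pow_le_pow_left₀ (norm_nonneg _) (by linarith) k) (e2.trans ?_)
          (norm_nonneg _) (by positivity)
        gcongr
    _ = n.factorial * C ^ n * Real.exp ((K + 1) ^ 2 + 1) *
        ((1 + ‖η‖) ^ (k + l * n) * Real.exp (-‖η‖)) := by
        rw [pow_add, pow_mul]; ring
    _ ≤ _ := by
        gcongr

/-- The symbol `exp (-(|ξ|⁴ + μ |ξ|²))`, `ξ = 2π η`, as a Schwartz function. -/
noncomputable def symbolSchwartz (μ : ℝ) : 𝓢(V, ℂ) where
  toFun := symbolFun μ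
  smooth' := (contDiff_symbolFun μ).of_le (by exact_mod_cast le_top)
  decay' k n := (symbolFun_decay |μ| k n).imp fun _ h => h μ le_rfl

theorem symbolSchwartz_apply (μ : ℝ) (η : V) : symbolSchwartz μ η = symbolFun μ η := rfl

theorem seminorm_symbolSchwartz_le (K : ℝ) (k n : ℕ) : ∃ C : ℝ, 0 ≤ C ∧ ∀ μ : ℝ, |μ| ≤ K →
    SchwartzMap.seminorm ℝ k n (symbolSchwartz (V := V) μ) ≤ C := by
  obtain ⟨C, hC⟩ := symbolFun_decay (V := V) K k n
  refine ⟨max C 0, le_max_right _ _, fun μ hμ => ?_⟩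
  exact SchwartzMap.seminorm_le_bound ℝ k n _ (le_max_right _ _)
    fun η => (hC μ hμ η).trans (le_max_left _ _)

/-- A continuous linear map of Schwartz spaces maps the symbols to functions with decay that is
locally uniform in `μ`. -/
theorem decay_of_clm_symbolSchwartz (L : 𝓢(V, ℂ) →L[ℝ] 𝓢(V, ℂ)) (K : ℝ) (M : ℕ) :
    ∃ C : ℝ, 0 ≤ C ∧ ∀ μ : ℝ, |μ| ≤ K → ∀ z : V,
      (1 + ‖z‖) ^ M * ‖L (symbolSchwartz μ) z‖ ≤ C := by
  have key : ∀ k n : ℕ, ∃ C : ℝ, 0 ≤ C ∧ ∀ μ : ℝ, |μ| ≤ K →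
      SchwartzMap.seminorm ℝ k n (L (symbolSchwartz (V := V) μ)) ≤ C := by
    intro k n
    have hcont : Continuous ((SchwartzMap.seminorm ℝ k n).comp (L : 𝓢(V, ℂ) →ₗ[ℝ] 𝓢(V, ℂ))) :=
      ((schwartz_withSeminorms ℝ V ℂ).continuous_seminorm (k, n)).comp L.continuous
    obtain ⟨s, C, -, hs⟩ := Seminorm.bound_of_continuous (schwartz_withSeminorms ℝ V ℂ) _ hcont
    choose D hD0 hD using fun p : ℕ × ℕ => seminorm_symbolSchwartz_le (V := V) K p.1 p.2
    refine ⟨C * ∑ p ∈ s, D p, mul_nonneg C.2 (Finset.sum_nonneg fun p _ => hD0 p), fun μ hμ => ?_⟩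
    have h1 := hs (symbolSchwartz (V := V) μ)
    refine h1.trans ?_
    have h2 : (s.sup (schwartzSeminormFamily ℝ V ℂ)) (symbolSchwartz μ) ≤ ∑ p ∈ s, D p := by
      refine Seminorm.finset_sup_apply_le (Finset.sum_nonneg fun p _ => hD0 p) fun p hp => ?_
      exact (hD p μ hμ).trans (Finset.single_le_sum (fun i _ => hD0 i) hp)
    exact mul_le_mul_of_nonneg_left h2 C.2
  choose D hD0 hD using key
  refine ⟨2 ^ M * ∑ p ∈ Finset.Iic (M, 0), D p.1 p.2,
    mul_nonneg (by positivity) (Finset.sum_nonneg fun p _ => hD0 _ _), fun μ hμ z => ?_⟩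
  have h := SchwartzMap.one_add_le_sup_seminorm_apply (𝕜 := ℝ) (m := (M, 0)) (k := M) (n := 0)
    le_rfl le_rfl (L (symbolSchwartz μ)) z
  rw [norm_iteratedFDeriv_zero] at h
  refine h.trans ?_
  gcongr
  refine Seminorm.finset_sup_apply_le (Finset.sum_nonneg fun i _ => hD0 _ _) fun p hp => ?_
  exact (hD p.1 p.2 μ hμ).trans
    (Finset.single_le_sum (f := fun p : ℕ × ℕ => D p.1 p.2) (fun i _ => hD0 _ _) hp)

end Kernel

/-! ### Taylor estimates on an interval -/

section Taylor

/-- One step of a Taylor estimate: integrate a bound `B |s| ^ k` for the derivative. -/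
theorem abs_le_mul_abs_pow_succ {f f' : ℝ → ℝ} {δ B : ℝ} {k : ℕ}
    (hf : ∀ s ∈ Set.uIcc 0 δ, HasDerivAt f (f' s) s) (h0 : f 0 = 0)
    (hB : ∀ s ∈ Set.uIcc 0 δ, |f' s| ≤ B * |s| ^ k) :
    ∀ s ∈ Set.uIcc 0 δ, |f s| ≤ B * |s| ^ (k + 1) := by
  intro s hs
  have hsub : Set.uIcc 0 s ⊆ Set.uIcc 0 δ := Set.uIcc_subset_uIcc_left hs
  have hB0 : 0 ≤ B * |s| ^ k := (abs_nonneg _).trans (hB s hs)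
  have h := (convex_uIcc (0 : ℝ) s).norm_image_sub_le_of_norm_hasDerivWithin_le
    (f := f) (f' := f') (C := B * |s| ^ k)
    (fun x hx => (hf x (hsub hx)).hasDerivWithinAt) (fun x hx => ?_)
    Set.left_mem_uIcc Set.right_mem_uIcc
  · rw [h0, sub_zero, sub_zero, Real.norm_eq_abs, Real.norm_eq_abs] at h
    rw [pow_succ, ← mul_assoc]; exact h
  · rw [Real.norm_eq_abs]
    refine (hB x (hsub hx)).trans ?_
    have hxs : |x| ≤ |s| := by
      have := Set.abs_sub_left_of_mem_uIcc hx
      simpa using this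
    rcases (abs_nonneg s).eq_or_lt with h | h
    · have : |x| = |s| := le_antisymm hxs (h ▸ abs_nonneg x)
      rw [this]
    · have : 0 ≤ B := by
        by_contra hneg
        have : B * |s| ^ k < 0 := mul_neg_of_neg_of_pos (not_le.1 hneg) (by positivity)
        linarith
      gcongr

theorem abs_sub_le_of_hasDerivAt {f f₁ : ℝ → ℝ} {δ B : ℝ}
    (h0 : ∀ s ∈ Set.uIcc 0 δ, HasDerivAt f (f₁ s) s) (hB : ∀ s ∈ Set.uIcc 0 δ, |f₁ s| ≤ B) :
    ∀ s ∈ Set.uIcc 0 δ, |f s - f 0| ≤ B * |s| := by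
  have := abs_le_mul_abs_pow_succ (f := fun s => f s - f 0) (f' := f₁) (δ := δ) (B := B) (k := 0)
    (fun s hs => (h0 s hs).sub_const _) (by simp) (by simpa using hB)
  simpa using this

theorem abs_taylor_two_le {f f₁ f₂ : ℝ → ℝ} {δ B : ℝ}
    (h0 : ∀ s ∈ Set.uIcc 0 δ, HasDerivAt f (f₁ s) s)
    (h1 : ∀ s ∈ Set.uIcc 0 δ, HasDerivAt f₁ (f₂ s) s)
    (hB : ∀ s ∈ Set.uIcc 0 δ, |f₂ s| ≤ B) :
    ∀ s ∈ Set.uIcc 0 δ, |f s - f 0 - s * f₁ 0| ≤ B * |s| ^ 2 := by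
  refine abs_le_mul_abs_pow_succ (f := fun s => f s - f 0 - s * f₁ 0)
    (f' := fun s => f₁ s - f₁ 0) (k := 1) (fun s hs => ?_) (by simp) ?_
  · exact (((h0 s hs).sub_const _).sub ((hasDerivAt_id s).mul_const (f₁ 0))).congr_deriv (by simp)
  · simpa using abs_sub_le_of_hasDerivAt h1 hB

theorem abs_taylor_three_le {f f₁ f₂ f₃ : ℝ → ℝ} {δ B : ℝ}
    (h0 : ∀ s ∈ Set.uIcc 0 δ, HasDerivAt f (f₁ s) s)
    (h1 : ∀ s ∈ Set.uIcc 0 δ, HasDerivAt f₁ (f₂ s) s)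
    (h2 : ∀ s ∈ Set.uIcc 0 δ, HasDerivAt f₂ (f₃ s) s)
    (hB : ∀ s ∈ Set.uIcc 0 δ, |f₃ s| ≤ B) :
    ∀ s ∈ Set.uIcc 0 δ, |f s - f 0 - s * f₁ 0 - s ^ 2 / 2 * f₂ 0| ≤ B * |s| ^ 3 := by
  refine abs_le_mul_abs_pow_succ (f := fun s => f s - f 0 - s * f₁ 0 - s ^ 2 / 2 * f₂ 0)
    (f' := fun s => f₁ s - f₁ 0 - s * f₂ 0) (k := 2) (fun s hs => ?_) (by simp)
    (abs_taylor_two_le h1 h2 hB)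
  have := (((h0 s hs).sub_const (f 0)).sub ((hasDerivAt_id s).mul_const (f₁ 0))).sub
    ((((hasDerivAt_id s).pow 2).div_const 2).mul_const (f₂ 0))
  refine this.congr_deriv ?_
  simp

theorem abs_taylor_four_le {f f₁ f₂ f₃ f₄ : ℝ → ℝ} {δ B : ℝ}
    (h0 : ∀ s ∈ Set.uIcc 0 δ, HasDerivAt f (f₁ s) s)
    (h1 : ∀ s ∈ Set.uIcc 0 δ, HasDerivAt f₁ (f₂ s) s)
    (h2 : ∀ s ∈ Set.uIcc 0 δ, HasDerivAt f₂ (f₃ s) s)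
    (h3 : ∀ s ∈ Set.uIcc 0 δ, HasDerivAt f₃ (f₄ s) s)
    (hB : ∀ s ∈ Set.uIcc 0 δ, |f₄ s| ≤ B) :
    ∀ s ∈ Set.uIcc 0 δ,
      |f s - f 0 - s * f₁ 0 - s ^ 2 / 2 * f₂ 0 - s ^ 3 / 6 * f₃ 0| ≤ B * |s| ^ 4 := by
  refine abs_le_mul_abs_pow_succ
    (f := fun s => f s - f 0 - s * f₁ 0 - s ^ 2 / 2 * f₂ 0 - s ^ 3 / 6 * f₃ 0)
    (f' := fun s => f₁ s - f₁ 0 - s * f₂ 0 - s ^ 2 / 2 * f₃ 0) (k := 3) (fun s hs => ?_) (by simp)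
    (abs_taylor_three_le h1 h2 h3 hB)
  have := ((((h0 s hs).sub_const (f 0)).sub ((hasDerivAt_id s).mul_const (f₁ 0))).sub
    ((((hasDerivAt_id s).pow 2).div_const 2).mul_const (f₂ 0))).sub
    ((((hasDerivAt_id s).pow 3).div_const 6).mul_const (f₃ 0))
  refine this.congr_deriv ?_
  simp only [id]
  push_cast
  ring

end Taylor

/-! ### The self-similar profile -/

section Profile

variable {V : Type*} [NormedAddCommGroup V] [InnerProductSpace ℝ V]

/-- The weight `|ξ|²` at `ξ = 2π η`. -/
noncomputable def sqWeight (η : V) : ℝ := (2 * Real.pi) ^ 2 * ‖η‖ ^ 2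

theorem hasTemperateGrowth_sqWeight : (sqWeight (V := V)).HasTemperateGrowth :=
  (Function.HasTemperateGrowth.const _).mul (Function.hasTemperateGrowth_norm_sq V)

/-- The weighted symbol `|ξ| ^ (2 j) exp (-(|ξ|⁴ + μ |ξ|²))`, `ξ = 2π η`, as a Schwartz function. -/
noncomputable def weightedSymbol (j : ℕ) (μ : ℝ) : 𝓢(V, ℂ) :=
  ((SchwartzMap.smulLeftCLM ℂ (sqWeight (V := V))) ^ j) (symbolSchwartz μ)

theorem weightedSymbol_apply (j : ℕ) (μ : ℝ) (η : V) :
    weightedSymbol j μ η = ((sqWeight η ^ j * Real.exp (symbolExponent μ η) : ℝ) : ℂ) := by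
  induction j with
  | zero => simp [weightedSymbol, symbolSchwartz_apply, symbolFun]
  | succ j ih =>
    have : weightedSymbol (V := V) (j + 1) μ =
        SchwartzMap.smulLeftCLM ℂ sqWeight (weightedSymbol j μ) := by
      rw [weightedSymbol, pow_succ', mul_apply_eq_comp]; rfl
    rw [this, SchwartzMap.smulLeftCLM_apply_apply hasTemperateGrowth_sqWeight, ih, pow_succ']
    simp [mul_assoc]

variable [FiniteDimensional ℝ V] [MeasurableSpace V] [BorelSpace V]

/-- The self-similar profile `(2π) ^ (-dim V) ∫ |ξ| ^ (2 j) exp (-(|ξ|⁴ + μ |ξ|²) + i ⟨z, ξ⟩) dξ`, as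
the inverse Fourier transform (in Mathlib's normalization) of the weighted symbol. -/
noncomputable def profile (j : ℕ) (μ : ℝ) : 𝓢(V, ℂ) := 𝓕⁻ (weightedSymbol j μ : 𝓢(V, ℂ))

theorem profile_apply (j : ℕ) (μ : ℝ) (z : V) :
    profile j μ z = ∫ η : V, Complex.exp (↑(2 * Real.pi * inner ℝ η z) * Complex.I) •
      weightedSymbol j μ η := by
  rw [profile, SchwartzMap.fourierInv_coe, Real.fourierInv_eq']

theorem profile_decay (j : ℕ) (K : ℝ) (M : ℕ) : ∃ C : ℝ, 0 ≤ C ∧ ∀ μ : ℝ, |μ| ≤ K → ∀ z : V,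
    (1 + ‖z‖) ^ M * ‖profile j μ z‖ ≤ C :=
  decay_of_clm_symbolSchwartz ((FourierTransform.fourierInvCLM ℝ 𝓢(V, ℂ)).comp
    ((SchwartzMap.smulLeftCLM ℂ (sqWeight (V := V))) ^ j)) K M

theorem profile_neg (j : ℕ) (μ : ℝ) (z : V) : profile j μ (-z) = profile j μ z := by
  rw [profile_apply, profile_apply, ← integral_neg_eq_self]
  congr 1
  funext η
  simp [weightedSymbol_apply, symbolExponent, sqWeight]

theorem conj_profile (j : ℕ) (μ : ℝ) (z : V) :
    (starRingEnd ℂ) (profile j μ z) = profile j μ z := by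
  conv_rhs => rw [← profile_neg]
  rw [profile_apply, profile_apply, ← integral_conj]
  congr 1
  funext η
  rw [weightedSymbol_apply]
  simp [← Complex.exp_conj, map_ofNat]

theorem ofReal_re_profile (j : ℕ) (μ : ℝ) (z : V) : ((profile j μ z).re : ℂ) = profile j μ z :=
  Complex.conj_eq_iff_re.mp (conj_profile j μ z)

theorem fourier_profile (j : ℕ) (μ : ℝ) : 𝓕 (profile (V := V) j μ) = weightedSymbol j μ :=
  FourierTransform.fourier_fourierInv_eq _

theorem hasDerivAt_profile_param (j : ℕ) (μ : ℝ) (z : V) :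
    HasDerivAt (fun μ => profile j μ z) (-profile (j + 1) μ z) μ := by
  simp_rw [profile_apply]
  rw [← integral_neg]
  set K := |μ| + 1
  have hs : Metric.ball μ 1 ∈ nhds μ := Metric.ball_mem_nhds _ one_pos
  have hmono : ∀ x ∈ Metric.ball μ 1, ∀ η : V,
      symbolExponent x η ≤ symbolExponent (-K) η := by
    intro x hx η
    have h1 : -K ≤ x := by
      rw [Metric.mem_ball, Real.dist_eq] at hx
      have := neg_abs_le μ
      have := (abs_lt.1 hx).1
      simp only [K]; linarith
    have h2 : 0 ≤ (2 * Real.pi) ^ 2 * ‖η‖ ^ 2 := by positivity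
    simp only [symbolExponent]
    nlinarith
  have hc : ∀ z : V, Continuous fun η : V =>
      Complex.exp (↑(2 * Real.pi * inner ℝ η z) * Complex.I) := by intro z; fun_prop
  have hn : ∀ η : V, ‖Complex.exp (↑(2 * Real.pi * inner ℝ η z) * Complex.I)‖ = 1 :=
    fun η => Complex.norm_exp_ofReal_mul_I _
  refine (hasDerivAt_integral_of_dominated_loc_of_deriv_le (s := Metric.ball μ 1)
    (bound := fun η => ‖weightedSymbol (j + 1) (-K) η‖)
    (F' := fun x η => -(Complex.exp (↑(2 * Real.pi * inner ℝ η z) * Complex.I) •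
      weightedSymbol (j + 1) x η)) hs ?_ ?_ ?_ ?_ ?_ ?_).2
  · exact Filter.Eventually.of_forall fun x =>
      ((hc z).smul (weightedSymbol j x).continuous).aestronglyMeasurable
  · refine ((weightedSymbol (V := V) j μ).integrable (μ := volume)).norm.mono'
      ((hc z).smul (weightedSymbol j μ).continuous).aestronglyMeasurable
      (Filter.Eventually.of_forall fun η => ?_)
    rw [norm_smul, hn, one_mul]
  · exact ((hc z).smul (weightedSymbol (j + 1) μ).continuous).neg.aestronglyMeasurable
  · refine Filter.Eventually.of_forall fun η x hx => ?_
    rw [norm_neg, norm_smul, hn, one_mul, weightedSymbol_apply, weightedSymbol_apply,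
      Complex.norm_real, Complex.norm_real, norm_mul, norm_mul, Real.norm_eq_abs (Real.exp _),
      Real.norm_eq_abs (Real.exp _), Real.abs_exp, Real.abs_exp]
    gcongr
    exact hmono x hx η
  · exact ((weightedSymbol (V := V) (j + 1) (-K)).integrable (μ := volume)).norm
  · refine Filter.Eventually.of_forall fun η x hx => ?_
    simp_rw [weightedSymbol_apply]
    have h1 : HasDerivAt (fun x => symbolExponent x η) (-sqWeight η) x := by
      simp only [symbolExponent, sqWeight]
      simpa using ((hasDerivAt_id x).mul_const ((2 * Real.pi) ^ 2 * ‖η‖ ^ 2)).neg.const_add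
        (-((2 * Real.pi) ^ 4 * (‖η‖ ^ 2) ^ 2))
    have h2 := ((h1.exp.const_mul (sqWeight η ^ j)).ofReal_comp).const_smul
      (Complex.exp (↑(2 * Real.pi * inner ℝ η z) * Complex.I))
    refine h2.congr_deriv ?_
    simp only [smul_eq_mul]
    push_cast
    ring

/-- Second-order expansion of the profile in the parameter `μ`, with a rapidly decaying error. -/
theorem profile_expansion (M : ℕ) : ∃ C : ℝ, 0 ≤ C ∧ ∀ μ : ℝ, |μ| ≤ 1 → ∀ z : V,
    (1 + ‖z‖) ^ M * |(profile 0 μ z).re - (profile 0 0 z).re + μ * (profile 1 0 z).re|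
      ≤ C * μ ^ 2 := by
  obtain ⟨C, hC, h⟩ := profile_decay (V := V) 2 1 M
  refine ⟨C, hC, fun μ hμ z => ?_⟩
  have hd : ∀ j x, HasDerivAt (fun μ => (profile j μ z).re) (-(profile (j + 1) x z).re) x := by
    intro j x
    exact (Complex.reCLM.hasFDerivAt.comp_hasDerivAt x (hasDerivAt_profile_param j x z)).congr_deriv
      (by simp)
  have hp : 0 < (1 + ‖z‖) ^ M := by positivity
  have h2 := abs_taylor_two_le (f := fun μ => (profile 0 μ z).re)
    (f₁ := fun μ => -(profile 1 μ z).re) (f₂ := fun μ => (profile 2 μ z).re) (δ := μ)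
    (B := C / (1 + ‖z‖) ^ M) (fun s _ => hd 0 s)
    (fun s _ => (hd 1 s).neg.congr_deriv (by simp)) (fun s hs => ?_) μ Set.right_mem_uIcc
  · rw [sq_abs] at h2
    rw [mul_comm, ← le_div_iff₀ hp, mul_div_right_comm]
    have e : ∀ x : ℝ, x - μ * -(profile 1 0 z).re = x + μ * (profile 1 0 z).re := fun x => by ring
    rw [e] at h2
    exact h2
  · rw [le_div_iff₀ hp, mul_comm]
    have hs1 : |s| ≤ 1 := by
      have := Set.abs_sub_left_of_mem_uIcc hs
      simp at this; linarith
    refine le_trans ?_ (h s hs1 z)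
    gcongr
    exact Complex.abs_re_le_norm _

end Profile

/-! ### Scaling of the fundamental solution -/

section Scaling

variable {N : ℕ}

/-- At time `h⁴` the fundamental solution is the profile rescaled by `h`, with parameter `lam h²`. -/
theorem fundamentalSolution_eq_profile (lam : ℝ) (x : EuclideanSpace ℝ (Fin N)) {h : ℝ}
    (hh : 0 < h) :
    fundamentalSolution lam x (h ^ 4) =
      (h ^ N)⁻¹ * (profile 0 (lam * h ^ 2) (h⁻¹ • x)).re := by
  have hpi := Real.pi_pos
  have h1 := Measure.integral_comp_smul (volume : Measure (EuclideanSpace ℝ (Fin N)))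
    (kernelIntegrand lam (h ^ 4) x) (2 * Real.pi / h)
  have hR : 0 < (2 * Real.pi / h) ^ N := by positivity
  rw [finrank_euclideanSpace_fin, abs_of_pos (inv_pos.2 hR)] at h1
  have h2 : ∫ η, kernelIntegrand lam (h ^ 4) x ((2 * Real.pi / h) • η) =
      profile 0 (lam * h ^ 2) (h⁻¹ • x) := by
    rw [profile_apply]
    congr 1
    funext η
    rw [weightedSymbol_apply, kernelIntegrand, symbolExponent, smul_eq_mul, pow_zero, one_mul,
      Complex.ofReal_exp, ← Complex.exp_add]
    congr 1
    rw [norm_smul, Real.norm_of_nonneg (by positivity), inner_smul_right, inner_smul_right,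
      real_inner_comm]
    have : (h : ℂ) ≠ 0 := by exact_mod_cast hh.ne'
    push_cast
    field_simp
    ring
  rw [h2] at h1
  rw [h1, fundamentalSolution, Complex.smul_re, smul_eq_mul, div_pow]
  field_simp

/-- The solution at time `h⁴` averages the datum, blown up around `x` at scale `h`, against the
profile. -/
theorem cauchySolution_eq_integral_profile (lam : ℝ) (Ω : Set (EuclideanSpace ℝ (Fin N)))
    (x : EuclideanSpace ℝ (Fin N)) {h : ℝ} (hh : 0 < h) :
    cauchySolution lam Ω x (h ^ 4) =
      ∫ z, (profile 0 (lam * h ^ 2) z).re * Ω.indicator (fun _ => (1 : ℝ)) (x + h • z) := by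
  have hN : 0 < h ^ N := by positivity
  rw [cauchySolution, ← integral_add_left_eq_self _ x]
  have h1 := Measure.integral_comp_smul (volume : Measure (EuclideanSpace ℝ (Fin N)))
    (fun y => fundamentalSolution lam (x - (x + y)) (h ^ 4) *
      Ω.indicator (fun _ => (1 : ℝ)) (x + y)) h
  rw [finrank_euclideanSpace_fin, abs_of_pos (inv_pos.2 hN), smul_eq_mul, eq_comm,
    inv_mul_eq_iff_eq_mul₀ hN.ne', ← integral_const_mul] at h1
  rw [h1]
  congr 1
  funext z
  rw [fundamentalSolution_eq_profile lam _ hh]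
  have : h⁻¹ • (x - (x + h • z)) = -z := by
    rw [sub_add_cancel_left, smul_neg, smul_smul, inv_mul_cancel₀ hh.ne', one_smul]
  rw [this, profile_neg]
  field_simp

end Scaling

/-! ### Marginals of the leading profile -/

section Marginal

variable {V : Type*} [NormedAddCommGroup V] [InnerProductSpace ℝ V] [FiniteDimensional ℝ V]
  [MeasurableSpace V] [BorelSpace V]

theorem integral_map_withDensity_ofReal {F : V → ℝ} (hF : Continuous F)
    {L : V → ℝ} (hL : Continuous L) {φ : ℝ → ℂ} (hφ : Measurable φ) :
    ∫ s, φ s ∂((volume.withDensity fun z => ENNReal.ofReal (F z)).map L) =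
      ∫ z, ((max (F z) 0 : ℝ) : ℂ) * φ (L z) := by
  rw [integral_map hL.aemeasurable hφ.aestronglyMeasurable,
    integral_withDensity_eq_integral_toReal_smul (by fun_prop) (by simp)]
  simp_rw [ENNReal.toReal_ofReal', Complex.real_smul]

theorem integrable_max_mul {F : V → ℝ} (hF : Continuous F) (hFi : Integrable F)
    {L : V → ℝ} (hL : Continuous L) {φ : ℝ → ℂ} (hφ : Measurable φ) (hb : ∀ s, ‖φ s‖ ≤ 1) :
    Integrable fun z => ((max (F z) 0 : ℝ) : ℂ) * φ (L z) := by
  have hm : Measurable fun z => ((max (F z) 0 : ℝ) : ℂ) * φ (L z) :=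
    (Complex.measurable_ofReal.comp (hF.measurable.max measurable_const)).mul
      (hφ.comp hL.measurable)
  refine hFi.norm.mono' hm.aestronglyMeasurable (Filter.Eventually.of_forall fun z => ?_)
  rw [norm_mul, Complex.norm_real, Real.norm_eq_abs, Real.norm_eq_abs]
  calc _ ≤ |F z| * 1 := by
        refine mul_le_mul ?_ (hb _) (norm_nonneg _) (abs_nonneg _)
        · rw [abs_of_nonneg (le_max_right (F z) 0)]
          exact max_le (le_abs_self _) (abs_nonneg _)
    _ = _ := mul_one _

/-- Two integrable densities, one on `V` and one on `ℝ`, with matching Fourier transforms along a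
linear functional have the same mass on sublevel sets of that functional. The densities may change
sign, so positive and negative parts are moved to opposite sides to get finite measures. -/
theorem setIntegral_inner_le_eq {F : V → ℝ} {G : ℝ → ℝ} (hF : Continuous F) (hFi : Integrable F)
    (hG : Continuous G) (hGi : Integrable G) (n : V)
    (h : ∀ t : ℝ, ∫ z, (F z : ℂ) * Complex.exp (t * (inner ℝ n z : ℝ) * Complex.I) =
      ∫ s, (G s : ℂ) * Complex.exp (t * s * Complex.I)) (τ : ℝ) :
    ∫ z in {z | inner ℝ n z ≤ τ}, F z = ∫ s in Set.Iic τ, G s := by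
  have hL : Continuous fun z : V => (inner ℝ n z : ℝ) := by fun_prop
  have fin1 := isFiniteMeasure_withDensity_ofReal hFi.2
  have fin2 := isFiniteMeasure_withDensity_ofReal hGi.2
  have fin3 := isFiniteMeasure_withDensity_ofReal hFi.neg.2
  have fin4 := isFiniteMeasure_withDensity_ofReal hGi.neg.2
  set A₁ := (volume.withDensity fun z => ENNReal.ofReal (F z)).map fun z => (inner ℝ n z : ℝ)
  set A₂ := (volume.withDensity fun z => ENNReal.ofReal (-G z)).map fun s : ℝ => s
  set B₁ := (volume.withDensity fun z => ENNReal.ofReal (-F z)).map fun z => (inner ℝ n z : ℝ)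
  set B₂ := (volume.withDensity fun z => ENNReal.ofReal (G z)).map fun s : ℝ => s
  have i1 : IsFiniteMeasure A₁ := by dsimp [A₁]; infer_instance
  have i2 : IsFiniteMeasure A₂ := by
    have : IsFiniteMeasure (volume.withDensity fun z => ENNReal.ofReal (-G z)) := fin4
    dsimp [A₂]; infer_instance
  have i3 : IsFiniteMeasure B₁ := by
    have : IsFiniteMeasure (volume.withDensity fun z => ENNReal.ofReal (-F z)) := fin3
    dsimp [B₁]; infer_instance
  have i4 : IsFiniteMeasure B₂ := by dsimp [B₂]; infer_instance
  -- Bounded test functions see the difference of the two measures only through `F` and `G`. The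
  -- identity is used for characters and for the indicator of a half-line.
  have key : ∀ φ : ℝ → ℂ, Measurable φ → (∀ s, ‖φ s‖ ≤ 1) →
      (∫ s, φ s ∂(A₁ + A₂) - ∫ s, φ s ∂(B₁ + B₂) =
        (∫ z, (F z : ℂ) * φ (inner ℝ n z)) - ∫ s, (G s : ℂ) * φ s) := by
    intro φ hφ hb
    have hint : ∀ (ν : Measure ℝ) [IsFiniteMeasure ν], Integrable φ ν := fun ν _ =>
      (integrable_const (1 : ℝ)).mono' hφ.aestronglyMeasurable (Filter.Eventually.of_forall hb)
    have e : ∀ x : ℝ, ((max x 0 : ℝ) : ℂ) - ((max (-x) 0 : ℝ) : ℂ) = x := by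
      intro x
      rw [← Complex.ofReal_sub]
      congr 1
      rcases le_total x 0 with hx | hx
      · rw [max_eq_right hx, max_eq_left (by linarith)]; ring
      · rw [max_eq_left hx, max_eq_right (by linarith)]; ring
    have hFd : ∫ z, (F z : ℂ) * φ (inner ℝ n z) = ∫ s, φ s ∂A₁ - ∫ s, φ s ∂B₁ := by
      rw [integral_map_withDensity_ofReal hF hL hφ, integral_map_withDensity_ofReal (F := fun z => -F z) hF.neg hL hφ,
        ← integral_sub (integrable_max_mul hF hFi hL hφ hb)
          (integrable_max_mul (F := fun z => -F z) hF.neg hFi.neg hL hφ hb)]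
      congr 1
      funext z
      rw [← sub_mul, e]
    have hGd : ∫ z, (G z : ℂ) * φ z = ∫ s, φ s ∂B₂ - ∫ s, φ s ∂A₂ := by
      rw [integral_map_withDensity_ofReal hG continuous_id' hφ,
        integral_map_withDensity_ofReal (F := fun z => -G z) hG.neg continuous_id' hφ,
        ← integral_sub (integrable_max_mul hG hGi continuous_id' hφ hb)
          (integrable_max_mul (F := fun z => -G z) hG.neg hGi.neg continuous_id' hφ hb)]
      congr 1
      funext z
      rw [← sub_mul, e]
    rw [integral_add_measure (hint _) (hint _), integral_add_measure (hint _) (hint _), hFd, hGd]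
    ring
  have hAB : A₁ + A₂ = B₁ + B₂ := by
    apply Measure.ext_of_charFun
    funext t
    rw [charFun_apply_real, charFun_apply_real, ← sub_eq_zero, key]
    · rw [sub_eq_zero]; exact h t
    · fun_prop
    · intro s
      rw [show (t : ℂ) * s * Complex.I = ((t * s : ℝ) : ℂ) * Complex.I by push_cast; rfl,
        Complex.norm_exp_ofReal_mul_I]
  have h2 := key ((Set.Iic τ).indicator fun _ => 1)
    (measurable_const.indicator measurableSet_Iic) (fun s => by
      by_cases hs : s ∈ Set.Iic τ <;> simp [hs])
  rw [hAB, sub_self, eq_comm, sub_eq_zero] at h2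
  have e1 : ∫ z, (F z : ℂ) * (Set.Iic τ).indicator (fun _ => (1 : ℂ)) (inner ℝ n z) =
      ((∫ z in {z | inner ℝ n z ≤ τ}, F z : ℝ) : ℂ) := by
    rw [← integral_indicator (measurableSet_le hL.measurable measurable_const), ← integral_complex_ofReal]
    congr 1
    funext z
    by_cases hz : inner ℝ n z ≤ τ <;> simp [hz]
  have e2 : ∫ s, (G s : ℂ) * (Set.Iic τ).indicator (fun _ => (1 : ℂ)) s =
      ((∫ s in Set.Iic τ, G s : ℝ) : ℂ) := by
    rw [← integral_indicator measurableSet_Iic, ← integral_complex_ofReal]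
    congr 1
    funext z
    by_cases hz : z ≤ τ <;> simp [hz]
  rw [e1, e2] at h2
  exact_mod_cast h2

/-- The one-dimensional profile, the fundamental solution of `∂ₜ + ∂ₓ⁴` at time one. -/
noncomputable def lineProfile (s : ℝ) : ℝ := (profile (V := ℝ) 0 0 s).re

/-- The leading profile `F₀` is the fundamental solution of `∂ₜ + Δ²` at time one. -/
noncomputable def mainProfile (z : V) : ℝ := (profile 0 0 z).re

/-- The first-order coefficient in `μ` of the profile. -/
noncomputable def correctionProfile (z : V) : ℝ := -(profile 1 0 z).re

/-- The Fourier transform of `mainProfile` on the line spanned by `n`. It depends on `n` only through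
its norm, so the marginals along unit vectors agree with the one-dimensional profile. -/
theorem integral_mainProfile_mul_exp (n : V) (t : ℝ) :
    ∫ z : V, (mainProfile z : ℂ) * Complex.exp (t * (inner ℝ n z : ℝ) * Complex.I) =
      Real.exp (-(t ^ 4 * ‖n‖ ^ 4)) := by
  have hpi : (Real.pi : ℝ) ≠ 0 := Real.pi_ne_zero
  have h := congrArg (fun f : 𝓢(V, ℂ) => f ((-(t / (2 * Real.pi))) • n)) (fourier_profile 0 0)
  simp only [SchwartzMap.fourier_coe, Real.fourier_eq'] at h
  rw [weightedSymbol_apply, symbolExponent, norm_smul] at h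
  have e : (|t| / (2 * Real.pi) * ‖n‖ : ℝ) ^ 2 = t ^ 2 / (2 * Real.pi) ^ 2 * ‖n‖ ^ 2 := by
    rw [mul_pow, div_pow, sq_abs]
  rw [norm_neg, norm_div, Real.norm_eq_abs t, Real.norm_of_nonneg (by positivity : 0 ≤ 2 * Real.pi),
    e] at h
  have e2 : ∀ z : V, (mainProfile z : ℂ) * Complex.exp (t * (inner ℝ n z : ℝ) * Complex.I) =
      Complex.exp (↑(-2 * Real.pi * inner ℝ z (-(t / (2 * Real.pi)) • n)) * Complex.I) •
        (profile 0 0) z := by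
    intro z
    rw [mainProfile, ofReal_re_profile, inner_smul_right, real_inner_comm, smul_eq_mul, mul_comm]
    congr 3
    rw [← Complex.ofReal_mul]
    congr 1
    field_simp
  simp_rw [e2]
  rw [h, pow_zero, one_mul]
  congr 2
  field_simp
  ring

theorem continuous_mainProfile : Continuous (mainProfile (V := V)) :=
  Complex.continuous_re.comp (profile 0 0).continuous

theorem integrable_mainProfile : Integrable (mainProfile (V := V)) :=
  ((profile (V := V) 0 0).integrable (μ := volume)).re

theorem integrable_correctionProfile : Integrable (correctionProfile (V := V)) :=
  ((profile (V := V) 1 0).integrable (μ := volume)).re.neg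

theorem mainProfile_neg (z : V) : mainProfile (-z) = mainProfile z := by
  rw [mainProfile, mainProfile, profile_neg]

theorem integral_mainProfile : ∫ z : V, mainProfile z = 1 := by
  have h := integral_mainProfile_mul_exp (0 : V) 0
  simp only [Complex.ofReal_zero, zero_mul, Complex.exp_zero, mul_one, integral_complex_ofReal] at h
  simpa using h

theorem setIntegral_mainProfile_inner_le {n : V} (hn : ‖n‖ = 1) (τ : ℝ) :
    ∫ z in {z : V | inner ℝ n z ≤ τ}, mainProfile z = ∫ s in Set.Iic τ, lineProfile s := by
  refine setIntegral_inner_le_eq continuous_mainProfile integrable_mainProfile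
    (continuous_mainProfile (V := ℝ)) (integrable_mainProfile (V := ℝ)) n (fun t => ?_) τ
  rw [integral_mainProfile_mul_exp, hn]
  have := integral_mainProfile_mul_exp (1 : ℝ) t
  simp only [norm_one] at this
  rw [← this]
  congr 1
  funext s
  simp

end Marginal

/-! ### Taylor bounds for the exponential and trigonometric functions -/

section ExpTaylor

/-- Taylor remainder of the exponential on the closed left half-plane. It gives the alternating
bounds for `exp (-x)`, `x ≥ 0`, and those for `cos` and `sin`. -/
theorem norm_exp_sub_sum_le_of_re_nonpos {z : ℂ} (hz : z.re ≤ 0) (n : ℕ) :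
    ‖Complex.exp z - ∑ k ∈ Finset.range n, z ^ k / k.factorial‖ ≤ ‖z‖ ^ n / n.factorial := by
  have key : ∀ n : ℕ, ∀ t ∈ Set.Icc (0 : ℝ) 1,
      ‖Complex.exp (t * z) - ∑ k ∈ Finset.range n, (t * z) ^ k / k.factorial‖ ≤
        (t * ‖z‖) ^ n / n.factorial := by
    intro n
    induction n with
    | zero =>
      intro t ht
      simp only [Finset.range_zero, Finset.sum_empty, sub_zero, pow_zero, Nat.factorial_zero,
        Nat.cast_one, div_one, Complex.norm_exp]
      rw [Real.exp_le_one_iff, Complex.re_ofReal_mul]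
      exact mul_nonpos_of_nonneg_of_nonpos ht.1 hz
    | succ n ih =>
      have hd : ∀ t : ℝ, HasDerivAt
          (fun t : ℝ => Complex.exp (t * z) - ∑ k ∈ Finset.range (n + 1), (t * z) ^ k / k.factorial)
          (z * (Complex.exp (t * z) - ∑ k ∈ Finset.range n, (t * z) ^ k / k.factorial)) t := by
        intro t
        have h1 : HasDerivAt (fun t : ℝ => (t : ℂ) * z) z t := by
          simpa using (Complex.ofRealCLM.hasDerivAt (x := t)).mul_const z
        have h2 : HasDerivAt (fun t : ℝ => ∑ k ∈ Finset.range (n + 1), ((t : ℂ) * z) ^ k / k.factorial)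
            (∑ k ∈ Finset.range (n + 1), (k * ((t : ℂ) * z) ^ (k - 1) * z) / k.factorial) t :=
          HasDerivAt.fun_sum fun k _ => (h1.pow k).div_const _
        refine (h1.cexp.sub h2).congr_deriv ?_
        rw [Finset.sum_range_succ', mul_sub, Finset.mul_sum]
        simp only [Nat.factorial_succ, Nat.cast_mul, Nat.cast_add, Nat.cast_one, Nat.add_sub_cancel,
          Nat.cast_zero, zero_mul, zero_div, add_zero]
        rw [mul_comm (Complex.exp _)]
        congr 1
        refine Finset.sum_congr rfl fun k _ => ?_
        have : (k.factorial : ℂ) ≠ 0 := by exact_mod_cast k.factorial_ne_zero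
        have : (k : ℂ) + 1 ≠ 0 := by exact_mod_cast k.succ_ne_zero
        field_simp
      have hB : ∀ t : ℝ, HasDerivAt (fun t : ℝ => (t * ‖z‖) ^ (n + 1) / (n + 1).factorial)
          (‖z‖ * ((t * ‖z‖) ^ n / n.factorial)) t := by
        intro t
        refine ((((hasDerivAt_id t).mul_const ‖z‖).pow (n + 1)).div_const _).congr_deriv ?_
        simp only [Nat.factorial_succ, Nat.cast_mul, Nat.cast_add, Nat.cast_one, id,
          Nat.add_sub_cancel]
        have : (n.factorial : ℝ) ≠ 0 := by exact_mod_cast n.factorial_ne_zero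
        have : (n : ℝ) + 1 ≠ 0 := by positivity
        field_simp
      refine image_norm_le_of_norm_deriv_right_le_deriv_boundary
        (fun t _ => (hd t).continuousAt.continuousWithinAt)
        (fun t _ => (hd t).hasDerivWithinAt) ?_ hB (fun t ht => ?_)
      · simp [Finset.sum_range_succ']
      · rw [norm_mul]
        exact mul_le_mul_of_nonneg_left (ih t ⟨ht.1, ht.2.le⟩) (norm_nonneg _)
  simpa using key n 1 ⟨zero_le_one, le_rfl⟩

theorem abs_exp_neg_sub_sum_le {x : ℝ} (hx : 0 ≤ x) (n : ℕ) :
    |Real.exp (-x) - ∑ k ∈ Finset.range n, (-x) ^ k / k.factorial| ≤ x ^ n / n.factorial := by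
  have h := norm_exp_sub_sum_le_of_re_nonpos (z := ((-x : ℝ) : ℂ)) (by simpa using hx) n
  rw [Complex.norm_real, Real.norm_eq_abs, abs_neg, abs_of_nonneg hx] at h
  rw [← Real.norm_eq_abs, ← Complex.norm_real]
  push_cast at h ⊢
  exact h

theorem sum_range_two_mul_pow_mul_I (x : ℝ) (n : ℕ) :
    ∑ k ∈ Finset.range (2 * n), ((x : ℂ) * Complex.I) ^ k / (k.factorial : ℂ) =
      (∑ k ∈ Finset.range n, (-1) ^ k * x ^ (2 * k) / (2 * k).factorial : ℝ) +
      (∑ k ∈ Finset.range n, (-1) ^ k * x ^ (2 * k + 1) / (2 * k + 1).factorial : ℝ) *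
        Complex.I := by
  induction n with
  | zero => simp
  | succ n ih =>
    rw [show 2 * (n + 1) = 2 * n + 1 + 1 by ring, Finset.sum_range_succ, Finset.sum_range_succ,
      ih, Finset.sum_range_succ, Finset.sum_range_succ, mul_pow, mul_pow, pow_succ Complex.I,
      pow_mul Complex.I, Complex.I_sq]
    push_cast
    ring

theorem abs_cos_sub_sum_le (x : ℝ) (n : ℕ) :
    |Real.cos x - ∑ k ∈ Finset.range n, (-1) ^ k * x ^ (2 * k) / (2 * k).factorial| ≤
      |x| ^ (2 * n) / (2 * n).factorial := by
  have h := norm_exp_sub_sum_le_of_re_nonpos (z := x * Complex.I) (by simp) (2 * n)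
  refine le_trans ?_ (h.trans_eq (by simp))
  refine le_trans (le_of_eq ?_) (Complex.abs_re_le_norm _)
  rw [Complex.sub_re, Complex.exp_ofReal_mul_I_re, sum_range_two_mul_pow_mul_I, Complex.add_re,
    Complex.ofReal_re, Complex.re_ofReal_mul, Complex.I_re, mul_zero, add_zero]

theorem abs_sin_sub_sum_le (x : ℝ) (n : ℕ) :
    |Real.sin x - ∑ k ∈ Finset.range n, (-1) ^ k * x ^ (2 * k + 1) / (2 * k + 1).factorial| ≤
      |x| ^ (2 * n + 1) / (2 * n + 1).factorial := by
  have h := norm_exp_sub_sum_le_of_re_nonpos (z := x * Complex.I) (by simp) (2 * n + 1)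
  refine le_trans ?_ (h.trans_eq (by simp))
  refine le_trans (le_of_eq ?_) (Complex.abs_im_le_norm _)
  have e : ((x : ℂ) * Complex.I) ^ (2 * n) / ((2 * n).factorial : ℂ) =
      (((-1) ^ n * x ^ (2 * n) / (2 * n).factorial : ℝ) : ℂ) := by
    rw [mul_pow, pow_mul Complex.I, Complex.I_sq]
    push_cast
    ring
  rw [Complex.sub_im, Complex.exp_ofReal_mul_I_im, Finset.sum_range_succ,
    sum_range_two_mul_pow_mul_I, e, Complex.add_im, Complex.add_im, Complex.ofReal_im,
    Complex.im_ofReal_mul, Complex.I_im, Complex.ofReal_im, mul_one, zero_add, add_zero]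

end ExpTaylor

/-! ### Moments of the quartic exponential -/

section QuarticMoments

/-- The quartic weight `exp (-ξ⁴)`. -/
noncomputable def quarticExp (ξ : ℝ) : ℝ := Real.exp (-ξ ^ 4)

theorem continuous_quarticExp : Continuous quarticExp := by unfold quarticExp; fun_prop

theorem quarticExp_pos (ξ : ℝ) : 0 < quarticExp ξ := Real.exp_pos _

theorem hasDerivAt_quarticExp (ξ : ℝ) :
    HasDerivAt quarticExp (-4 * ξ ^ 3 * quarticExp ξ) ξ := by
  refine (((hasDerivAt_id ξ).pow 4).neg.exp).congr_deriv ?_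
  simp [quarticExp]
  ring

theorem integrable_abs_pow_mul_quarticExp (n : ℕ) :
    Integrable fun ξ : ℝ => |ξ| ^ n * quarticExp ξ := by
  have hpi := Real.pi_pos
  have h := ((symbolSchwartz (V := ℝ) 0).integrable_pow_mul (μ := volume) n).comp_smul
    (R := (2 * Real.pi)⁻¹) (by positivity)
  have h2 := h.const_mul ((2 * Real.pi) ^ n)
  refine h2.congr (Filter.Eventually.of_forall fun ξ => ?_)
  simp only [symbolSchwartz_apply, symbolFun, symbolExponent, quarticExp, Complex.norm_real,
    norm_smul, Real.norm_eq_abs, Real.abs_exp]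
  rw [abs_of_pos (by positivity : 0 < (2 * Real.pi)⁻¹)]
  have e : ξ ^ 4 = |ξ| ^ 4 := by rw [← abs_pow, abs_of_nonneg (by positivity)]
  have e2 : ∀ r : ℝ, -((2 * Real.pi) ^ 4 * (((2 * Real.pi)⁻¹ * r) ^ 2) ^ 2) +
      -(0 * ((2 * Real.pi) ^ 2 * ((2 * Real.pi)⁻¹ * r) ^ 2)) = -r ^ 4 := by
    intro r
    field_simp
    ring
  rw [e, e2, ← mul_assoc, ← mul_pow, mul_inv_cancel_left₀ (by positivity)]

theorem integrable_pow_mul_quarticExp (n : ℕ) :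
    Integrable fun ξ : ℝ => ξ ^ n * quarticExp ξ := by
  refine (integrable_abs_pow_mul_quarticExp n).mono'
    (by have := continuous_quarticExp; fun_prop) (Filter.Eventually.of_forall fun ξ => ?_)
  rw [norm_mul, Real.norm_of_nonneg (quarticExp_pos ξ).le, norm_pow, Real.norm_eq_abs]

/-- The moments `∫ ξ ^ n exp (-ξ⁴) dξ`. -/
noncomputable def quarticMoment (n : ℕ) : ℝ := ∫ ξ : ℝ, ξ ^ n * quarticExp ξ

theorem integral_eq_zero_of_integrable_deriv {f f' : ℝ → ℝ} (hd : ∀ x, HasDerivAt f (f' x) x)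
    (hf : Integrable f) (hf' : Integrable f') : ∫ x, f' x = 0 := by
  have h1 := tendsto_zero_of_hasDerivAt_of_integrableOn_Ioi (a := 0) (fun x _ => hd x)
    hf'.integrableOn hf.integrableOn
  have h2 := tendsto_zero_of_hasDerivAt_of_integrableOn_Iic (a := 0) (fun x _ => hd x)
    hf'.integrableOn hf.integrableOn
  simpa using integral_of_hasDerivAt_of_tendsto hd hf' h2 h1

theorem quarticMoment_add_four (n : ℕ) :
    quarticMoment (n + 4) = (n + 1) / 4 * quarticMoment n := by
  have hd : ∀ ξ : ℝ, HasDerivAt (fun ξ => ξ ^ (n + 1) * quarticExp ξ)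
      ((n + 1) * (ξ ^ n * quarticExp ξ) - 4 * (ξ ^ (n + 4) * quarticExp ξ)) ξ := by
    intro ξ
    refine (((hasDerivAt_id ξ).pow (n + 1)).mul (hasDerivAt_quarticExp ξ)).congr_deriv ?_
    simp only [id, Nat.add_sub_cancel, Pi.pow_apply]
    push_cast
    ring
  have i1 := (integrable_pow_mul_quarticExp n).const_mul ((n : ℝ) + 1)
  have i2 := (integrable_pow_mul_quarticExp (n + 4)).const_mul 4
  have h := integral_eq_zero_of_integrable_deriv hd (integrable_pow_mul_quarticExp (n + 1))
    (i1.sub i2)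
  rw [integral_sub i1 i2, integral_const_mul, integral_const_mul] at h
  rw [quarticMoment, quarticMoment]
  linarith

end QuarticMoments

/-! ### The one-dimensional profile -/

section LineProfile

/-- The functions `∫ ξ ^ n exp (-ξ⁴) cos (s ξ) dξ`. -/
noncomputable def cosMoment (n : ℕ) (s : ℝ) : ℝ := ∫ ξ : ℝ, ξ ^ n * quarticExp ξ * Real.cos (s * ξ)

/-- The functions `∫ ξ ^ n exp (-ξ⁴) sin (s ξ) dξ`. -/
noncomputable def sinMoment (n : ℕ) (s : ℝ) : ℝ := ∫ ξ : ℝ, ξ ^ n * quarticExp ξ * Real.sin (s * ξ)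

theorem integrable_pow_mul_quarticExp_mul (n : ℕ) {φ : ℝ → ℝ} (hφ : Continuous φ)
    (hb : ∀ x, |φ x| ≤ 1) : Integrable fun ξ : ℝ => ξ ^ n * quarticExp ξ * φ ξ := by
  have := continuous_quarticExp
  refine (integrable_pow_mul_quarticExp n).norm.mono' (by fun_prop)
    (Filter.Eventually.of_forall fun ξ => ?_)
  rw [norm_mul]
  exact mul_le_of_le_one_right (norm_nonneg _) (hb ξ)

theorem abs_integral_pow_mul_quarticExp_mul_le (n : ℕ) {φ : ℝ → ℝ} (hb : ∀ x, |φ x| ≤ 1) :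
    |∫ ξ : ℝ, ξ ^ n * quarticExp ξ * φ ξ| ≤ ∫ ξ : ℝ, |ξ| ^ n * quarticExp ξ := by
  rw [← Real.norm_eq_abs]
  refine norm_integral_le_of_norm_le (integrable_abs_pow_mul_quarticExp n)
    (Filter.Eventually.of_forall fun ξ => ?_)
  rw [norm_mul, norm_mul, norm_pow, Real.norm_of_nonneg (quarticExp_pos ξ).le, Real.norm_eq_abs]
  exact mul_le_of_le_one_right (by have := quarticExp_pos ξ; positivity) (hb ξ)

theorem hasDerivAt_cosMoment (n : ℕ) (s : ℝ) :
    HasDerivAt (cosMoment n) (-sinMoment (n + 1) s) s := by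
  have hq := continuous_quarticExp
  rw [sinMoment, ← integral_neg]
  refine (hasDerivAt_integral_of_dominated_loc_of_deriv_le (s := Set.univ)
    (bound := fun ξ => |ξ| ^ (n + 1) * quarticExp ξ)
    (F' := fun s ξ => -(ξ ^ (n + 1) * quarticExp ξ * Real.sin (s * ξ)))
    Filter.univ_mem (Filter.Eventually.of_forall fun x => by fun_prop)
    (integrable_pow_mul_quarticExp_mul n (by fun_prop) fun x => Real.abs_cos_le_one _)
    (by fun_prop) (Filter.Eventually.of_forall fun ξ x _ => ?_)
    (integrable_abs_pow_mul_quarticExp (n + 1)) (Filter.Eventually.of_forall fun ξ x _ => ?_)).2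
  · rw [norm_neg, norm_mul, norm_mul, norm_pow, Real.norm_of_nonneg (quarticExp_pos ξ).le,
      Real.norm_eq_abs]
    exact mul_le_of_le_one_right (by have := quarticExp_pos ξ; positivity) (Real.abs_sin_le_one _)
  · refine ((((hasDerivAt_id x).mul_const ξ).cos).const_mul (ξ ^ n * quarticExp ξ)).congr_deriv ?_
    simp only [id]
    ring

theorem hasDerivAt_sinMoment (n : ℕ) (s : ℝ) :
    HasDerivAt (sinMoment n) (cosMoment (n + 1) s) s := by
  have hq := continuous_quarticExp
  rw [cosMoment]
  refine (hasDerivAt_integral_of_dominated_loc_of_deriv_le (s := Set.univ)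
    (bound := fun ξ => |ξ| ^ (n + 1) * quarticExp ξ)
    (F' := fun s ξ => (ξ ^ (n + 1) * quarticExp ξ * Real.cos (s * ξ)))
    Filter.univ_mem (Filter.Eventually.of_forall fun x => by fun_prop)
    (integrable_pow_mul_quarticExp_mul n (by fun_prop) fun x => Real.abs_sin_le_one _)
    (by fun_prop) (Filter.Eventually.of_forall fun ξ x _ => ?_)
    (integrable_abs_pow_mul_quarticExp (n + 1)) (Filter.Eventually.of_forall fun ξ x _ => ?_)).2
  · rw [norm_mul, norm_mul, norm_pow, Real.norm_of_nonneg (quarticExp_pos ξ).le,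
      Real.norm_eq_abs]
    exact mul_le_of_le_one_right (by have := quarticExp_pos ξ; positivity) (Real.abs_cos_le_one _)
  · refine ((((hasDerivAt_id x).mul_const ξ).sin).const_mul (ξ ^ n * quarticExp ξ)).congr_deriv ?_
    simp only [id]
    ring

/-- Integration by parts turns the third derivative of the profile into the profile itself. -/
theorem sinMoment_three (s : ℝ) : sinMoment 3 s = s / 4 * cosMoment 0 s := by
  have hd : ∀ ξ : ℝ, HasDerivAt (fun ξ => ξ ^ 0 * quarticExp ξ * Real.sin (s * ξ))
      (s * (ξ ^ 0 * quarticExp ξ * Real.cos (s * ξ)) -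
        4 * (ξ ^ 3 * quarticExp ξ * Real.sin (s * ξ))) ξ := by
    intro ξ
    refine (((hasDerivAt_quarticExp ξ).const_mul 1).mul
      (((hasDerivAt_id ξ).const_mul s).sin)).congr_deriv ?_
    simp only [id]
    ring
  have i1 := (integrable_pow_mul_quarticExp_mul 0 (φ := fun ξ => Real.cos (s * ξ)) (by fun_prop)
    fun x => Real.abs_cos_le_one _).const_mul s
  have i2 := (integrable_pow_mul_quarticExp_mul 3 (φ := fun ξ => Real.sin (s * ξ)) (by fun_prop)
    fun x => Real.abs_sin_le_one _).const_mul 4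
  have h := integral_eq_zero_of_integrable_deriv hd
    (integrable_pow_mul_quarticExp_mul 0 (φ := fun ξ => Real.sin (s * ξ)) (by fun_prop)
      fun x => Real.abs_sin_le_one _) (i1.sub i2)
  rw [integral_sub i1 i2, integral_const_mul, integral_const_mul] at h
  rw [sinMoment, cosMoment]
  linarith

theorem lineProfile_eq_cosMoment (s : ℝ) : lineProfile s = (2 * Real.pi)⁻¹ * cosMoment 0 s := by
  have hpi := Real.pi_pos
  have hint : Integrable fun η : ℝ => Complex.exp (↑(2 * Real.pi * inner ℝ η s) * Complex.I) •
      weightedSymbol 0 0 η := by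
    refine ((weightedSymbol (V := ℝ) 0 0).integrable (μ := volume)).norm.mono'
      (Continuous.aestronglyMeasurable ((by fun_prop :
        Continuous fun η : ℝ => Complex.exp (↑(2 * Real.pi * inner ℝ η s) * Complex.I)).smul
        (weightedSymbol 0 0).continuous)) (Filter.Eventually.of_forall fun η => ?_)
    rw [norm_smul, Complex.norm_exp_ofReal_mul_I, one_mul]
  rw [lineProfile, profile_apply, ← RCLike.re_eq_complex_re, ← integral_re hint]
  have h := Measure.integral_comp_smul (volume : Measure ℝ)
    (fun ξ : ℝ => ξ ^ 0 * quarticExp ξ * Real.cos (s * ξ)) (2 * Real.pi)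
  rw [Module.finrank_self, pow_one, abs_of_pos (by positivity), smul_eq_mul] at h
  rw [cosMoment, ← h]
  congr 1
  funext η
  rw [weightedSymbol_apply, smul_eq_mul, RCLike.re_eq_complex_re, Complex.re_mul_ofReal,
    Complex.exp_ofReal_mul_I_re]
  simp only [symbolExponent, quarticExp, smul_eq_mul, pow_zero, one_mul, Real.norm_eq_abs, sq_abs,
    zero_mul, neg_zero, add_zero, RCLike.inner_apply, conj_trivial]
  rw [mul_comm]
  congr 2 <;> ring

end LineProfile

/-! ### The tail of the one-dimensional profile -/

section LineTail

theorem continuous_lineProfile : Continuous lineProfile := continuous_mainProfile (V := ℝ)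

theorem integrable_lineProfile : Integrable lineProfile := integrable_mainProfile (V := ℝ)

theorem lineProfile_neg (s : ℝ) : lineProfile (-s) = lineProfile s := mainProfile_neg (V := ℝ) s

theorem integral_lineProfile : ∫ s, lineProfile s = 1 := integral_mainProfile (V := ℝ)

/-- The tail `∫_s^∞` of the one-dimensional profile. -/
noncomputable def lineTail (s : ℝ) : ℝ := ∫ σ in Set.Ioi s, lineProfile σ

theorem integral_Iic_lineProfile (s : ℝ) : ∫ σ in Set.Iic s, lineProfile σ = 1 - lineTail s := by
  rw [← integral_lineProfile, lineTail, eq_sub_iff_add_eq,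
    intervalIntegral.integral_Iic_add_Ioi integrable_lineProfile.integrableOn
      integrable_lineProfile.integrableOn]

theorem lineTail_neg (s : ℝ) : lineTail (-s) = 1 - lineTail s := by
  rw [← integral_Iic_lineProfile, lineTail, ← integral_comp_neg_Iic]
  simp_rw [lineProfile_neg]

theorem lineTail_zero : lineTail 0 = 1 / 2 := by
  have := lineTail_neg 0
  rw [neg_zero] at this
  linarith

theorem hasDerivAt_lineTail (s : ℝ) : HasDerivAt lineTail (-lineProfile s) s := by
  have e : lineTail = fun s => lineTail 0 - ∫ σ in (0 : ℝ)..s, lineProfile σ := by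
    funext s
    rw [lineTail, lineTail, ← intervalIntegral.integral_Ioi_sub_Ioi' integrable_lineProfile.integrableOn
      integrable_lineProfile.integrableOn]
    ring
  rw [e]
  exact (intervalIntegral.integral_hasDerivAt_right
    integrable_lineProfile.intervalIntegrable
    (continuous_lineProfile.stronglyMeasurableAtFilter _ _)
    continuous_lineProfile.continuousAt).const_sub _

/-- The tail is `O(1 / s)`, by the first moment of the profile. -/
theorem abs_lineTail_le : ∃ K : ℝ, 0 ≤ K ∧ ∀ s : ℝ, 0 ≤ s → s * |lineTail s| ≤ K := by
  have hi : Integrable fun s : ℝ => |s| * |lineProfile s| := by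
    have h := (profile (V := ℝ) 0 0).integrable_pow_mul (μ := volume) 1
    refine h.mono' ((continuous_abs.mul continuous_lineProfile.abs).aestronglyMeasurable)
      (Filter.Eventually.of_forall fun s => ?_)
    rw [Real.norm_of_nonneg (by positivity), pow_one, Real.norm_eq_abs]
    gcongr
    exact Complex.abs_re_le_norm _
  refine ⟨∫ s : ℝ, |s| * |lineProfile s|, integral_nonneg fun s => by positivity, fun s hs => ?_⟩
  calc s * |lineTail s| = ‖∫ σ in Set.Ioi s, s * lineProfile σ‖ := by
        rw [integral_const_mul, norm_mul, Real.norm_of_nonneg hs]; rfl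
    _ ≤ ∫ σ in Set.Ioi s, |σ| * |lineProfile σ| := by
        refine norm_integral_le_of_norm_le hi.integrableOn ?_
        refine (ae_restrict_iff' measurableSet_Ioi).2 (Filter.Eventually.of_forall fun σ hσ => ?_)
        rw [norm_mul, Real.norm_of_nonneg hs, Real.norm_eq_abs]
        gcongr
        exact (le_of_lt hσ).trans (le_abs_self σ)
    _ ≤ _ := setIntegral_le_integral hi (Filter.Eventually.of_forall fun s => by positivity)

theorem tendsto_lineTail : Filter.Tendsto lineTail Filter.atTop (nhds 0) := by
  obtain ⟨K, hK, h⟩ := abs_lineTail_le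
  have h1 : Filter.Tendsto (fun s : ℝ => K / s) Filter.atTop (nhds 0) :=
    Filter.tendsto_id.const_div_atTop K
  refine squeeze_zero_norm' ?_ h1
  filter_upwards [Filter.eventually_gt_atTop 0] with s hs
  rw [Real.norm_eq_abs, le_div_iff₀ hs, mul_comm]
  exact h s hs.le

theorem tendsto_mul_lineTail_sq :
    Filter.Tendsto (fun s => s * lineTail s ^ 2) Filter.atTop (nhds 0) := by
  obtain ⟨K, hK, h⟩ := abs_lineTail_le
  have h1 : Filter.Tendsto (fun s : ℝ => K * |lineTail s|) Filter.atTop (nhds 0) := by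
    simpa using (tendsto_lineTail.abs.const_mul K)
  refine squeeze_zero_norm' ?_ h1
  filter_upwards [Filter.eventually_gt_atTop 0] with s hs
  rw [norm_mul, norm_pow, Real.norm_of_nonneg hs.le, Real.norm_eq_abs, sq, ← mul_assoc]
  gcongr
  exact h s hs.le

theorem tendsto_lineProfile : Filter.Tendsto lineProfile Filter.atTop (nhds 0) := by
  have h := (profile (V := ℝ) 0 0).tendsto_cocompact
  have h2 := (Complex.continuous_re.tendsto 0).comp (h.mono_left atTop_le_cocompact)
  exact h2

/-- Partial sums of the power series of `cosMoment n`. The parity of `n` makes the weight `ξ ^ n`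
nonnegative, so that the error is again a moment. -/
theorem abs_cosMoment_sub_sum_le {n : ℕ} (hn : Even n) (s : ℝ) (p : ℕ) :
    |cosMoment n s - ∑ k ∈ Finset.range p,
      (-1) ^ k * s ^ (2 * k) / (2 * k).factorial * quarticMoment (n + 2 * k)| ≤
      |s| ^ (2 * p) / (2 * p).factorial * quarticMoment (n + 2 * p) := by
  have hi : ∀ k : ℕ, Integrable fun ξ : ℝ =>
      (-1) ^ k * s ^ (2 * k) / (2 * k).factorial * (ξ ^ (n + 2 * k) * quarticExp ξ) :=
    fun k => (integrable_pow_mul_quarticExp (n + 2 * k)).const_mul _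
  have hc := integrable_pow_mul_quarticExp_mul n (φ := fun ξ => Real.cos (s * ξ)) (by fun_prop)
    fun x => Real.abs_cos_le_one _
  simp_rw [cosMoment, quarticMoment, ← integral_const_mul]
  rw [← integral_finsetSum _ fun k _ => hi k, ← integral_sub hc (integrable_finsetSum _ fun k _ => hi k),
    ← Real.norm_eq_abs]
  refine norm_integral_le_of_norm_le ((integrable_pow_mul_quarticExp (n + 2 * p)).const_mul _)
    (Filter.Eventually.of_forall fun ξ => ?_)
  have e : ξ ^ n * quarticExp ξ * Real.cos (s * ξ) - ∑ k ∈ Finset.range p,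
      (-1) ^ k * s ^ (2 * k) / (2 * k).factorial * (ξ ^ (n + 2 * k) * quarticExp ξ) =
      ξ ^ n * quarticExp ξ * (Real.cos (s * ξ) - ∑ k ∈ Finset.range p,
        (-1) ^ k * (s * ξ) ^ (2 * k) / (2 * k).factorial) := by
    rw [mul_sub, Finset.mul_sum]
    congr 1
    refine Finset.sum_congr rfl fun k _ => ?_
    rw [mul_pow, pow_add]; ring
  have hq := (quarticExp_pos ξ).le
  have hξ := hn.pow_nonneg ξ
  rw [e, norm_mul, Real.norm_of_nonneg (mul_nonneg hξ hq)]
  refine (mul_le_mul_of_nonneg_left (abs_cos_sub_sum_le (s * ξ) p) (mul_nonneg hξ hq)).trans_eq ?_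
  rw [abs_mul, mul_pow, pow_mul |ξ|, sq_abs, ← pow_mul ξ, pow_add]
  ring

theorem abs_sinMoment_sub_sum_le {n : ℕ} (hn : Odd n) (s : ℝ) (p : ℕ) :
    |sinMoment n s - ∑ k ∈ Finset.range p,
      (-1) ^ k * s ^ (2 * k + 1) / (2 * k + 1).factorial * quarticMoment (n + (2 * k + 1))| ≤
      |s| ^ (2 * p + 1) / (2 * p + 1).factorial * quarticMoment (n + (2 * p + 1)) := by
  have hi : ∀ k : ℕ, Integrable fun ξ : ℝ => (-1) ^ k * s ^ (2 * k + 1) / (2 * k + 1).factorial *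
      (ξ ^ (n + (2 * k + 1)) * quarticExp ξ) :=
    fun k => (integrable_pow_mul_quarticExp (n + (2 * k + 1))).const_mul _
  have hc := integrable_pow_mul_quarticExp_mul n (φ := fun ξ => Real.sin (s * ξ)) (by fun_prop)
    fun x => Real.abs_sin_le_one _
  simp_rw [sinMoment, quarticMoment, ← integral_const_mul]
  rw [← integral_finsetSum _ fun k _ => hi k, ← integral_sub hc (integrable_finsetSum _ fun k _ => hi k),
    ← Real.norm_eq_abs]
  refine norm_integral_le_of_norm_le ((integrable_pow_mul_quarticExp (n + (2 * p + 1))).const_mul _)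
    (Filter.Eventually.of_forall fun ξ => ?_)
  have e : ξ ^ n * quarticExp ξ * Real.sin (s * ξ) - ∑ k ∈ Finset.range p,
      (-1) ^ k * s ^ (2 * k + 1) / (2 * k + 1).factorial * (ξ ^ (n + (2 * k + 1)) * quarticExp ξ) =
      ξ ^ n * quarticExp ξ * (Real.sin (s * ξ) - ∑ k ∈ Finset.range p,
        (-1) ^ k * (s * ξ) ^ (2 * k + 1) / (2 * k + 1).factorial) := by
    rw [mul_sub, Finset.mul_sum]
    congr 1
    refine Finset.sum_congr rfl fun k _ => ?_
    rw [mul_pow, pow_add]; ring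
  have hq := (quarticExp_pos ξ).le
  have hodd : Odd (2 * p + 1) := odd_two_mul_add_one p
  have hξ : |ξ| ^ n * |ξ| ^ (2 * p + 1) = ξ ^ (n + (2 * p + 1)) := by
    rw [← pow_add, ← abs_pow, abs_of_nonneg ((hn.add_odd hodd).pow_nonneg ξ)]
  rw [e, norm_mul, norm_mul, norm_pow, Real.norm_of_nonneg hq, Real.norm_eq_abs]
  refine (mul_le_mul_of_nonneg_left (abs_sin_sub_sum_le (s * ξ) p) (by positivity)).trans_eq ?_
  rw [abs_mul, mul_pow, ← hξ]
  ring

/-- Partial sums of the power series of the tail, by integrating those of `cosMoment 0`. -/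
theorem abs_lineTail_sub_sum_le {s : ℝ} (hs : 0 ≤ s) (p : ℕ) :
    |2 * Real.pi * (1 / 2 - lineTail s) - ∑ k ∈ Finset.range p,
      (-1) ^ k * s ^ (2 * k + 1) / (2 * k + 1).factorial * quarticMoment (2 * k)| ≤
      s ^ (2 * p + 1) / (2 * p + 1).factorial * quarticMoment (2 * p) := by
  have hpi := Real.pi_pos
  have hpow : ∀ (k : ℕ) (x : ℝ), HasDerivAt (fun x : ℝ => x ^ (2 * k + 1) / (2 * k + 1).factorial)
      (x ^ (2 * k) / (2 * k).factorial) x := by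
    intro k x
    refine ((hasDerivAt_pow (2 * k + 1) x).div_const _).congr_deriv ?_
    rw [Nat.factorial_succ]
    have : ((2 * k).factorial : ℝ) ≠ 0 := by exact_mod_cast (2 * k).factorial_ne_zero
    push_cast
    have : (2 * (k : ℝ) + 1) ≠ 0 := by positivity
    field_simp
  have hd : ∀ x, HasDerivAt (fun s => 2 * Real.pi * (1 / 2 - lineTail s) - ∑ k ∈ Finset.range p,
      (-1) ^ k * s ^ (2 * k + 1) / (2 * k + 1).factorial * quarticMoment (2 * k))
      (cosMoment 0 x - ∑ k ∈ Finset.range p,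
      (-1) ^ k * x ^ (2 * k) / (2 * k).factorial * quarticMoment (0 + 2 * k)) x := by
    intro x
    have h1 := ((hasDerivAt_lineTail x).const_sub (1 / 2)).const_mul (2 * Real.pi)
    refine (h1.sub (HasDerivAt.fun_sum (u := Finset.range p)
      (A := fun k s => (-1) ^ k * s ^ (2 * k + 1) / (2 * k + 1).factorial * quarticMoment (2 * k))
      (A' := fun k => (-1) ^ k * x ^ (2 * k) / (2 * k).factorial * quarticMoment (2 * k))
      fun k _ => ?_)).congr_deriv ?_
    · have := ((hpow k x).const_mul ((-1) ^ k)).mul_const (quarticMoment (2 * k))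
      simp only [mul_div_assoc] at this ⊢
      exact this
    · rw [lineProfile_eq_cosMoment]
      simp only [zero_add]
      field_simp
  have hB : ∀ x, HasDerivAt (fun s : ℝ => s ^ (2 * p + 1) / (2 * p + 1).factorial * quarticMoment (2 * p))
      (x ^ (2 * p) / (2 * p).factorial * quarticMoment (2 * p)) x :=
    fun x => (hpow p x).mul_const _
  refine image_norm_le_of_norm_deriv_right_le_deriv_boundary (a := 0) (b := s)
    (fun x _ => (hd x).continuousAt.continuousWithinAt) (fun x _ => (hd x).hasDerivWithinAt)
    ?_ hB (fun x hx => ?_) ⟨hs, le_rfl⟩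
  · simp [lineTail_zero]
  · have h := abs_cosMoment_sub_sum_le (n := 0) (by simp) x p
    rw [abs_of_nonneg hx.1, zero_add] at h
    exact h

end LineTail

/-! ### Numerical values of the moments -/

section Numerics

theorem abs_intervalIntegral_pow_mul_quarticExp_sub_le {L : ℝ} (hL : 0 ≤ L) (p n : ℕ) :
    |(∫ x in (0 : ℝ)..L, x ^ p * quarticExp x) - ∑ k ∈ Finset.range n,
      (-1) ^ k / k.factorial * (L ^ (4 * k + p + 1) / (4 * k + p + 1 : ℕ))| ≤
      1 / n.factorial * (L ^ (4 * n + p + 1) / (4 * n + p + 1 : ℕ)) := by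
  have hq := continuous_quarticExp
  have hint : ∀ m : ℕ, ∫ x in (0 : ℝ)..L, x ^ m = L ^ (m + 1) / (m + 1 : ℕ) := by
    intro m; rw [integral_pow]; simp
  have hsum : ∑ k ∈ Finset.range n, (-1) ^ k / k.factorial *
      (L ^ (4 * k + p + 1) / (4 * k + p + 1 : ℕ)) =
      ∫ x in (0 : ℝ)..L, ∑ k ∈ Finset.range n, (-1) ^ k / k.factorial * x ^ (4 * k + p) := by
    rw [intervalIntegral.integral_finsetSum fun k _ => by
      exact (by fun_prop : Continuous fun x : ℝ => (-1) ^ k / (k.factorial : ℝ) * x ^ (4 * k + p)).intervalIntegrable _ _]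
    refine Finset.sum_congr rfl fun k _ => ?_
    rw [intervalIntegral.integral_const_mul, hint]
  rw [hsum, ← intervalIntegral.integral_sub
      ((by fun_prop : Continuous fun x : ℝ => x ^ p * quarticExp x).intervalIntegrable _ _)
      ((by fun_prop : Continuous fun x : ℝ => ∑ k ∈ Finset.range n,
        (-1) ^ k / (k.factorial : ℝ) * x ^ (4 * k + p)).intervalIntegrable _ _), ← hint,
    ← intervalIntegral.integral_const_mul, ← Real.norm_eq_abs]
  refine intervalIntegral.norm_integral_le_of_norm_le hL (Filter.Eventually.of_forall fun x hx => ?_)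
    ((by fun_prop : Continuous fun x : ℝ => 1 / (n.factorial : ℝ) * x ^ (4 * n + p)).intervalIntegrable _ _)
  have hx0 : 0 ≤ x := hx.1.le
  have h := abs_exp_neg_sub_sum_le (x := x ^ 4) (by positivity) n
  have e : x ^ p * quarticExp x - ∑ k ∈ Finset.range n, (-1) ^ k / (k.factorial : ℝ) * x ^ (4 * k + p)
      = x ^ p * (Real.exp (-x ^ 4) - ∑ k ∈ Finset.range n, (-x ^ 4) ^ k / k.factorial) := by
    rw [mul_sub, Finset.mul_sum, quarticExp]
    congr 1
    refine Finset.sum_congr rfl fun k _ => ?_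
    rw [pow_add, pow_mul, neg_pow (x ^ 4)]; ring
  rw [e, norm_mul, norm_pow, Real.norm_of_nonneg hx0, Real.norm_eq_abs]
  refine (mul_le_mul_of_nonneg_left h (by positivity)).trans_eq ?_
  rw [pow_add, pow_mul]; ring

theorem setIntegral_Ioi_pow_mul_quarticExp_le {L : ℝ} (hL : 0 < L) {p : ℕ} (hp : p ≤ 3) :
    ∫ x in Set.Ioi L, x ^ p * quarticExp x ≤ quarticExp L / (4 * L ^ (3 - p)) := by
  have hd : ∀ x ∈ Set.Ici L, HasDerivAt (fun x => -quarticExp x / 4) (x ^ 3 * quarticExp x) x := by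
    intro x _
    refine ((hasDerivAt_quarticExp x).neg.div_const 4).congr_deriv ?_
    ring
  have hlim : Filter.Tendsto (fun x => -quarticExp x / 4) Filter.atTop (nhds 0) := by
    have h1 : Filter.Tendsto quarticExp Filter.atTop (nhds 0) :=
      Real.tendsto_exp_atBot.comp (Filter.tendsto_neg_atTop_atBot.comp
        (Filter.tendsto_pow_atTop (by norm_num)))
    simpa using (h1.neg.div_const 4)
  have h3 := integral_Ioi_of_hasDerivAt_of_tendsto' hd
    (integrable_pow_mul_quarticExp 3).integrableOn hlim
  have hle : ∫ x in Set.Ioi L, x ^ p * quarticExp x ≤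
      ∫ x in Set.Ioi L, (L ^ (3 - p))⁻¹ * (x ^ 3 * quarticExp x) := by
    refine setIntegral_mono_on (integrable_pow_mul_quarticExp p).integrableOn
      ((integrable_pow_mul_quarticExp 3).const_mul _).integrableOn measurableSet_Ioi fun x hx => ?_
    have hx' : L < x := hx
    have hx0 : 0 < x := hL.trans hx'
    have e : x ^ 3 = x ^ (3 - p) * x ^ p := by rw [← pow_add]; congr 1; omega
    rw [e, mul_assoc, ← mul_assoc, ← div_eq_inv_mul]
    refine le_mul_of_one_le_left (by have := quarticExp_pos x; positivity) ?_
    rw [one_le_div (by positivity)]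
    gcongr
  rw [integral_const_mul, h3] at hle
  refine hle.trans_eq ?_
  field_simp
  ring

/-- Enclosure of an even moment: term-by-term integration of the exponential series on `[0, L]`, and
comparison with `x³ exp (-x⁴)`, which has an explicit primitive, on `[L, ∞)`. -/
theorem quarticMoment_bounds {p : ℕ} (hp : Even p) (hp3 : p ≤ 3) {L : ℝ} (hL : 0 < L) (n : ℕ) :
    2 * (∑ k ∈ Finset.range n, (-1) ^ k / k.factorial *
      (L ^ (4 * k + p + 1) / (4 * k + p + 1 : ℕ)) -
        1 / n.factorial * (L ^ (4 * n + p + 1) / (4 * n + p + 1 : ℕ))) ≤ quarticMoment p ∧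
    quarticMoment p ≤ 2 * (∑ k ∈ Finset.range n, (-1) ^ k / k.factorial *
      (L ^ (4 * k + p + 1) / (4 * k + p + 1 : ℕ)) +
        1 / n.factorial * (L ^ (4 * n + p + 1) / (4 * n + p + 1 : ℕ)) +
        quarticExp L / (4 * L ^ (3 - p))) := by
  have h1 : quarticMoment p = 2 * ∫ x in Set.Ioi (0 : ℝ), x ^ p * quarticExp x := by
    rw [← integral_comp_abs (f := fun x => x ^ p * quarticExp x), quarticMoment]
    congr 1
    funext x
    rw [hp.pow_abs, quarticExp, quarticExp, Even.pow_abs (by decide : Even 4)]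
  have h2 : ∫ x in Set.Ioi (0 : ℝ), x ^ p * quarticExp x =
      (∫ x in (0 : ℝ)..L, x ^ p * quarticExp x) + ∫ x in Set.Ioi L, x ^ p * quarticExp x := by
    rw [← intervalIntegral.integral_Ioi_sub_Ioi' (integrable_pow_mul_quarticExp p).integrableOn
      (integrable_pow_mul_quarticExp p).integrableOn]
    ring
  have h3 := abs_le.1 (abs_intervalIntegral_pow_mul_quarticExp_sub_le hL.le p n)
  have h4 := setIntegral_Ioi_pow_mul_quarticExp_le hL hp3
  have h5 : 0 ≤ ∫ x in Set.Ioi L, x ^ p * quarticExp x :=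
    setIntegral_nonneg measurableSet_Ioi fun x hx =>
      mul_nonneg (hp.pow_nonneg x) (quarticExp_pos x).le
  rw [h1, h2]
  constructor <;> linarith [h3.1, h3.2]

theorem quarticExp_seven_fourths_le : quarticExp (7 / 4) ≤ 1 / 8000 := by
  have h1 : quarticExp (7 / 4) ≤ Real.exp (-9) := by
    unfold quarticExp
    exact Real.exp_le_exp.2 (by norm_num)
  refine h1.trans ?_
  rw [Real.exp_neg, ← one_div]
  have h2 : (8000 : ℝ) ≤ Real.exp 9 := by
    have h := Real.exp_one_gt_d9
    have e : Real.exp 9 = Real.exp 1 ^ 9 := by rw [← Real.exp_nat_mul]; norm_num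
    rw [e]
    calc (8000 : ℝ) ≤ 2.7182818283 ^ 9 := by norm_num
      _ ≤ _ := by gcongr
  exact one_div_le_one_div_of_le (by norm_num) h2

-- With `L = 7 / 4` the tail is below `10⁻⁴`, and `L⁴ < 10` makes `32` terms of the series enough.
theorem quarticMoment_zero_mem : 1.8127 ≤ quarticMoment 0 ∧ quarticMoment 0 ≤ 1.8129 := by
  have h := quarticMoment_bounds (p := 0) (by decide) (by norm_num) (L := 7 / 4) (by norm_num) 32
  have h2 := quarticExp_seven_fourths_le
  norm_num [Finset.sum_range_succ, Nat.factorial] at h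
  constructor <;> linarith [h.1, h.2]

theorem quarticMoment_two_mem : 0.6126 ≤ quarticMoment 2 ∧ quarticMoment 2 ≤ 0.6129 := by
  have h := quarticMoment_bounds (p := 2) (by decide) (by norm_num) (L := 7 / 4) (by norm_num) 32
  have h2 := quarticExp_seven_fourths_le
  norm_num [Finset.sum_range_succ, Nat.factorial] at h
  constructor <;> linarith [h.1, h.2]

/-- All even moments up to order `20` in terms of the first two. -/
theorem quarticMoment_eq : quarticMoment 4 = 1 / 4 * quarticMoment 0 ∧
    quarticMoment 6 = 3 / 4 * quarticMoment 2 ∧ quarticMoment 8 = 5 / 16 * quarticMoment 0 ∧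
    quarticMoment 10 = 21 / 16 * quarticMoment 2 ∧ quarticMoment 12 = 45 / 64 * quarticMoment 0 ∧
    quarticMoment 14 = 231 / 64 * quarticMoment 2 ∧ quarticMoment 16 = 585 / 256 * quarticMoment 0 ∧
    quarticMoment 18 = 3465 / 256 * quarticMoment 2 ∧
    quarticMoment 20 = 9945 / 1024 * quarticMoment 0 := by
  have h4 := quarticMoment_add_four 0
  have h6 := quarticMoment_add_four 2
  have h8 := quarticMoment_add_four 4
  have h10 := quarticMoment_add_four 6
  have h12 := quarticMoment_add_four 8
  have h14 := quarticMoment_add_four 10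
  have h16 := quarticMoment_add_four 12
  have h18 := quarticMoment_add_four 14
  have h20 := quarticMoment_add_four 16
  norm_num at *
  refine ⟨?_, ?_, ?_, ?_, ?_, ?_, ?_, ?_, ?_⟩ <;> linarith

theorem cosMoment_zero_four_mem : -0.147 ≤ cosMoment 0 4 ∧ cosMoment 0 4 ≤ -0.137 := by
  have h := abs_le.1 (abs_cosMoment_sub_sum_le (n := 0) (by decide) 4 9)
  obtain ⟨h4, h6, h8, h10, h12, h14, h16, h18, h20⟩ := quarticMoment_eq
  obtain ⟨a1, a2⟩ := quarticMoment_zero_mem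
  obtain ⟨b1, b2⟩ := quarticMoment_two_mem
  norm_num [Finset.sum_range_succ, Nat.factorial, h4, h6, h8, h10, h12, h14, h16, h18, h20] at *
  constructor <;> linarith [h.1, h.2]

theorem sinMoment_one_four_mem : 0.159 ≤ sinMoment 1 4 ∧ sinMoment 1 4 ≤ 0.169 := by
  have h := abs_le.1 (abs_sinMoment_sub_sum_le (n := 1) (by decide) 4 9)
  obtain ⟨h4, h6, h8, h10, h12, h14, h16, h18, h20⟩ := quarticMoment_eq
  obtain ⟨a1, a2⟩ := quarticMoment_zero_mem
  obtain ⟨b1, b2⟩ := quarticMoment_two_mem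
  norm_num [Finset.sum_range_succ, Nat.factorial, h4, h6, h8, h10, h12, h14, h16, h18, h20] at *
  constructor <;> linarith [h.1, h.2]

theorem cosMoment_two_four_mem : -0.334 ≤ cosMoment 2 4 ∧ cosMoment 2 4 ≤ -0.324 := by
  have h := abs_le.1 (abs_cosMoment_sub_sum_le (n := 2) (by decide) 4 9)
  obtain ⟨h4, h6, h8, h10, h12, h14, h16, h18, h20⟩ := quarticMoment_eq
  obtain ⟨a1, a2⟩ := quarticMoment_zero_mem
  obtain ⟨b1, b2⟩ := quarticMoment_two_mem
  norm_num [Finset.sum_range_succ, Nat.factorial, h4, h6, h8, h10, h12, h14, h16, h18, h20] at *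
  constructor <;> linarith [h.1, h.2]

end Numerics

/-! ### Numerical bounds for the tail -/

section TailBounds

/-- Converts a lower bound for `2π (1/2 - lineTail s)`, the quantity with a rational power series,
into an upper bound for the tail. -/
theorem lineTail_le_of_le {s x c : ℝ} (h : x ≤ 2 * Real.pi * (1 / 2 - lineTail s)) (hc : c ≤ 1 / 2)
    (hx : 2 * 3.1416 * (1 / 2 - c) ≤ x) : lineTail s ≤ c := by
  by_contra hlt
  have h1 := Real.pi_lt_d4
  have h2 : 2 * Real.pi * (1 / 2 - lineTail s) < 2 * Real.pi * (1 / 2 - c) := by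
    have := Real.pi_pos
    gcongr
    exact not_le.1 hlt
  nlinarith

theorem le_lineTail_of_le {s x c : ℝ} (h : 2 * Real.pi * (1 / 2 - lineTail s) ≤ x) (hc : c ≤ 1 / 2)
    (hx : x ≤ 2 * 3.1415 * (1 / 2 - c)) : c ≤ lineTail s := by
  by_contra hlt
  have h1 := Real.pi_gt_d4
  have h2 : 2 * Real.pi * (1 / 2 - c) < 2 * Real.pi * (1 / 2 - lineTail s) := by
    have := Real.pi_pos
    gcongr
    exact not_le.1 hlt
  nlinarith

theorem lineTail_one_le : lineTail 1 ≤ 0.23 := by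
  have h := abs_le.1 (abs_lineTail_sub_sum_le (s := 1) (by norm_num) 3)
  obtain ⟨h4, h6, h8, h10, h12, h14, h16, h18, h20⟩ := quarticMoment_eq
  obtain ⟨a1, a2⟩ := quarticMoment_zero_mem
  obtain ⟨b1, b2⟩ := quarticMoment_two_mem
  refine lineTail_le_of_le (x := 1.714) ?_ (by norm_num) (by norm_num)
  generalize 2 * Real.pi * (1 / 2 - lineTail 1) = X at h ⊢
  norm_num [Finset.sum_range_succ, Nat.factorial, h4, h6, h8, h10, h12, h14, h16, h18, h20] at h ⊢
  linarith [h.1, h.2]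

theorem lineTail_four_thirds_le : lineTail (4 / 3) ≤ 0.155 := by
  have h := abs_le.1 (abs_lineTail_sub_sum_le (s := 4 / 3) (by norm_num) 4)
  obtain ⟨h4, h6, h8, h10, h12, h14, h16, h18, h20⟩ := quarticMoment_eq
  obtain ⟨a1, a2⟩ := quarticMoment_zero_mem
  obtain ⟨b1, b2⟩ := quarticMoment_two_mem
  refine lineTail_le_of_le (x := 2.189) ?_ (by norm_num) (by norm_num)
  generalize 2 * Real.pi * (1 / 2 - lineTail (4 / 3)) = X at h ⊢
  norm_num [Finset.sum_range_succ, Nat.factorial, h4, h6, h8, h10, h12, h14, h16, h18, h20] at h ⊢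
  linarith [h.1, h.2]

theorem lineTail_five_thirds_le : lineTail (5 / 3) ≤ 0.09 := by
  have h := abs_le.1 (abs_lineTail_sub_sum_le (s := 5 / 3) (by norm_num) 5)
  obtain ⟨h4, h6, h8, h10, h12, h14, h16, h18, h20⟩ := quarticMoment_eq
  obtain ⟨a1, a2⟩ := quarticMoment_zero_mem
  obtain ⟨b1, b2⟩ := quarticMoment_two_mem
  refine lineTail_le_of_le (x := 2.59) ?_ (by norm_num) (by norm_num)
  generalize 2 * Real.pi * (1 / 2 - lineTail (5 / 3)) = X at h ⊢
  norm_num [Finset.sum_range_succ, Nat.factorial, h4, h6, h8, h10, h12, h14, h16, h18, h20] at h ⊢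
  linarith [h.1, h.2]

theorem lineTail_two_mem : 0 ≤ lineTail 2 ∧ lineTail 2 ≤ 0.036 := by
  have h := abs_le.1 (abs_lineTail_sub_sum_le (s := 2) (by norm_num) 6)
  obtain ⟨h4, h6, h8, h10, h12, h14, h16, h18, h20⟩ := quarticMoment_eq
  obtain ⟨a1, a2⟩ := quarticMoment_zero_mem
  obtain ⟨b1, b2⟩ := quarticMoment_two_mem
  have key : 2.916 ≤ 2 * Real.pi * (1 / 2 - lineTail 2) ∧
      2 * Real.pi * (1 / 2 - lineTail 2) ≤ 2.922 := by
    generalize 2 * Real.pi * (1 / 2 - lineTail 2) = X at h ⊢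
    norm_num [Finset.sum_range_succ, Nat.factorial, h4, h6, h8, h10, h12, h14, h16, h18, h20] at h ⊢
    constructor <;> linarith [h.1, h.2]
  exact ⟨le_lineTail_of_le key.2 (by norm_num) (by norm_num),
    lineTail_le_of_le key.1 (by norm_num) (by norm_num)⟩

theorem le_lineTail_five_halves : -0.02 ≤ lineTail (5 / 2) := by
  have h := abs_le.1 (abs_lineTail_sub_sum_le (s := 5 / 2) (by norm_num) 7)
  obtain ⟨h4, h6, h8, h10, h12, h14, h16, h18, h20⟩ := quarticMoment_eq
  obtain ⟨a1, a2⟩ := quarticMoment_zero_mem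
  obtain ⟨b1, b2⟩ := quarticMoment_two_mem
  refine le_lineTail_of_le (x := 3.26) ?_ (by norm_num) (by norm_num)
  generalize 2 * Real.pi * (1 / 2 - lineTail (5 / 2)) = X at h ⊢
  norm_num [Finset.sum_range_succ, Nat.factorial, h4, h6, h8, h10, h12, h14, h16, h18, h20] at h ⊢
  linarith [h.1, h.2]

/-- Values of the tail on a grid of mesh `1 / 4`, around its first negative minimum. -/
theorem lineTail_mem_of_three_to_four {s : ℝ}
    (hs : s = 3 ∨ s = 13 / 4 ∨ s = 7 / 2 ∨ s = 15 / 4 ∨ s = 4) :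
    -0.053 ≤ lineTail s ∧ lineTail s ≤ -0.044 := by
  obtain ⟨h4, h6, h8, h10, h12, h14, h16, h18, h20⟩ := quarticMoment_eq
  obtain ⟨a1, a2⟩ := quarticMoment_zero_mem
  obtain ⟨b1, b2⟩ := quarticMoment_two_mem
  have key : 3.4185 ≤ 2 * Real.pi * (1 / 2 - lineTail s) ∧
      2 * Real.pi * (1 / 2 - lineTail s) ≤ 3.4742 := by
    have hs0 : 0 ≤ s := by rcases hs with rfl | rfl | rfl | rfl | rfl <;> norm_num
    have h := abs_le.1 (abs_lineTail_sub_sum_le hs0 9)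
    generalize 2 * Real.pi * (1 / 2 - lineTail s) = X at h ⊢
    rcases hs with rfl | rfl | rfl | rfl | rfl <;>
      norm_num [Finset.sum_range_succ, Nat.factorial, h4, h6, h8, h10, h12, h14, h16, h18,
        h20] at h a1 a2 b1 b2 ⊢ <;>
      constructor <;> linarith [h.1, h.2]
  exact ⟨le_lineTail_of_le key.2 (by norm_num) (by norm_num),
    lineTail_le_of_le key.1 (by norm_num) (by norm_num)⟩

/-- The bound `1.8129 / (2π)`, used as a Lipschitz constant for the tail. -/
theorem abs_lineProfile_le (s : ℝ) : |lineProfile s| ≤ 0.2887 := by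
  have h := abs_integral_pow_mul_quarticExp_mul_le 0 (φ := fun ξ => Real.cos (s * ξ))
    fun x => Real.abs_cos_le_one _
  have h0 := quarticMoment_zero_mem.2
  have e : |cosMoment 0 s| ≤ 1.8129 := by
    refine h.trans (le_trans (le_of_eq ?_) h0)
    rw [quarticMoment]; simp
  have hpi := Real.pi_gt_d4
  rw [lineProfile_eq_cosMoment, abs_mul, abs_of_pos (by positivity), inv_mul_le_iff₀ (by positivity)]
  nlinarith

/-- The grid values extend to the whole interval by the Lipschitz bound. -/
theorem lineTail_mem_Icc_three_four {s : ℝ} (hs : s ∈ Set.Icc (3 : ℝ) 4) :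
    -0.0895 ≤ lineTail s ∧ lineTail s ≤ 0 := by
  have hlip : ∀ x y : ℝ, |lineTail y - lineTail x| ≤ 0.2887 * |y - x| := by
    intro x y
    have := convex_univ.norm_image_sub_le_of_norm_hasDerivWithin_le (f := lineTail)
      (f' := fun s => -lineProfile s) (C := 0.2887) (x := x) (y := y)
      (fun x _ => (hasDerivAt_lineTail x).hasDerivWithinAt)
      (fun x _ => by rw [norm_neg]; exact abs_lineProfile_le x) trivial trivial
    exact this
  have key : ∀ x : ℝ, (x = 3 ∨ x = 13 / 4 ∨ x = 7 / 2 ∨ x = 15 / 4 ∨ x = 4) → |s - x| ≤ 1 / 8 →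
      -0.0895 ≤ lineTail s ∧ lineTail s ≤ 0 := by
    intro x hx hd
    have h1 := lineTail_mem_of_three_to_four hx
    have h2 := abs_le.1 (hlip x s)
    constructor <;> linarith [h1.1, h1.2, h2.1, h2.2]
  obtain ⟨h3, h4⟩ := hs
  rcases le_total s (25 / 8) with h | h
  · exact key 3 (by simp) (abs_le.2 ⟨by linarith, by linarith⟩)
  rcases le_total s (27 / 8) with h' | h'
  · exact key (13 / 4) (by simp) (abs_le.2 ⟨by linarith, by linarith⟩)
  rcases le_total s (29 / 8) with h'' | h''
  · exact key (7 / 2) (by simp) (abs_le.2 ⟨by linarith, by linarith⟩)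
  rcases le_total s (31 / 8) with h₃ | h₃
  · exact key (15 / 4) (by simp) (abs_le.2 ⟨by linarith, by linarith⟩)
  · exact key 4 (by simp) (abs_le.2 ⟨by linarith, by linarith⟩)

/-- The profile is positive on `[0, 3]`: three terms of its series and the bound for the remainder
suffice. -/
theorem lineProfile_pos {s : ℝ} (h0 : 0 ≤ s) (h3 : s ≤ 3) : 0 < lineProfile s := by
  have h := (abs_le.1 (abs_cosMoment_sub_sum_le (n := 0) (by decide) s 3)).1
  obtain ⟨h4, h6, -⟩ := quarticMoment_eq
  obtain ⟨a1, -⟩ := quarticMoment_zero_mem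
  obtain ⟨-, b2⟩ := quarticMoment_two_mem
  have hu0 : 0 ≤ s ^ 2 := sq_nonneg s
  have hu9 : s ^ 2 ≤ 9 := by nlinarith
  rw [abs_of_nonneg h0] at h
  norm_num [Finset.sum_range_succ, Nat.factorial, h4, h6] at h
  rw [lineProfile_eq_cosMoment]
  refine mul_pos (by have := Real.pi_pos; positivity) ?_
  have e4 : s ^ 4 = (s ^ 2) ^ 2 := by ring
  have e6 : s ^ 6 = (s ^ 2) ^ 3 := by ring
  rw [e4, e6] at h
  generalize s ^ 2 = u at *
  generalize quarticMoment 0 = A at *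
  generalize quarticMoment 2 = B at *
  have hA : 0 ≤ (A - 1.8127) * (1 + u ^ 2 / 96) := mul_nonneg (by linarith) (by positivity)
  have hB : 0 ≤ (0.6129 - B) * (u / 2 + u ^ 3 / 960) := mul_nonneg (by linarith) (by positivity)
  have hq : 0 < 1.8127 * (1 + u ^ 2 / 96) - 0.6129 * (u / 2 + u ^ 3 / 960) := by
    nlinarith [mul_nonneg (sub_nonneg.2 hu9) (sq_nonneg (u - 9)), mul_nonneg (sub_nonneg.2 hu9) hu0]
  linarith

end TailBounds

/-! ### The tail beyond `4` -/

section Lyapunov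

theorem hasDerivAt_sinMoment_one (s : ℝ) : HasDerivAt (sinMoment 1) (cosMoment 2 s) s :=
  hasDerivAt_sinMoment 1 s

theorem hasDerivAt_cosMoment_zero (s : ℝ) : HasDerivAt (cosMoment 0) (-sinMoment 1 s) s :=
  hasDerivAt_cosMoment 0 s

theorem hasDerivAt_cosMoment_two (s : ℝ) :
    HasDerivAt (cosMoment 2) (-(s / 4 * cosMoment 0 s)) s := by
  rw [← sinMoment_three]; exact hasDerivAt_cosMoment 2 s

/-- The tail in the normalization `2π ∫_s^∞`, whose derivative is `-cosMoment 0`. -/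
noncomputable def scaledTail (s : ℝ) : ℝ := 2 * Real.pi * lineTail s

theorem hasDerivAt_scaledTail (s : ℝ) : HasDerivAt scaledTail (-cosMoment 0 s) s := by
  refine ((hasDerivAt_lineTail s).const_mul (2 * Real.pi)).congr_deriv ?_
  rw [lineProfile_eq_cosMoment]
  have := Real.pi_pos
  field_simp

/-- A quadratic form in the derivatives of the profile that decreases on the half-line. -/
noncomputable def derivEnergy (s : ℝ) : ℝ :=
  cosMoment 2 s ^ 2 / 2 + s / 4 * (cosMoment 0 s * sinMoment 1 s) + cosMoment 0 s ^ 2 / 8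

theorem hasDerivAt_derivEnergy (s : ℝ) :
    HasDerivAt derivEnergy (-(s / 4 * sinMoment 1 s ^ 2)) s := by
  have h := ((((hasDerivAt_cosMoment_two s).pow 2).div_const 2).add
    (((hasDerivAt_id s).div_const 4).mul
      ((hasDerivAt_cosMoment_zero s).mul (hasDerivAt_sinMoment_one s)))).add
    (((hasDerivAt_cosMoment_zero s).pow 2).div_const 8)
  refine h.congr_deriv ?_
  simp only [id, Pi.mul_apply]
  push_cast
  ring

theorem derivEnergy_le {s : ℝ} (hs : 4 ≤ s) : derivEnergy s ≤ derivEnergy 4 := by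
  refine antitoneOn_of_hasDerivWithinAt_nonpos (convex_Ici (4 : ℝ))
    (fun x _ => (hasDerivAt_derivEnergy x).continuousAt.continuousWithinAt)
    (fun x _ => (hasDerivAt_derivEnergy x).hasDerivWithinAt) (fun x hx => ?_)
    (Set.mem_Ici.2 le_rfl) hs hs
  rw [interior_Ici] at hx
  have : 0 ≤ x := by linarith [Set.mem_Ioi.1 hx]
  rw [neg_nonpos]
  positivity

/-- A quadratic form in the tail and its derivatives that decreases to zero. Up to the sign its
derivative is `(T'' + p T' + q T) ^ 2 + (1 / 8 - q ^ 2) T ^ 2` with `p = 4 / 5`, `q = p ^ 2 / 2`. -/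
noncomputable def tailEnergy (s : ℝ) : ℝ :=
  scaledTail s * cosMoment 2 s + cosMoment 0 s * sinMoment 1 s - s / 8 * scaledTail s ^ 2
    - 4 / 5 * cosMoment 0 s ^ 2 + 16 / 25 * (scaledTail s * cosMoment 0 s)
    - 32 / 125 * scaledTail s ^ 2

theorem hasDerivAt_tailEnergy (s : ℝ) :
    HasDerivAt tailEnergy (-(sinMoment 1 s - 4 / 5 * cosMoment 0 s + 8 / 25 * scaledTail s) ^ 2
      - (1 / 8 - (8 / 25) ^ 2) * scaledTail s ^ 2) s := by
  have hT := hasDerivAt_scaledTail s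
  have hG := hasDerivAt_cosMoment_zero s
  have h := (((((hT.mul (hasDerivAt_cosMoment_two s)).add
    (hG.mul (hasDerivAt_sinMoment_one s))).sub
    (((hasDerivAt_id s).div_const 8).mul (hT.pow 2))).sub
    ((hG.pow 2).const_mul (4 / 5))).add ((hT.mul hG).const_mul (16 / 25))).sub
    ((hT.pow 2).const_mul (32 / 125))
  refine h.congr_deriv ?_
  simp only [id, Pi.pow_apply]
  push_cast
  ring

theorem tailEnergy_nonneg (s : ℝ) : 0 ≤ tailEnergy s := by
  have hanti : Antitone tailEnergy := antitone_of_hasDerivAt_nonpos hasDerivAt_tailEnergy fun x => by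
    rw [Pi.zero_apply]
    nlinarith [sq_nonneg (sinMoment 1 x - 4 / 5 * cosMoment 0 x + 8 / 25 * scaledTail x),
      sq_nonneg (scaledTail x)]
  refine hanti.le_of_tendsto ?_ s
  have hT : Filter.Tendsto scaledTail Filter.atTop (nhds 0) := by
    have h := tendsto_lineTail.const_mul (2 * Real.pi)
    rw [mul_zero] at h
    exact h
  have hG : Filter.Tendsto (cosMoment 0) Filter.atTop (nhds 0) := by
    have h := tendsto_lineProfile.const_mul (2 * Real.pi)
    rw [mul_zero] at h
    refine h.congr fun s => ?_
    rw [lineProfile_eq_cosMoment]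
    have := Real.pi_pos
    field_simp
  have hsT : Filter.Tendsto (fun s => s / 8 * scaledTail s ^ 2) Filter.atTop (nhds 0) := by
    have h := tendsto_mul_lineTail_sq.const_mul ((2 * Real.pi) ^ 2 / 8)
    rw [mul_zero] at h
    refine h.congr fun s => ?_
    rw [scaledTail]; ring
  have hTC : Filter.Tendsto (fun s => scaledTail s * cosMoment 2 s) Filter.atTop (nhds 0) :=
    hT.zero_mul_isBoundedUnder_le (Filter.isBoundedUnder_of ⟨_, fun s => by
      rw [Function.comp_apply, Real.norm_eq_abs]
      exact abs_integral_pow_mul_quarticExp_mul_le 2 (φ := fun ξ => Real.cos (s * ξ))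
        fun x => Real.abs_cos_le_one _⟩)
  have hGS : Filter.Tendsto (fun s => cosMoment 0 s * sinMoment 1 s) Filter.atTop (nhds 0) :=
    hG.zero_mul_isBoundedUnder_le (Filter.isBoundedUnder_of ⟨_, fun s => by
      rw [Function.comp_apply, Real.norm_eq_abs]
      exact abs_integral_pow_mul_quarticExp_mul_le 1 (φ := fun ξ => Real.sin (s * ξ))
        fun x => Real.abs_sin_le_one _⟩)
  have h := ((((hTC.add hGS).sub hsT).sub ((hG.pow 2).const_mul (4 / 5))).add
    ((hT.mul hG).const_mul (16 / 25))).sub ((hT.pow 2).const_mul (32 / 125))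
  have e : (0 : ℝ) + 0 - 0 - 4 / 5 * 0 ^ 2 + 16 / 25 * (0 * 0) - 32 / 125 * 0 ^ 2 = 0 := by norm_num
  rw [e] at h
  exact h

/-- At a critical point of the tail beyond `4` the two energies bound the tail. -/
theorem abs_lineTail_le_of_critical {c : ℝ} (hc : 4 ≤ c) (h0 : cosMoment 0 c = 0) :
    |lineTail c| ≤ 0.06 := by
  have h1 := tailEnergy_nonneg c
  have h2 := derivEnergy_le hc
  have h3 : derivEnergy 4 ≤ 0.04 := by
    obtain ⟨a1, a2⟩ := cosMoment_zero_four_mem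
    obtain ⟨b1, b2⟩ := sinMoment_one_four_mem
    obtain ⟨c1, c2⟩ := cosMoment_two_four_mem
    rw [derivEnergy]
    nlinarith
  have hpi := Real.pi_gt_d4
  rw [derivEnergy, h0] at h2
  rw [tailEnergy, h0] at h1
  have h4 : cosMoment 2 c ^ 2 ≤ 0.08 := by linarith
  -- At a critical point `tailEnergy` is `T * cosMoment 2 c - (c / 8 + 32 / 125) * T ^ 2` with
  -- `T = scaledTail c`, and `c / 8 ≥ 1 / 2`.
  have h5 : scaledTail c ^ 2 * 0.756 ≤ scaledTail c * cosMoment 2 c := by nlinarith [sq_nonneg (scaledTail c)]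
  have h6 : |scaledTail c| * 0.756 ≤ |cosMoment 2 c| := by
    rcases (abs_nonneg (scaledTail c)).eq_or_lt with h | h
    · rw [← h, zero_mul]; exact abs_nonneg _
    · have h7 : |scaledTail c| * (|scaledTail c| * 0.756) ≤ |scaledTail c| * |cosMoment 2 c| := by
        rw [← abs_mul, ← mul_assoc, ← sq, sq_abs]
        exact h5.trans (le_abs_self _)
      exact le_of_mul_le_mul_left h7 h
  have h8 : |cosMoment 2 c| ≤ 0.2829 := abs_le_of_sq_le_sq (by linarith) (by norm_num)
  rw [scaledTail, abs_mul, abs_of_pos (by positivity)] at h6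
  nlinarith [abs_nonneg (lineTail c)]

/-- Beyond `4` the tail is at most `0.06` in absolute value: its maximum there is attained either at
`4`, where the value is known, or at a critical point. -/
theorem abs_lineTail_le_of_four_le {s : ℝ} (hs : 4 ≤ s) : |lineTail s| ≤ 0.06 := by
  by_contra! hlt
  have hcont : Continuous lineTail := continuous_iff_continuousAt.2 fun x =>
    (hasDerivAt_lineTail x).continuousAt
  have hev : ∀ᶠ x in Filter.atTop, |lineTail x| < 0.06 := by
    have := tendsto_lineTail.abs
    rw [abs_zero] at this
    exact this.eventually_lt_const (by norm_num)
  obtain ⟨X, hX⟩ := Filter.eventually_atTop.1 hev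
  have hsX : s < X := by
    by_contra! h
    linarith [hX s h]
  obtain ⟨c, hc, hmax⟩ := isCompact_Icc.exists_isMaxOn (s := Set.Icc 4 X) (f := fun x => |lineTail x|)
    ⟨s, hs, hsX.le⟩ hcont.abs.continuousOn
  have hcs : 0.06 < |lineTail c| := hlt.trans_le (hmax ⟨hs, hsX.le⟩)
  have hc4 : 4 < c := by
    refine lt_of_le_of_ne hc.1 fun h => ?_
    rw [← h] at hcs
    have h4 := lineTail_mem_of_three_to_four (s := 4) (by simp)
    have := abs_le.2 (⟨by linarith, by linarith⟩ : -(0.06 : ℝ) ≤ lineTail 4 ∧ lineTail 4 ≤ 0.06)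
    linarith
  have hcX : c < X := by
    refine lt_of_le_of_ne hc.2 fun h => ?_
    linarith [hX c h.ge]
  have hloc : IsLocalMax (fun x => lineTail x ^ 2) c := by
    filter_upwards [Icc_mem_nhds hc4 hcX] with x hx
    exact sq_le_sq.2 (hmax hx)
  have hd := hloc.hasDerivAt_eq_zero ((hasDerivAt_lineTail c).pow 2)
  have hT : lineTail c ≠ 0 := by
    intro h
    rw [h, abs_zero] at hcs
    norm_num at hcs
  have hg : cosMoment 0 c = 0 := by
    rw [lineProfile_eq_cosMoment] at hd
    have := Real.pi_pos.ne'
    simpa [hT, this] using hd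
  linarith [abs_lineTail_le_of_critical hc4.le hg]

end Lyapunov

/-! ### The half-space threshold function -/

section Threshold

theorem strictAntiOn_lineTail : StrictAntiOn lineTail (Set.Icc 0 3) := by
  refine strictAntiOn_of_hasDerivWithinAt_neg (convex_Icc 0 3)
    (fun x _ => (hasDerivAt_lineTail x).continuousAt.continuousWithinAt)
    (fun x _ => (hasDerivAt_lineTail x).hasDerivWithinAt) fun x hx => ?_
  rw [interior_Icc] at hx
  exact neg_neg_of_pos (lineProfile_pos hx.1.le hx.2.le)

/-- The leading-order value of the threshold function minus `1 / 2`, at distance `s` (in units of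
the diffusion length) inside a half-space. -/
noncomputable def halfSpaceThreshold (s : ℝ) : ℝ :=
  1 / 2 - (lineTail (s / 3) - 3 * lineTail (s / 2) + 3 * lineTail s)

/-- The arguments `s / 3`, `s / 2` and `s` are placed in `[0, 3]`, where the tail decreases, in
`[3, 4]`, or beyond `4`. -/
theorem halfSpaceThreshold_pos {s : ℝ} (hs : 0 < s) : 0 < halfSpaceThreshold s := by
  have hanti : ∀ {x y : ℝ}, 0 ≤ x → x ≤ y → y ≤ 3 → lineTail y ≤ lineTail x := fun hx hxy hy =>
    strictAntiOn_lineTail.antitoneOn ⟨hx, hxy.trans hy⟩ ⟨hx.trans hxy, hy⟩ hxy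
  have h0 := lineTail_zero
  have h2 := lineTail_two_mem
  have h3 := lineTail_mem_of_three_to_four (s := 3) (by simp)
  have hbig : ∀ {x : ℝ}, 4 ≤ x → -0.06 ≤ lineTail x ∧ lineTail x ≤ 0.06 := fun hx =>
    abs_le.1 (abs_lineTail_le_of_four_le hx)
  rw [halfSpaceThreshold]
  rcases le_total s 3 with h | h
  · have a1 : lineTail (s / 3) < lineTail 0 :=
      strictAntiOn_lineTail ⟨le_rfl, by norm_num⟩ ⟨by positivity, by linarith⟩ (by positivity)
    have a2 : lineTail s ≤ lineTail (s / 2) := hanti (by positivity) (by linarith) h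
    linarith
  rcases le_total s 4 with h' | h'
  · have a1 := hanti (x := 1) (y := s / 3) (by norm_num) (by linarith) (by linarith)
    have a2 := hanti (x := s / 2) (y := 2) (by positivity) (by linarith) (by norm_num)
    have a3 := (lineTail_mem_Icc_three_four ⟨h, h'⟩).2
    linarith [lineTail_one_le]
  have b := (hbig h').2
  rcases le_total s 5 with h₁ | h₁
  · have a1 := hanti (x := 4 / 3) (y := s / 3) (by norm_num) (by linarith) (by linarith)
    have a2 := hanti (x := s / 2) (y := 5 / 2) (by positivity) (by linarith) (by norm_num)
    linarith [lineTail_four_thirds_le, le_lineTail_five_halves]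
  rcases le_total s 6 with h₂ | h₂
  · have a1 := hanti (x := 5 / 3) (y := s / 3) (by norm_num) (by linarith) (by linarith)
    have a2 := hanti (x := s / 2) (y := 3) (by positivity) (by linarith) (by norm_num)
    linarith [lineTail_five_thirds_le]
  have c : lineTail (s / 3) ≤ 0.06 := by
    rcases le_total (s / 3) 3 with h₃ | h₃
    · have a1 := hanti (x := 2) (y := s / 3) (by norm_num) (by linarith) h₃
      linarith
    rcases le_total (s / 3) 4 with h₄ | h₄
    · linarith [(lineTail_mem_Icc_three_four ⟨h₃, h₄⟩).2]
    · exact (hbig h₄).2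
  rcases le_total s 8 with h₅ | h₅
  · have a1 := hanti (x := 2) (y := s / 3) (by norm_num) (by linarith) (by linarith)
    have a2 := (lineTail_mem_Icc_three_four (s := s / 2) ⟨by linarith, by linarith⟩).1
    linarith
  · have a2 := (hbig (x := s / 2) (by linarith)).1
    linarith

theorem halfSpaceThreshold_neg (s : ℝ) : halfSpaceThreshold (-s) = -halfSpaceThreshold s := by
  simp only [halfSpaceThreshold, neg_div, lineTail_neg]
  ring

theorem continuous_lineTail : Continuous lineTail :=
  continuous_iff_continuousAt.2 fun x => (hasDerivAt_lineTail x).continuousAt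

/-- The leading-order threshold function is nondegenerate at the interface and bounded away from
zero elsewhere. -/
theorem exists_le_halfSpaceThreshold :
    ∃ c : ℝ, 0 < c ∧ ∀ s : ℝ, 0 ≤ s → c * min s 1 ≤ halfSpaceThreshold s := by
  have hcont : Continuous halfSpaceThreshold := by
    have := continuous_lineTail
    unfold halfSpaceThreshold
    fun_prop
  have hg : 0 < lineProfile 0 := lineProfile_pos le_rfl (by norm_num)
  have hz : halfSpaceThreshold 0 = 0 := by
    rw [halfSpaceThreshold, zero_div, zero_div, lineTail_zero]; norm_num
  have hd : HasDerivAt halfSpaceThreshold (11 / 6 * lineProfile 0) 0 := by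
    have hT : ∀ b : ℝ, HasDerivAt (fun s : ℝ => lineTail (s / b)) (-lineProfile 0 * (1 / b)) 0 := by
      intro b
      have h1 : HasDerivAt lineTail (-lineProfile 0) ((0 : ℝ) / b) := by
        rw [zero_div]; exact hasDerivAt_lineTail 0
      exact h1.comp (0 : ℝ) ((hasDerivAt_id (0 : ℝ)).div_const b)
    have h := (((hT 3).sub ((hT 2).const_mul 3)).add
      ((hasDerivAt_lineTail 0).const_mul 3)).const_sub (1 / 2)
    refine h.congr_deriv ?_
    ring
  have hnear : ∃ δ : ℝ, 0 < δ ∧ ∀ s, 0 < s → s < δ → lineProfile 0 * s ≤ halfSpaceThreshold s := by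
    have h1 := (hasDerivAt_iff_tendsto_slope.1 hd).eventually_const_lt
      (by linarith : lineProfile 0 < 11 / 6 * lineProfile 0)
    rw [eventually_nhdsWithin_iff, Metric.eventually_nhds_iff] at h1
    obtain ⟨δ, hδ, h⟩ := h1
    refine ⟨δ, hδ, fun s hs hsδ => ?_⟩
    have h2 := h (y := s) (by rw [Real.dist_eq, sub_zero, abs_of_pos hs]; exact hsδ) hs.ne'
    rw [slope_def_field, hz, sub_zero, sub_zero, lt_div_iff₀ hs] at h2
    exact h2.le
  have hfar : ∃ K : ℝ, ∀ s, K ≤ s → 1 / 4 ≤ halfSpaceThreshold s := by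
    have hT : ∀ b : ℝ, 0 < b → Filter.Tendsto (fun s : ℝ => lineTail (s / b)) Filter.atTop (nhds 0) :=
      fun b hb => tendsto_lineTail.comp (Filter.tendsto_id.atTop_div_const hb)
    have h := (((hT 3 (by norm_num)).sub ((hT 2 (by norm_num)).const_mul 3)).add
      (tendsto_lineTail.const_mul 3)).const_sub (1 / 2)
    have := h.eventually_const_le (u := 1 / 4) (by norm_num)
    exact Filter.eventually_atTop.1 this
  obtain ⟨δ, hδ, hnear⟩ := hnear
  obtain ⟨K, hfar⟩ := hfar
  have hmid : ∃ m : ℝ, 0 < m ∧ ∀ s ∈ Set.Icc (δ / 2) (max K δ), m ≤ halfSpaceThreshold s := by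
    obtain ⟨s₀, hs₀, hmin⟩ := isCompact_Icc.exists_isMinOn (s := Set.Icc (δ / 2) (max K δ))
      ⟨δ, by linarith, le_max_right _ _⟩ hcont.continuousOn
    exact ⟨_, halfSpaceThreshold_pos (lt_of_lt_of_le (by positivity) hs₀.1), fun s hs => hmin hs⟩
  obtain ⟨m, hm, hmid⟩ := hmid
  refine ⟨min (lineProfile 0) (min m (1 / 4)), by positivity, fun s hs => ?_⟩
  have hmin0 : 0 ≤ min s 1 := le_min hs zero_le_one
  rcases hs.eq_or_lt with rfl | hs
  · rw [hz]; simp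
  rcases lt_or_ge s δ with h | h
  · refine le_trans ?_ (hnear s hs h)
    gcongr
    · exact min_le_left _ _
    · exact min_le_left _ _
  · have h1 : min (lineProfile 0) (min m (1 / 4)) * min s 1 ≤ min m (1 / 4) := by
      refine (mul_le_of_le_one_right (by positivity) (min_le_right _ _)).trans (min_le_right _ _)
    rcases le_total s K with h2 | h2
    · exact h1.trans ((min_le_left _ _).trans (hmid s ⟨by linarith, h2.trans (le_max_left _ _)⟩))
    · exact h1.trans ((min_le_right _ _).trans (hfar s h2))

end Threshold

/-! ### Graphs with bounded derivatives -/

section FlatGraph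

set_option linter.unusedSectionVars false

variable {V : Type*} [NormedAddCommGroup V] [InnerProductSpace ℝ V]

/-- The graph data of a smooth hypersurface in a frame with last axis `ν`: a `C⁴` function `f` that
does not depend on the last coordinate, with derivatives of orders `1` to `4` bounded by `L`. The
bounds are stated for repeated directional derivatives only. -/
structure FlatGraph (ν : V) (f : V → ℝ) (L : ℝ) : Prop where
  norm_eq_one : ‖ν‖ = 1
  contDiff : ContDiff ℝ 4 f
  invariant : ∀ (y : V) (s : ℝ), f (y + s • ν) = f y
  nonneg : 0 ≤ L
  bound : ∀ k : ℕ, 1 ≤ k → k ≤ 4 → ∀ x w : V, |iteratedFDeriv ℝ k f x (fun _ => w)| ≤ L * ‖w‖ ^ k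

/-- The graph function blown up around `x` at scale `h`. -/
noncomputable def scaledGraph (f : V → ℝ) (x : V) (h : ℝ) (w : V) : ℝ := (f (x + h • w) - f x) / h

namespace FlatGraph

variable {ν : V} {f : V → ℝ} {L : ℝ}

theorem hasDerivAt_iteratedFDeriv_line (hf : FlatGraph ν f L) {k : ℕ} (hk : k < 4) (x w : V)
    (s : ℝ) : HasDerivAt (fun s : ℝ => iteratedFDeriv ℝ k f (x + s • w) (fun _ => w))
      (iteratedFDeriv ℝ (k + 1) f (x + s • w) (fun _ => w)) s := by
  have hd : DifferentiableAt ℝ (iteratedFDeriv ℝ k f) (x + s • w) :=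
    (hf.contDiff.differentiable_iteratedFDeriv (by exact_mod_cast hk)).differentiableAt
  have h1 : HasDerivAt (fun s : ℝ => x + s • w) w s := by
    simpa using ((hasDerivAt_id s).smul_const w).const_add x
  have h2 := hd.hasFDerivAt.comp_hasDerivAt s h1
  have h3 := (ContinuousMultilinearMap.apply ℝ (fun _ : Fin k => V) ℝ
    (fun _ => w)).hasFDerivAt.comp_hasDerivAt s h2
  refine h3.congr_deriv ?_
  rw [iteratedFDeriv_succ_apply_left]
  rfl

theorem iteratedFDeriv_one (f : V → ℝ) (x w : V) :
    iteratedFDeriv ℝ 1 f x (fun _ => w) = fderiv ℝ f x w := by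
  rw [iteratedFDeriv_one_apply]

theorem abs_fderiv_le (hf : FlatGraph ν f L) (x w : V) : |fderiv ℝ f x w| ≤ L * ‖w‖ := by
  have := hf.bound 1 le_rfl (by norm_num) x w
  rwa [iteratedFDeriv_one, pow_one] at this

theorem differentiable (hf : FlatGraph ν f L) : Differentiable ℝ f :=
  hf.contDiff.differentiable (by norm_num)

theorem fderiv_normal (hf : FlatGraph ν f L) (x : V) : fderiv ℝ f x ν = 0 := by
  have h1 : HasDerivAt (fun s : ℝ => x + s • ν) ν 0 := by
    simpa using ((hasDerivAt_id (0 : ℝ)).smul_const ν).const_add x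
  have h2 := (hf.differentiable (x + (0 : ℝ) • ν)).hasFDerivAt.comp_hasDerivAt 0 h1
  have h3 : (f ∘ fun s : ℝ => x + s • ν) = fun _ => f x := by
    funext s; exact hf.invariant x s
  rw [h3, zero_smul, add_zero] at h2
  exact h2.unique (hasDerivAt_const _ _)

theorem fderiv_add_normal (hf : FlatGraph ν f L) (x w : V) (s : ℝ) :
    fderiv ℝ f x (w + s • ν) = fderiv ℝ f x w := by
  rw [map_add, map_smul, hf.fderiv_normal, smul_zero, add_zero]

theorem scaledGraph_add_normal (hf : FlatGraph ν f L) (x w : V) (h s : ℝ) :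
    scaledGraph f x h (w + s • ν) = scaledGraph f x h w := by
  rw [scaledGraph, scaledGraph, smul_add, smul_smul, ← add_assoc, hf.invariant]

theorem differentiable_scaledGraph (hf : FlatGraph ν f L) (x : V) (h : ℝ) :
    Differentiable ℝ (scaledGraph f x h) := by
  have := hf.differentiable
  unfold scaledGraph
  fun_prop

theorem abs_scaledGraph_le (hf : FlatGraph ν f L) (x w : V) {h : ℝ} (hh : 0 < h) :
    |scaledGraph f x h w| ≤ L * ‖w‖ := by
  have := abs_sub_le_of_hasDerivAt (δ := h)
    (fun s _ => hf.hasDerivAt_iteratedFDeriv_line (k := 0) (by norm_num) x w s)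
    (fun s _ => hf.bound 1 (by norm_num) (by norm_num) _ w) h Set.right_mem_uIcc
  simp only [iteratedFDeriv_zero_apply, zero_smul, add_zero, pow_one, abs_of_pos hh] at this
  rw [scaledGraph, abs_div, abs_of_pos hh, div_le_iff₀ hh]
  exact this

theorem abs_scaledGraph_sub_fderiv_le (hf : FlatGraph ν f L) (x w : V) {h : ℝ} (hh : 0 < h) :
    |scaledGraph f x h w - fderiv ℝ f x w| ≤ L * h * ‖w‖ ^ 2 := by
  have := abs_taylor_two_le (δ := h)
    (fun s _ => hf.hasDerivAt_iteratedFDeriv_line (k := 0) (by norm_num) x w s)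
    (fun s _ => hf.hasDerivAt_iteratedFDeriv_line (k := 1) (by norm_num) x w s)
    (fun s _ => hf.bound 2 (by norm_num) (by norm_num) _ w) h Set.right_mem_uIcc
  simp only [iteratedFDeriv_zero_apply, zero_smul, add_zero, abs_of_pos hh,
    iteratedFDeriv_one, Nat.reduceAdd] at this
  have e : scaledGraph f x h w - fderiv ℝ f x w =
      (f (x + h • w) - f x - h * fderiv ℝ f x w) / h := by
    rw [scaledGraph]; field_simp
  rw [e, abs_div, abs_of_pos hh, div_le_iff₀ hh]
  linarith

theorem abs_scaledGraph_sub_two_le (hf : FlatGraph ν f L) (x w : V) {h : ℝ} (hh : 0 < h) :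
    |scaledGraph f x h w - fderiv ℝ f x w - h * (iteratedFDeriv ℝ 2 f x (fun _ => w) / 2)| ≤
      L * h ^ 2 * ‖w‖ ^ 3 := by
  have := abs_taylor_three_le (δ := h)
    (fun s _ => hf.hasDerivAt_iteratedFDeriv_line (k := 0) (by norm_num) x w s)
    (fun s _ => hf.hasDerivAt_iteratedFDeriv_line (k := 1) (by norm_num) x w s)
    (fun s _ => hf.hasDerivAt_iteratedFDeriv_line (k := 2) (by norm_num) x w s)
    (fun s _ => hf.bound 3 (by norm_num) (by norm_num) _ w) h Set.right_mem_uIcc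
  simp only [iteratedFDeriv_zero_apply, zero_smul, add_zero, abs_of_pos hh,
    iteratedFDeriv_one, Nat.reduceAdd] at this
  have e : scaledGraph f x h w - fderiv ℝ f x w - h * (iteratedFDeriv ℝ 2 f x (fun _ => w) / 2) =
      (f (x + h • w) - f x - h * fderiv ℝ f x w -
        h ^ 2 / 2 * iteratedFDeriv ℝ 2 f x (fun _ => w)) / h := by
    rw [scaledGraph]; field_simp
  rw [e, abs_div, abs_of_pos hh, div_le_iff₀ hh]
  linarith

theorem abs_scaledGraph_sub_three_le (hf : FlatGraph ν f L) (x w : V) {h : ℝ} (hh : 0 < h) :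
    |scaledGraph f x h w - fderiv ℝ f x w - h * (iteratedFDeriv ℝ 2 f x (fun _ => w) / 2) -
      h ^ 2 * (iteratedFDeriv ℝ 3 f x (fun _ => w) / 6)| ≤ L * h ^ 3 * ‖w‖ ^ 4 := by
  have := abs_taylor_four_le (δ := h)
    (fun s _ => hf.hasDerivAt_iteratedFDeriv_line (k := 0) (by norm_num) x w s)
    (fun s _ => hf.hasDerivAt_iteratedFDeriv_line (k := 1) (by norm_num) x w s)
    (fun s _ => hf.hasDerivAt_iteratedFDeriv_line (k := 2) (by norm_num) x w s)
    (fun s _ => hf.hasDerivAt_iteratedFDeriv_line (k := 3) (by norm_num) x w s)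
    (fun s _ => hf.bound 4 (by norm_num) (by norm_num) _ w) h Set.right_mem_uIcc
  simp only [iteratedFDeriv_zero_apply, zero_smul, add_zero, abs_of_pos hh,
    iteratedFDeriv_one, Nat.reduceAdd] at this
  have e : scaledGraph f x h w - fderiv ℝ f x w -
      h * (iteratedFDeriv ℝ 2 f x (fun _ => w) / 2) -
      h ^ 2 * (iteratedFDeriv ℝ 3 f x (fun _ => w) / 6) =
      (f (x + h • w) - f x - h * fderiv ℝ f x w -
        h ^ 2 / 2 * iteratedFDeriv ℝ 2 f x (fun _ => w) -
        h ^ 3 / 6 * iteratedFDeriv ℝ 3 f x (fun _ => w)) / h := by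
    rw [scaledGraph]; field_simp
  rw [e, abs_div, abs_of_pos hh, div_le_iff₀ hh]
  linarith

end FlatGraph

/-- The polynomially decaying weight `(1 + |w|) ^ (-K)`. -/
noncomputable def decayWeight (K : ℕ) (w : V) : ℝ := ((1 + ‖w‖) ^ K)⁻¹

theorem decayWeight_pos (K : ℕ) (w : V) : 0 < decayWeight K w := by
  unfold decayWeight; positivity

theorem decayWeight_add_le (K : ℕ) {ν : V} (hν : ‖ν‖ = 1) (w : V) {τ : ℝ} (hτ : |τ| ≤ 1) :
    decayWeight K (w + τ • ν) ≤ 2 ^ K * decayWeight K w := by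
  unfold decayWeight
  rw [← div_eq_mul_inv, inv_eq_one_div, div_le_div_iff₀ (by positivity) (by positivity), one_mul,
    ← mul_pow]
  have h1 : ‖τ • ν‖ ≤ 1 := by rw [norm_smul, hν, mul_one]; exact hτ
  have h2 : ‖w‖ ≤ ‖w + τ • ν‖ + ‖τ • ν‖ := by
    have := norm_sub_le (w + τ • ν) (τ • ν)
    simpa using this
  gcongr
  have := norm_nonneg (w + τ • ν)
  linarith

theorem pow_mul_decayWeight (M j : ℕ) (w : V) :
    (1 + ‖w‖) ^ j * decayWeight (M + j) w = decayWeight M w := by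
  unfold decayWeight
  have : (1 + ‖w‖) ≠ 0 := by positivity
  rw [pow_add]
  field_simp

theorem SchwartzMap.exists_abs_le_decayWeight (P : 𝓢(V, ℝ)) (K : ℕ) :
    ∃ C : ℝ, 0 ≤ C ∧ ∀ z, |P z| ≤ C * decayWeight K z := by
  have h := SchwartzMap.one_add_le_sup_seminorm_apply (𝕜 := ℝ) (m := (K, 0)) le_rfl le_rfl P
  simp only at h
  set C := (2 : ℝ) ^ K * ((Finset.Iic (K, 0)).sup fun m => SchwartzMap.seminorm ℝ m.1 m.2) P
  refine ⟨C, (le_trans (by positivity) (h 0) : (0 : ℝ) ≤ C), fun z => ?_⟩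
  · have := h z
    rw [norm_iteratedFDeriv_zero, Real.norm_eq_abs] at this
    rw [decayWeight, ← div_eq_mul_inv, le_div_iff₀ (by positivity), mul_comm]
    exact this

theorem SchwartzMap.hasDerivAt_line (P : 𝓢(V, ℝ)) (ν z : V) (s : ℝ) :
    HasDerivAt (fun s : ℝ => P (z + s • ν)) ((∂_{ν} P : 𝓢(V, ℝ)) (z + s • ν)) s := by
  have h1 : HasDerivAt (fun s : ℝ => z + s • ν) ν s := by
    simpa using ((hasDerivAt_id s).smul_const ν).const_add z
  have h2 := (P.differentiable (z + s • ν)).hasFDerivAt.comp_hasDerivAt s h1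
  rw [SchwartzMap.lineDerivOp_apply_eq_fderiv]
  exact h2

namespace FlatGraph

variable {ν : V} {f : V → ℝ} {L : ℝ}

/-- A displacement `s` along `ν` that is controlled by the slope of the graph does not spoil the
decay in `w`: since `|s| ≤ L |w + s ν|`, the norms of `w` and `w + s ν` are comparable. -/
theorem exists_abs_le_of_slope (hf : FlatGraph ν f L) (P : 𝓢(V, ℝ)) (K : ℕ) :
    ∃ C : ℝ, 0 ≤ C ∧ ∀ (w : V) (s : ℝ), |s| ≤ L * ‖w + s • ν‖ →
      |P (w + s • ν)| ≤ C * decayWeight K w := by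
  obtain ⟨C, hC, hP⟩ := P.exists_abs_le_decayWeight K
  have hL := hf.nonneg
  refine ⟨C * (1 + L) ^ K, by positivity, fun w s hs => (hP _).trans ?_⟩
  rw [mul_assoc]
  refine mul_le_mul_of_nonneg_left ?_ hC
  unfold decayWeight
  rw [← div_eq_mul_inv, inv_eq_one_div, div_le_div_iff₀ (by positivity) (by positivity), one_mul,
    ← mul_pow]
  gcongr
  have h2 : ‖w‖ ≤ ‖w + s • ν‖ + ‖s • ν‖ := by
    have := norm_sub_le (w + s • ν) (s • ν)
    simpa using this
  rw [norm_smul, hf.norm_eq_one, mul_one, Real.norm_eq_abs] at h2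
  nlinarith [norm_nonneg (w + s • ν)]

/-- The displacements between the tangent plane and the graph are controlled by the slope. -/
theorem abs_le_of_mem_uIcc (hf : FlatGraph ν f L) (x w : V) {h : ℝ} (hh : 0 < h) {s : ℝ}
    (hs : s ∈ Set.uIcc 0 (scaledGraph f x h w - fderiv ℝ f x w)) :
    |fderiv ℝ f x w + s| ≤ L * ‖w + (fderiv ℝ f x w + s) • ν‖ := by
  set r := fderiv ℝ f x w + s
  have h1 : |fderiv ℝ f x w| ≤ L * ‖w + r • ν‖ := by
    rw [← hf.fderiv_add_normal x w r]; exact hf.abs_fderiv_le x _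
  have h2 : |scaledGraph f x h w| ≤ L * ‖w + r • ν‖ := by
    rw [← hf.scaledGraph_add_normal x w h r]; exact hf.abs_scaledGraph_le x _ hh
  have h3 : r ∈ Set.uIcc (fderiv ℝ f x w) (scaledGraph f x h w) := by
    rw [Set.mem_uIcc] at hs ⊢
    rcases hs with hs | hs
    · left; constructor <;> simp only [r] <;> linarith [hs.1, hs.2]
    · right; constructor <;> simp only [r] <;> linarith [hs.1, hs.2]
  rw [abs_le] at h1 h2 ⊢
  rw [Set.mem_uIcc] at h3
  rcases h3 with h3 | h3 <;> constructor <;> linarith [h3.1, h3.2]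

/-- Replacing the blown-up graph by its tangent plane changes a Schwartz function by `O(h)`. -/
theorem exists_abs_sub_le (hf : FlatGraph ν f L) (P : 𝓢(V, ℝ)) (M : ℕ) :
    ∃ C : ℝ, 0 ≤ C ∧ ∀ (x w : V) (h : ℝ), 0 < h →
      |P (w + scaledGraph f x h w • ν) - P (w + fderiv ℝ f x w • ν)| ≤ C * h * decayWeight M w := by
  obtain ⟨C, hC, hP⟩ := hf.exists_abs_le_of_slope (∂_{ν} P : 𝓢(V, ℝ)) (M + 2)
  have hL := hf.nonneg
  refine ⟨C * L, by positivity, fun x w h hh => ?_⟩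
  have h1 := abs_sub_le_of_hasDerivAt (δ := scaledGraph f x h w - fderiv ℝ f x w)
    (f := fun s => P (w + fderiv ℝ f x w • ν + s • ν)) (B := C * decayWeight (M + 2) w)
    (fun s _ => P.hasDerivAt_line ν _ s) (fun s hs => ?_) _ Set.right_mem_uIcc
  · simp only [zero_smul, add_zero] at h1
    rw [add_assoc, ← add_smul, add_sub_cancel] at h1
    refine h1.trans ?_
    have hw := norm_nonneg w
    calc C * decayWeight (M + 2) w * |scaledGraph f x h w - fderiv ℝ f x w|
        ≤ C * decayWeight (M + 2) w * (L * h * (1 + ‖w‖) ^ 2) := by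
          have := decayWeight_pos (M + 2) w
          refine mul_le_mul_of_nonneg_left
            ((hf.abs_scaledGraph_sub_fderiv_le x w hh).trans ?_) (by positivity)
          gcongr; linarith
      _ = C * L * h * ((1 + ‖w‖) ^ 2 * decayWeight (M + 2) w) := by ring
      _ = _ := by rw [pow_mul_decayWeight]
  · rw [add_assoc, ← add_smul]
    exact hP w _ (hf.abs_le_of_mem_uIcc x w hh hs)

/-- Algebra of the third-order expansion: `δ` is the displacement and `D` the increment it causes. -/
theorem abs_sub_quadratic_le {δ h m₂ m₃ n₁ n₂ D A L B : ℝ} (hh : 0 < h) (hA : 1 ≤ A) (hL : 0 ≤ L)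
    (h1 : |δ| ≤ L * h * A ^ 2) (h2 : |δ - h * (m₂ / 2)| ≤ L * h ^ 2 * A ^ 3)
    (h3 : |δ - h * (m₂ / 2) - h ^ 2 * (m₃ / 6)| ≤ L * h ^ 3 * A ^ 4) (hm : |m₂| ≤ L * A ^ 2)
    (hn₁ : |n₁| ≤ B) (hn₂ : |n₂| ≤ B) (hD : |D - δ * n₁ - δ ^ 2 / 2 * n₂| ≤ B * |δ| ^ 3) :
    |D - m₂ / 2 * n₁ * h - (m₃ / 6 * n₁ + m₂ ^ 2 / 8 * n₂) * h ^ 2| ≤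
      (L + L ^ 2 + L ^ 3) * h ^ 3 * (A ^ 6 * B) := by
  have hB : 0 ≤ B := (abs_nonneg _).trans hn₁
  have e : D - m₂ / 2 * n₁ * h - (m₃ / 6 * n₁ + m₂ ^ 2 / 8 * n₂) * h ^ 2 =
      (D - δ * n₁ - δ ^ 2 / 2 * n₂) + (δ - h * (m₂ / 2) - h ^ 2 * (m₃ / 6)) * n₁ +
        (δ - h * (m₂ / 2)) * ((δ + h * (m₂ / 2)) / 2) * n₂ := by ring
  have t1 : |D - δ * n₁ - δ ^ 2 / 2 * n₂| ≤ L ^ 3 * h ^ 3 * (A ^ 6 * B) := by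
    refine hD.trans ?_
    calc B * |δ| ^ 3 ≤ B * (L * h * A ^ 2) ^ 3 := by gcongr
      _ = _ := by ring
  have t2 : |(δ - h * (m₂ / 2) - h ^ 2 * (m₃ / 6)) * n₁| ≤ L * h ^ 3 * (A ^ 6 * B) := by
    rw [abs_mul]
    calc _ ≤ L * h ^ 3 * A ^ 4 * B := by gcongr
      _ ≤ L * h ^ 3 * A ^ 6 * B := by gcongr <;> norm_num
      _ = _ := by ring
  have t3 : |(δ - h * (m₂ / 2)) * ((δ + h * (m₂ / 2)) / 2) * n₂| ≤ L ^ 2 * h ^ 3 * (A ^ 6 * B) := by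
    rw [abs_mul, abs_mul]
    have h5 : |(δ + h * (m₂ / 2)) / 2| ≤ L * h * A ^ 2 := by
      rw [abs_le] at h1 hm ⊢
      constructor <;> nlinarith [h1.1, h1.2, hm.1, hm.2]
    calc _ ≤ (L * h ^ 2 * A ^ 3) * (L * h * A ^ 2) * B := by gcongr
      _ = L ^ 2 * h ^ 3 * A ^ 5 * B := by ring
      _ ≤ L ^ 2 * h ^ 3 * A ^ 6 * B := by gcongr <;> norm_num
      _ = _ := by ring
  rw [e]
  refine (abs_add_le _ _).trans ?_
  have := abs_add_le (D - δ * n₁ - δ ^ 2 / 2 * n₂)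
    ((δ - h * (m₂ / 2) - h ^ 2 * (m₃ / 6)) * n₁)
  linarith

/-- Replacing the blown-up graph by its tangent plane changes `P` by a quadratic polynomial in the
scale `h`, up to `O(h³)`. The coefficients depend on the point, but they do not matter: the
combination of scales in the threshold function annihilates `h` and `h²`. -/
theorem exists_abs_sub_quadratic_le (hf : FlatGraph ν f L) (P : 𝓢(V, ℝ)) (M : ℕ) :
    ∃ C : ℝ, 0 ≤ C ∧ ∀ x w : V, ∃ b₁ b₂ : ℝ, ∀ h : ℝ, 0 < h →
      |P (w + scaledGraph f x h w • ν) - P (w + fderiv ℝ f x w • ν) - b₁ * h - b₂ * h ^ 2| ≤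
        C * h ^ 3 * decayWeight M w := by
  obtain ⟨C₁, hC₁, hP₁⟩ := hf.exists_abs_le_of_slope (∂_{ν} P : 𝓢(V, ℝ)) (M + 6)
  obtain ⟨C₂, hC₂, hP₂⟩ := hf.exists_abs_le_of_slope (∂_{ν} (∂_{ν} P) : 𝓢(V, ℝ)) (M + 6)
  obtain ⟨C₃, hC₃, hP₃⟩ := hf.exists_abs_le_of_slope (∂_{ν} (∂_{ν} (∂_{ν} P)) : 𝓢(V, ℝ)) (M + 6)
  have hL := hf.nonneg
  refine ⟨(L + L ^ 2 + L ^ 3) * (C₁ + C₂ + C₃), by positivity, fun x w => ?_⟩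
  set z := w + fderiv ℝ f x w • ν with hz
  set W := decayWeight (M + 6) w with hW
  have hWp : 0 < W := decayWeight_pos _ _
  refine ⟨iteratedFDeriv ℝ 2 f x (fun _ => w) / 2 * (∂_{ν} P : 𝓢(V, ℝ)) z,
    iteratedFDeriv ℝ 3 f x (fun _ => w) / 6 * (∂_{ν} P : 𝓢(V, ℝ)) z +
    iteratedFDeriv ℝ 2 f x (fun _ => w) ^ 2 / 8 * (∂_{ν} (∂_{ν} P) : 𝓢(V, ℝ)) z, fun h hh => ?_⟩
  have hlin : |fderiv ℝ f x w| ≤ L * ‖w + fderiv ℝ f x w • ν‖ := by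
    simpa using hf.abs_le_of_mem_uIcc x w hh (s := 0) Set.left_mem_uIcc
  have hw := norm_nonneg w
  have hA : (1 : ℝ) ≤ 1 + ‖w‖ := by linarith
  have hwA : ‖w‖ ≤ 1 + ‖w‖ := by linarith
  have h1 := abs_taylor_three_le (δ := scaledGraph f x h w - fderiv ℝ f x w)
    (f := fun s => P (z + s • ν)) (B := (C₁ + C₂ + C₃) * W)
    (fun s _ => P.hasDerivAt_line ν _ s)
    (fun s _ => (∂_{ν} P : 𝓢(V, ℝ)).hasDerivAt_line ν _ s)
    (fun s _ => (∂_{ν} (∂_{ν} P) : 𝓢(V, ℝ)).hasDerivAt_line ν _ s)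
    (fun s hs => ?_) _ Set.right_mem_uIcc
  · simp only [zero_smul, add_zero] at h1
    rw [hz, add_assoc w, ← add_smul, add_sub_cancel, ← hz] at h1
    refine (abs_sub_quadratic_le hh hA hL
      ((hf.abs_scaledGraph_sub_fderiv_le x w hh).trans (by gcongr))
      ((hf.abs_scaledGraph_sub_two_le x w hh).trans (by gcongr))
      ((hf.abs_scaledGraph_sub_three_le x w hh).trans (by gcongr))
      ((hf.bound 2 (by norm_num) (by norm_num) x w).trans (by gcongr))
      ((hP₁ w _ hlin).trans ?_) ((hP₂ w _ hlin).trans ?_) h1).trans ?_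
    · rw [← hW]; gcongr; linarith
    · rw [← hW]; gcongr; linarith
    · apply le_of_eq
      rw [← pow_mul_decayWeight M 6 w, ← hW]
      ring
  · rw [hz, add_assoc, ← add_smul]
    refine (hP₃ w _ (hf.abs_le_of_mem_uIcc x w hh hs)).trans ?_
    rw [← hW]; gcongr; linarith

/-- Mixed difference in the scale and in a bounded shift along the normal. -/
theorem exists_abs_mixed_sub_le (hf : FlatGraph ν f L) (P : 𝓢(V, ℝ)) (M : ℕ) :
    ∃ C : ℝ, 0 ≤ C ∧ ∀ (x w : V) (h τ : ℝ), 0 < h → |τ| ≤ 1 →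
      |(P (w + (scaledGraph f x h w + τ) • ν) - P (w + (fderiv ℝ f x w + τ) • ν)) -
        (P (w + scaledGraph f x h w • ν) - P (w + fderiv ℝ f x w • ν))| ≤
        C * h * |τ| * decayWeight M w := by
  obtain ⟨C, hC, hP⟩ := hf.exists_abs_sub_le (∂_{ν} P : 𝓢(V, ℝ)) M
  refine ⟨C * 2 ^ M, by positivity, fun x w h τ hh hτ => ?_⟩
  have h1 := abs_sub_le_of_hasDerivAt (δ := τ)
    (f := fun s => P (w + scaledGraph f x h w • ν + s • ν) - P (w + fderiv ℝ f x w • ν + s • ν))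
    (B := C * h * (2 ^ M * decayWeight M w))
    (fun s _ => (P.hasDerivAt_line ν _ s).sub (P.hasDerivAt_line ν _ s)) (fun s hs => ?_)
    _ Set.right_mem_uIcc
  · simp only [zero_smul, add_zero] at h1
    rw [add_smul, add_smul, ← add_assoc, ← add_assoc]
    refine h1.trans (le_of_eq (by ring))
  · have hs1 : |s| ≤ 1 := by
      have := Set.abs_sub_left_of_mem_uIcc hs
      simp only [sub_zero] at this; linarith
    have h2 := hP x (w + s • ν) h hh
    rw [hf.scaledGraph_add_normal, hf.fderiv_add_normal, add_right_comm w (s • ν),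
      add_right_comm w (s • ν)] at h2
    refine h2.trans ?_
    gcongr
    exact decayWeight_add_le M hf.norm_eq_one w hs1

/-- A bounded shift of the tangent plane along the normal. -/
theorem exists_abs_shift_sub_le (hf : FlatGraph ν f L) (P : 𝓢(V, ℝ)) (M : ℕ) :
    ∃ C : ℝ, 0 ≤ C ∧ ∀ (x w : V) (τ : ℝ), |τ| ≤ 1 →
      |P (w + (fderiv ℝ f x w + τ) • ν) - P (w + fderiv ℝ f x w • ν)| ≤
        C * |τ| * decayWeight M w := by
  obtain ⟨C, hC, hP⟩ := hf.exists_abs_le_of_slope (∂_{ν} P : 𝓢(V, ℝ)) M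
  refine ⟨C * 2 ^ M, by positivity, fun x w τ hτ => ?_⟩
  have h1 := abs_sub_le_of_hasDerivAt (δ := τ)
    (f := fun s => P (w + fderiv ℝ f x w • ν + s • ν))
    (B := C * (2 ^ M * decayWeight M w))
    (fun s _ => P.hasDerivAt_line ν _ s) (fun s hs => ?_) _ Set.right_mem_uIcc
  · simp only [zero_smul, add_zero] at h1
    rw [add_smul, ← add_assoc]
    refine h1.trans (le_of_eq (by ring))
  · have hs1 : |s| ≤ 1 := by
      have := Set.abs_sub_left_of_mem_uIcc hs
      simp only [sub_zero] at this; linarith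
    have h2 := hP (w + s • ν) (fderiv ℝ f x w) ?_
    · rw [add_right_comm w (s • ν)] at h2
      refine h2.trans ?_
      gcongr
      exact decayWeight_add_le M hf.norm_eq_one w hs1
    · rw [← hf.fderiv_add_normal x w s]
      have := hf.abs_le_of_mem_uIcc x (w + s • ν) one_pos (s := 0) Set.left_mem_uIcc
      simpa using this

end FlatGraph

end FlatGraph

/-! ### The volume-preserving shear -/

section Shear

set_option linter.unusedSectionVars false

variable {V : Type*} [NormedAddCommGroup V] [InnerProductSpace ℝ V] [FiniteDimensional ℝ V]
  [MeasurableSpace V] [BorelSpace V]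

theorem integrable_decayWeight : Integrable (decayWeight (V := V) (Module.finrank ℝ V + 1)) := by
  have h := integrable_one_add_norm (E := V) (μ := volume) (r := ((Module.finrank ℝ V + 1 : ℕ) : ℝ))
    (by push_cast; linarith)
  refine h.congr (Filter.Eventually.of_forall fun z => ?_)
  simp only
  rw [Real.rpow_neg (by positivity), Real.rpow_natCast]
  rfl

/-- The shear `w ↦ w + q(w) ν` preserves volume when `q` does not depend on the `ν`-coordinate, and
it carries a half-space onto the region below the graph of `q`. -/
theorem setIntegral_subgraph_eq {ν : V} (hν : ‖ν‖ = 1) {q : V → ℝ} (hq : Differentiable ℝ q)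
    (hinv : ∀ (w : V) (s : ℝ), q (w + s • ν) = q w) (F : V → ℝ) :
    ∫ z in {z : V | inner ℝ ν z ≤ q z}, F z =
      ∫ w in {w : V | inner ℝ ν w ≤ 0}, F (w + q w • ν) := by
  have himg : (fun w => w + q w • ν) '' {w : V | inner ℝ ν w ≤ 0} =
      {z : V | inner ℝ ν z ≤ q z} := by
    have hνν : inner ℝ ν ν = (1 : ℝ) := by rw [real_inner_self_eq_norm_sq, hν, one_pow]
    ext z
    simp only [Set.mem_image, Set.mem_ofPred_eq]
    constructor
    · rintro ⟨w, hw, rfl⟩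
      rw [hinv, inner_add_right, inner_smul_right, hνν]
      linarith
    · intro hz
      refine ⟨z + (-q z) • ν, ?_, ?_⟩
      · rw [inner_add_right, inner_smul_right, hνν]; linarith
      · rw [hinv, add_assoc, ← add_smul, neg_add_cancel, zero_smul, add_zero]
  have hm : MeasurableSet {w : V | inner ℝ ν w ≤ 0} :=
    measurableSet_le (by fun_prop) measurable_const
  have hd : ∀ w, HasFDerivAt (fun w => w + q w • ν)
      (ContinuousLinearMap.id ℝ V + (fderiv ℝ q w).smulRight ν) w := fun w =>
    (hasFDerivAt_id w).add ((hq w).hasFDerivAt.smul_const ν)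
  have hinj : Set.InjOn (fun w => w + q w • ν) {w : V | inner ℝ ν w ≤ 0} := by
    intro w₁ _ w₂ _ h
    simp only at h
    have hqq : q w₁ = q w₂ := by
      rw [← hinv w₁ (q w₁), ← hinv w₂ (q w₂), h]
    rw [hqq] at h
    exact add_right_cancel h
  have h0 : ∀ w, fderiv ℝ q w ν = 0 := by
    intro w
    have h1 : HasDerivAt (fun s : ℝ => w + s • ν) ν 0 := by
      simpa using ((hasDerivAt_id (0 : ℝ)).smul_const ν).const_add w
    have h2 := (hq (w + (0 : ℝ) • ν)).hasFDerivAt.comp_hasDerivAt 0 h1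
    have h3 : (q ∘ fun s : ℝ => w + s • ν) = fun _ => q w := by
      funext s; exact hinv w s
    rw [h3, zero_smul, add_zero] at h2
    exact h2.unique (hasDerivAt_const _ _)
  rw [← himg, integral_image_eq_integral_abs_det_fderiv_smul volume hm
    (fun w _ => (hd w).hasFDerivWithinAt) hinj]
  congr 1
  funext w
  have : (ContinuousLinearMap.id ℝ V + (fderiv ℝ q w).smulRight ν).det = 1 := by
    have e : ((ContinuousLinearMap.id ℝ V + (fderiv ℝ q w).smulRight ν : V →L[ℝ] V) : V →ₗ[ℝ] V) =
        LinearMap.transvection (fderiv ℝ q w : V →ₗ[ℝ] ℝ) ν := by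
      ext v; simp [LinearMap.transvection.apply]
    rw [ContinuousLinearMap.det, e, LinearMap.transvection.det]
    simp [h0]
  rw [this, abs_one, one_smul]

end Shear

namespace FlatGraph

/-! ### Displaced Schwartz functions -/

section Combination

set_option linter.unusedSectionVars false

variable {V : Type*} [NormedAddCommGroup V] [InnerProductSpace ℝ V]
variable {ν : V} {f : V → ℝ} {L : ℝ}

/-- The quadratic expansion in `h` with a normal shift `τ`, whose coefficients do not depend on
`τ`. -/
theorem exists_abs_shifted_sub_quadratic_le (hf : FlatGraph ν f L) (P : 𝓢(V, ℝ)) (M : ℕ) :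
    ∃ C : ℝ, 0 ≤ C ∧ ∀ x w : V, ∃ b₁ b₂ : ℝ, ∀ h τ : ℝ, 0 < h → |τ| ≤ 1 →
      |P (w + (scaledGraph f x h w + τ) • ν) - P (w + (fderiv ℝ f x w + τ) • ν) -
        b₁ * h - b₂ * h ^ 2| ≤ C * (h ^ 3 + h * |τ|) * decayWeight M w := by
  obtain ⟨C₁, hC₁, hP₁⟩ := hf.exists_abs_sub_quadratic_le P M
  obtain ⟨C₂, hC₂, hP₂⟩ := hf.exists_abs_mixed_sub_le P M
  refine ⟨C₁ + C₂, by positivity, fun x w => ?_⟩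
  obtain ⟨b₁, b₂, hb⟩ := hP₁ x w
  refine ⟨b₁, b₂, fun h τ hh hτ => ?_⟩
  have hW := decayWeight_pos M w
  have h1 := hb h hh
  have h2 := hP₂ x w h τ hh hτ
  have h3 : C₁ * h ^ 3 * decayWeight M w + C₂ * h * |τ| * decayWeight M w ≤
      (C₁ + C₂) * (h ^ 3 + h * |τ|) * decayWeight M w := by
    have : 0 ≤ C₁ * (h * |τ|) * decayWeight M w := by positivity
    have : 0 ≤ C₂ * h ^ 3 * decayWeight M w := by positivity
    linarith
  rw [abs_le] at h1 h2 ⊢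
  constructor <;> linarith [h1.1, h1.2, h2.1, h2.2]

theorem exists_abs_shifted_sub_const_le (hf : FlatGraph ν f L) (P : 𝓢(V, ℝ)) (M : ℕ) :
    ∃ C : ℝ, 0 ≤ C ∧ ∀ x w : V, ∃ b : ℝ, ∀ h τ : ℝ, 0 < h → |τ| ≤ 1 →
      |P (w + (scaledGraph f x h w + τ) • ν) - b| ≤ C * (h + |τ|) * decayWeight M w := by
  obtain ⟨C₁, hC₁, hP₁⟩ := hf.exists_abs_sub_le P M
  obtain ⟨C₂, hC₂, hP₂⟩ := hf.exists_abs_shift_sub_le P M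
  refine ⟨2 ^ M * C₁ + C₂, by positivity, fun x w => ⟨P (w + fderiv ℝ f x w • ν),
    fun h τ hh hτ => ?_⟩⟩
  have hW := decayWeight_pos M w
  have h1 := hP₁ x (w + τ • ν) h hh
  rw [hf.scaledGraph_add_normal, hf.fderiv_add_normal, add_assoc w, add_assoc w, ← add_smul,
    ← add_smul, add_comm τ, add_comm τ] at h1
  have h4 : C₁ * h * decayWeight M (w + τ • ν) ≤ C₁ * h * (2 ^ M * decayWeight M w) := by
    gcongr
    exact decayWeight_add_le M hf.norm_eq_one w hτ
  have h2 := hP₂ x w τ hτ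
  have h3 : C₁ * h * (2 ^ M * decayWeight M w) + C₂ * |τ| * decayWeight M w ≤
      (2 ^ M * C₁ + C₂) * (h + |τ|) * decayWeight M w := by
    have : 0 ≤ 2 ^ M * C₁ * |τ| * decayWeight M w := by positivity
    have : 0 ≤ C₂ * h * decayWeight M w := by positivity
    linarith
  rw [abs_le] at h1 h2 ⊢
  constructor <;> linarith [h1.1, h1.2, h2.1, h2.2]

/-- The version for large shifts: the weight moves along with the shift. -/
theorem exists_abs_shifted_sub_le (hf : FlatGraph ν f L) (P : 𝓢(V, ℝ)) (M : ℕ) :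
    ∃ C : ℝ, 0 ≤ C ∧ ∀ (x w : V) (h τ : ℝ), 0 < h →
      |P (w + (scaledGraph f x h w + τ) • ν) - P (w + (fderiv ℝ f x w + τ) • ν)| ≤
        C * h * decayWeight M (w + τ • ν) := by
  obtain ⟨C₁, hC₁, hP₁⟩ := hf.exists_abs_sub_le P M
  refine ⟨C₁, hC₁, fun x w h τ hh => ?_⟩
  have h1 := hP₁ x (w + τ • ν) h hh
  rwa [hf.scaledGraph_add_normal, hf.fderiv_add_normal, add_assoc w, add_assoc w, ← add_smul,
    ← add_smul, add_comm τ, add_comm τ] at h1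

theorem exists_abs_shifted_le (hf : FlatGraph ν f L) (P : 𝓢(V, ℝ)) (M : ℕ) :
    ∃ C : ℝ, 0 ≤ C ∧ ∀ (x w : V) (τ : ℝ),
      |P (w + (fderiv ℝ f x w + τ) • ν)| ≤ C * decayWeight M (w + τ • ν) ∧
      ∀ h : ℝ, 0 < h →
        |P (w + (scaledGraph f x h w + τ) • ν)| ≤ C * decayWeight M (w + τ • ν) := by
  obtain ⟨C, hC, hP⟩ := hf.exists_abs_le_of_slope P M
  refine ⟨C, hC, fun x w τ => ⟨?_, fun h hh => ?_⟩⟩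
  · have h1 := hP (w + τ • ν) (fderiv ℝ f x w) ?_
    · rwa [add_assoc w, ← add_smul, add_comm τ] at h1
    · simpa only [hf.fderiv_add_normal] using
        hf.abs_fderiv_le x (w + τ • ν + fderiv ℝ f x w • ν)
  · have h1 := hP (w + τ • ν) (scaledGraph f x h w) ?_
    · rwa [add_assoc w, ← add_smul, add_comm τ] at h1
    · simpa only [hf.scaledGraph_add_normal] using
        hf.abs_scaledGraph_le x (w + τ • ν + scaledGraph f x h w • ν) hh

end Combination

/-- The cancellation `3 - 3 * 2 + 3 = 0` and `3 - 3 * 4 + 9 = 0` of the coefficients `b₁`, `b₂`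
and `b`. -/
theorem abs_combination_le_of_abs_sub_le {h D₁ D₂ D₃ a₁ a₂ a₃ Q₁ Q₂ Q₃ b₁ b₂ b C₁ C₂ E : ℝ}
    (u₁ : |D₁ - a₁ - b₁ * h - b₂ * h ^ 2| ≤ C₁ * E)
    (u₂ : |D₂ - a₂ - b₁ * (2 * h) - b₂ * (2 * h) ^ 2| ≤ 8 * C₁ * E)
    (u₃ : |D₃ - a₃ - b₁ * (3 * h) - b₂ * (3 * h) ^ 2| ≤ 27 * C₁ * E)
    (v₁ : h ^ 2 * |Q₁ - b| ≤ C₂ * E) (v₂ : h ^ 2 * |Q₂ - b| ≤ 2 * C₂ * E)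
    (v₃ : h ^ 2 * |Q₃ - b| ≤ 3 * C₂ * E) :
    |3 * (D₁ + h ^ 2 * Q₁ - a₁) - 3 * (D₂ + (2 * h) ^ 2 * Q₂ - a₂) +
      (D₃ + (3 * h) ^ 2 * Q₃ - a₃)| ≤ 54 * (C₁ + C₂) * E := by
  have hh : |h ^ 2| = h ^ 2 := abs_of_nonneg (sq_nonneg h)
  rw [← hh, ← abs_mul, abs_le] at v₁ v₂ v₃
  rw [abs_le] at u₁ u₂ u₃ ⊢
  obtain ⟨u₁, u₁'⟩ := u₁
  obtain ⟨u₂, u₂'⟩ := u₂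
  obtain ⟨u₃, u₃'⟩ := u₃
  obtain ⟨v₁, v₁'⟩ := v₁
  obtain ⟨v₂, v₂'⟩ := v₂
  obtain ⟨v₃, v₃'⟩ := v₃
  constructor <;> linarith

/-! ### Cancellation in the combination of three scales -/

section Integrals

set_option linter.unusedSectionVars false

variable {V : Type*} [NormedAddCommGroup V] [InnerProductSpace ℝ V] [FiniteDimensional ℝ V]
  [MeasurableSpace V] [BorelSpace V]
variable {ν : V} {f : V → ℝ} {L : ℝ}

theorem integrable_shifted (hf : FlatGraph ν f L) (P : 𝓢(V, ℝ)) (x : V) {h : ℝ} (hh : 0 < h)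
    (τ : ℝ) : Integrable fun w => P (w + (scaledGraph f x h w + τ) • ν) := by
  obtain ⟨C, hC, hP⟩ := hf.exists_abs_shifted_le P (Module.finrank ℝ V + 1)
  refine ((integrable_decayWeight.comp_add_right (τ • ν)).const_mul C).mono' ?_
    (Filter.Eventually.of_forall fun w => (hP x w τ).2 h hh)
  have := (hf.differentiable_scaledGraph x h).continuous
  exact (P.continuous.comp (by fun_prop)).aestronglyMeasurable

theorem integrable_tangent (hf : FlatGraph ν f L) (P : 𝓢(V, ℝ)) (x : V) (τ : ℝ) :
    Integrable fun w => P (w + (fderiv ℝ f x w + τ) • ν) := by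
  obtain ⟨C, hC, hP⟩ := hf.exists_abs_shifted_le P (Module.finrank ℝ V + 1)
  refine ((integrable_decayWeight.comp_add_right (τ • ν)).const_mul C).mono' ?_
    (Filter.Eventually.of_forall fun w => (hP x w τ).1)
  exact (P.continuous.comp (by fun_prop)).aestronglyMeasurable

/-- The integral of `P₀ + h² P₁` over the region below the blown-up graph. -/
noncomputable def graphIntegral (ν : V) (f : V → ℝ) (P₀ P₁ : 𝓢(V, ℝ)) (x : V) (h τ : ℝ) : ℝ :=
  ∫ w in {w : V | inner ℝ ν w ≤ 0}, (P₀ (w + (scaledGraph f x h w + τ) • ν) +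
    h ^ 2 * P₁ (w + (scaledGraph f x h w + τ) • ν))

/-- The integral of `P` over the half-space bounded by the tangent plane. -/
noncomputable def tangentIntegral (ν : V) (f : V → ℝ) (P : 𝓢(V, ℝ)) (x : V) (τ : ℝ) : ℝ :=
  ∫ w in {w : V | inner ℝ ν w ≤ 0}, P (w + (fderiv ℝ f x w + τ) • ν)

/-- Pointwise form of the comparison: the combination with weights `3, -3, 1` at scales `1, 2, 3`
kills the terms of orders `h` and `h²` coming from the curvature of the graph, and the constant
term of the correction `h² P₁`. -/
theorem exists_abs_combination_le (hf : FlatGraph ν f L) (P₀ P₁ : 𝓢(V, ℝ)) (M : ℕ) :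
    ∃ C : ℝ, 0 ≤ C ∧ ∀ (x w : V) (h τ : ℝ) (G : ℝ → ℝ → ℝ), 0 < h → h ≤ 1 →
      (∀ h τ, G h τ = P₀ (w + (scaledGraph f x h w + τ) • ν) +
        h ^ 2 * P₁ (w + (scaledGraph f x h w + τ) • ν) - P₀ (w + (fderiv ℝ f x w + τ) • ν)) →
      |3 * G h τ - 3 * G (2 * h) (τ / 2) + G (3 * h) (τ / 3)| ≤
        C * (h ^ 3 + h * min |τ| 1) * (decayWeight M w + decayWeight M (w + τ • ν) +
          decayWeight M (w + (τ / 2) • ν) + decayWeight M (w + (τ / 3) • ν)) := by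
  obtain ⟨C₁, hC₁, hP₁⟩ := hf.exists_abs_shifted_sub_quadratic_le P₀ M
  obtain ⟨C₂, hC₂, hP₂⟩ := hf.exists_abs_shifted_sub_const_le P₁ M
  obtain ⟨C₃, hC₃, hP₃⟩ := hf.exists_abs_shifted_sub_le P₀ M
  obtain ⟨C₄, hC₄, hP₄⟩ := hf.exists_abs_shifted_le P₁ M
  refine ⟨100 * (C₁ + C₂ + C₃ + C₄), by positivity, fun x w h τ G hh hh1 hG => ?_⟩
  rw [hG, hG, hG]
  have hW := decayWeight_pos M w
  have hW1 := decayWeight_pos M (w + τ • ν)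
  have hW2 := decayWeight_pos M (w + (τ / 2) • ν)
  have hW3 := decayWeight_pos M (w + (τ / 3) • ν)
  have hh2 : 0 < 2 * h := by linarith
  have hh3 : 0 < 3 * h := by linarith
  set W := decayWeight M w
  set W1 := decayWeight M (w + τ • ν)
  set W2 := decayWeight M (w + (τ / 2) • ν)
  set W3 := decayWeight M (w + (τ / 3) • ν)
  have htau2 : |τ / 2| = |τ| / 2 := by rw [abs_div]; norm_num
  have htau3 : |τ / 3| = |τ| / 3 := by rw [abs_div]; norm_num
  rcases le_total |τ| 1 with hτ | hτ
  · have hτ2 : |τ / 2| ≤ 1 := by rw [htau2]; linarith [abs_nonneg τ]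
    have hτ3 : |τ / 3| ≤ 1 := by rw [htau3]; linarith [abs_nonneg τ]
    rw [min_eq_left hτ]
    obtain ⟨b₁, b₂, hb⟩ := hP₁ x w
    obtain ⟨b, hb'⟩ := hP₂ x w
    have u1 := hb h τ hh hτ
    have u2 := hb (2 * h) (τ / 2) hh2 hτ2
    have u3 := hb (3 * h) (τ / 3) hh3 hτ3
    have v1 := hb' h τ hh hτ
    have v2 := hb' (2 * h) (τ / 2) hh2 hτ2
    have v3 := hb' (3 * h) (τ / 3) hh3 hτ3
    rw [htau2] at u2 v2
    rw [htau3] at u3 v3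
    have hT : 0 ≤ |τ| := abs_nonneg τ
    set E := (h ^ 3 + h * |τ|) * W with hE
    have hE0 : 0 ≤ E := by positivity
    refine (abs_combination_le_of_abs_sub_le (b₁ := b₁) (b₂ := b₂) (b := b) (C₁ := C₁) (C₂ := C₂)
      (E := E) (u1.trans (le_of_eq ?_)) (u2.trans ?_) (u3.trans ?_) ?_ ?_ ?_).trans ?_
    · rw [hE]; ring
    · have : 0 ≤ C₁ * (h * |τ|) * W := by positivity
      rw [hE]; linarith
    · have : 0 ≤ C₁ * (h * |τ|) * W := by positivity
      rw [hE]; linarith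
    · have h2 : h ^ 2 * (C₂ * (h + |τ|) * W) ≤ C₂ * E := by
        rw [hE]
        have : 0 ≤ C₂ * |τ| * W * h * (1 - h) :=
          mul_nonneg (by positivity) (by linarith)
        linarith
      exact (mul_le_mul_of_nonneg_left v1 (by positivity)).trans h2
    · have h2 : h ^ 2 * (C₂ * (2 * h + |τ| / 2) * W) ≤ 2 * C₂ * E := by
        rw [hE]
        have : 0 ≤ C₂ * |τ| * W * h * (1 - h) :=
          mul_nonneg (by positivity) (by linarith)
        have : 0 ≤ C₂ * |τ| * W * h := by positivity
        linarith
      exact (mul_le_mul_of_nonneg_left v2 (by positivity)).trans h2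
    · have h2 : h ^ 2 * (C₂ * (3 * h + |τ| / 3) * W) ≤ 3 * C₂ * E := by
        rw [hE]
        have : 0 ≤ C₂ * |τ| * W * h * (1 - h) :=
          mul_nonneg (by positivity) (by linarith)
        have : 0 ≤ C₂ * |τ| * W * h := by positivity
        linarith
      exact (mul_le_mul_of_nonneg_left v3 (by positivity)).trans h2
    · have hc : 54 * (C₁ + C₂) ≤ 100 * (C₁ + C₂ + C₃ + C₄) := by linarith
      calc 54 * (C₁ + C₂) * E ≤ 100 * (C₁ + C₂ + C₃ + C₄) * E := by gcongr
        _ = 100 * (C₁ + C₂ + C₃ + C₄) * (h ^ 3 + h * |τ|) * W := by rw [hE]; ring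
        _ ≤ _ := by gcongr; linarith
  -- For `|τ| ≥ 1` the bound is only of order `h`, and no cancellation is needed.
  · rw [min_eq_right hτ]
    have u1 := hP₃ x w h τ hh
    have u2 := hP₃ x w (2 * h) (τ / 2) hh2
    have u3 := hP₃ x w (3 * h) (τ / 3) hh3
    have v1 := (hP₄ x w τ).2 h hh
    have v2 := (hP₄ x w (τ / 2)).2 (2 * h) hh2
    have v3 := (hP₄ x w (τ / 3)).2 (3 * h) hh3
    have hsq : h ^ 2 ≤ h := by nlinarith
    refine (abs_combination_le_of_abs_sub_le (b₁ := 0) (b₂ := 0) (b := 0) (C₁ := C₃) (C₂ := C₄)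
      (E := h * (W1 + W2 + W3)) ?_ ?_ ?_ ?_ ?_ ?_).trans ?_
    · rw [zero_mul, zero_mul, sub_zero, sub_zero]
      refine u1.trans ?_
      rw [mul_assoc]
      gcongr; linarith
    · rw [zero_mul, zero_mul, sub_zero, sub_zero]
      refine u2.trans ?_
      have : 0 ≤ C₃ * h * (8 * W1 + 6 * W2 + 8 * W3) := by positivity
      linarith
    · rw [zero_mul, zero_mul, sub_zero, sub_zero]
      refine u3.trans ?_
      have : 0 ≤ C₃ * h * (27 * W1 + 27 * W2 + 24 * W3) := by positivity
      linarith
    · rw [sub_zero]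
      refine (mul_le_mul hsq v1 (abs_nonneg _) hh.le).trans ?_
      have : 0 ≤ C₄ * h * (W2 + W3) := by positivity
      linarith
    · rw [sub_zero]
      refine (mul_le_mul hsq v2 (abs_nonneg _) hh.le).trans ?_
      have : 0 ≤ C₄ * h * (2 * W1 + W2 + 2 * W3) := by positivity
      linarith
    · rw [sub_zero]
      refine (mul_le_mul hsq v3 (abs_nonneg _) hh.le).trans ?_
      have : 0 ≤ C₄ * h * (3 * W1 + 3 * W2 + 2 * W3) := by positivity
      linarith
    · have hc : 54 * (C₃ + C₄) ≤ 100 * (C₁ + C₂ + C₃ + C₄) := by linarith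
      have hq : h * (W1 + W2 + W3) ≤ (h ^ 3 + h * 1) * (W + W1 + W2 + W3) := by
        gcongr
        · have : 0 ≤ h ^ 3 := by positivity
          linarith
        · linarith
      calc _ ≤ 100 * (C₁ + C₂ + C₃ + C₄) * ((h ^ 3 + h * 1) * (W + W1 + W2 + W3)) := by gcongr
        _ = _ := by ring

/-- Comparison of the curved region with the half-space under its tangent plane. Here `τ / b` is the
height of the graph over the base point, measured at scale `b h`. -/
theorem exists_abs_graphIntegral_sub_le (hf : FlatGraph ν f L) (P₀ P₁ : 𝓢(V, ℝ)) :
    ∃ C : ℝ, 0 ≤ C ∧ ∀ (x : V) (h τ : ℝ), 0 < h → h ≤ 1 →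
      |(3 * graphIntegral ν f P₀ P₁ x h τ - 3 * graphIntegral ν f P₀ P₁ x (2 * h) (τ / 2) +
          graphIntegral ν f P₀ P₁ x (3 * h) (τ / 3)) -
        (3 * tangentIntegral ν f P₀ x τ - 3 * tangentIntegral ν f P₀ x (τ / 2) +
          tangentIntegral ν f P₀ x (τ / 3))| ≤ C * (h ^ 3 + h * min |τ| 1) := by
  obtain ⟨C, hC, hP⟩ := hf.exists_abs_combination_le P₀ P₁ (Module.finrank ℝ V + 1)
  set I := ∫ w : V, decayWeight (Module.finrank ℝ V + 1) w with hI
  have hI0 : 0 ≤ I := integral_nonneg fun w => (decayWeight_pos _ w).le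
  refine ⟨C * (4 * I), by positivity, fun x h τ hh hh1 => ?_⟩
  set H := {w : V | inner ℝ ν w ≤ 0}
  set G : V → ℝ → ℝ → ℝ := fun w h τ => P₀ (w + (scaledGraph f x h w + τ) • ν) +
        h ^ 2 * P₁ (w + (scaledGraph f x h w + τ) • ν) - P₀ (w + (fderiv ℝ f x w + τ) • ν) with hG
  have hGi : ∀ h, 0 < h → ∀ τ, IntegrableOn (fun w => G w h τ) H := fun h hh τ =>
    (((hf.integrable_shifted P₀ x hh τ).add ((hf.integrable_shifted P₁ x hh τ).const_mul _)).sub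
      (hf.integrable_tangent P₀ x τ)).integrableOn
  have hGe : ∀ h, 0 < h → ∀ τ, ∫ w in H, G w h τ =
      graphIntegral ν f P₀ P₁ x h τ - tangentIntegral ν f P₀ x τ := fun h hh τ =>
    integral_sub (((hf.integrable_shifted P₀ x hh τ).add
      ((hf.integrable_shifted P₁ x hh τ).const_mul _)).integrableOn)
      (hf.integrable_tangent P₀ x τ).integrableOn
  have hh2 : 0 < 2 * h := by linarith
  have hh3 : 0 < 3 * h := by linarith
  have e : (3 * graphIntegral ν f P₀ P₁ x h τ - 3 * graphIntegral ν f P₀ P₁ x (2 * h) (τ / 2) +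
          graphIntegral ν f P₀ P₁ x (3 * h) (τ / 3)) -
        (3 * tangentIntegral ν f P₀ x τ - 3 * tangentIntegral ν f P₀ x (τ / 2) +
          tangentIntegral ν f P₀ x (τ / 3)) =
      ∫ w in H, (3 * G w h τ - 3 * G w (2 * h) (τ / 2) + G w (3 * h) (τ / 3)) := by
    have i₁ : IntegrableOn (fun w => 3 * G w h τ) H := (hGi h hh τ).const_mul 3
    have i₂ : IntegrableOn (fun w => 3 * G w (2 * h) (τ / 2)) H := (hGi _ hh2 _).const_mul 3
    have i₁₂ : IntegrableOn (fun w => 3 * G w h τ - 3 * G w (2 * h) (τ / 2)) H := i₁.sub i₂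
    rw [integral_add i₁₂ (hGi _ hh3 _), integral_sub i₁ i₂, integral_const_mul,
      integral_const_mul, hGe h hh, hGe _ hh2, hGe _ hh3]
    ring
  have hWi := integrable_decayWeight (V := V)
  set W : V → ℝ := decayWeight (Module.finrank ℝ V + 1)
  have j₁ : Integrable fun w => W (w + τ • ν) := hWi.comp_add_right _
  have j₂ : Integrable fun w => W (w + (τ / 2) • ν) := hWi.comp_add_right _
  have j₃ : Integrable fun w => W (w + (τ / 3) • ν) := hWi.comp_add_right _
  have k₁ : Integrable fun w => W w + W (w + τ • ν) := hWi.add j₁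
  have k₂ : Integrable fun w => W w + W (w + τ • ν) + W (w + (τ / 2) • ν) := k₁.add j₂
  have hB : Integrable fun w => C * (h ^ 3 + h * min |τ| 1) *
      (W w + W (w + τ • ν) + W (w + (τ / 2) • ν) + W (w + (τ / 3) • ν)) :=
    (k₂.add j₃).const_mul _
  have hm : 0 ≤ min |τ| 1 := by positivity
  rw [e, ← Real.norm_eq_abs]
  refine (norm_integral_le_of_norm_le hB.integrableOn (Filter.Eventually.of_forall fun w =>
    hP x w h τ (G w) hh hh1 fun _ _ => rfl)).trans ?_
  refine (setIntegral_le_integral hB (Filter.Eventually.of_forall fun w => ?_)).trans ?_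
  · have := decayWeight_pos (Module.finrank ℝ V + 1) w
    have := decayWeight_pos (Module.finrank ℝ V + 1) (w + τ • ν)
    have := decayWeight_pos (Module.finrank ℝ V + 1) (w + (τ / 2) • ν)
    have := decayWeight_pos (Module.finrank ℝ V + 1) (w + (τ / 3) • ν)
    simp only [Pi.zero_apply, W]
    positivity
  · rw [integral_const_mul, integral_add k₂ j₃, integral_add k₁ j₂, integral_add hWi j₁,
      integral_add_right_eq_self, integral_add_right_eq_self, integral_add_right_eq_self, ← hI]
    apply le_of_eq; ring

end Integrals

end FlatGraph

namespace FlatGraph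

/-! ### Half-spaces under a tangent plane -/

section Threshold

set_option linter.unusedSectionVars false

variable {V : Type*} [NormedAddCommGroup V] [InnerProductSpace ℝ V] [FiniteDimensional ℝ V]
  [MeasurableSpace V] [BorelSpace V]
variable {ν : V} {f : V → ℝ} {L : ℝ}

/-- The mass of the half-space under the tangent plane depends only on its signed distance from the
origin, which is the height `τ` divided by the length of the normal `ν - ∇f(x)`. -/
theorem exists_setIntegral_tangent_eq (hf : FlatGraph ν f L) (x : V) :
    ∃ c : ℝ, (1 + L)⁻¹ ≤ c ∧ c ≤ 1 ∧ ∀ τ : ℝ,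
      ∫ w in {w : V | inner ℝ ν w ≤ 0}, mainProfile (w + (fderiv ℝ f x w + τ) • ν) =
        1 - lineTail (c * τ) := by
  have : CompleteSpace V := FiniteDimensional.complete ℝ V
  have hL := hf.nonneg
  set g : V := (InnerProductSpace.toDual ℝ V).symm (fderiv ℝ f x)
  have hg : ∀ w, inner ℝ g w = fderiv ℝ f x w := fun w => InnerProductSpace.toDual_symm_apply
  have hgL : ‖g‖ ≤ L := by
    have h1 := (le_abs_self _).trans (hf.abs_fderiv_le x g)
    rw [← hg, real_inner_self_eq_norm_sq, sq] at h1
    rcases (norm_nonneg g).eq_or_lt with h | h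
    · rw [← h]; exact hL
    · exact le_of_mul_le_mul_right h1 h
  have hup : ‖ν - g‖ ≤ 1 + L := by
    refine (norm_sub_le _ _).trans ?_
    rw [hf.norm_eq_one]; linarith
  have hlow : 1 ≤ ‖ν - g‖ := by
    have h1 := real_inner_le_norm (ν - g) ν
    rw [inner_sub_left, hg, hf.fderiv_normal, real_inner_self_eq_norm_sq, hf.norm_eq_one] at h1
    linarith
  have hpos : 0 < ‖ν - g‖ := by linarith
  refine ⟨‖ν - g‖⁻¹, inv_anti₀ hpos hup, inv_le_one_of_one_le₀ hlow, fun τ => ?_⟩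
  have h1 := setIntegral_subgraph_eq hf.norm_eq_one
    (q := fun w => fderiv ℝ f x w + τ) (by fun_prop)
    (fun w s => by rw [hf.fderiv_add_normal]) (mainProfile (V := V))
  rw [← h1, ← integral_Iic_lineProfile, ← setIntegral_mainProfile_inner_le
    (n := ‖ν - g‖⁻¹ • (ν - g)) (by rw [norm_smul, norm_inv, norm_norm, inv_mul_cancel₀ hpos.ne'])]
  congr 2
  ext z
  simp only [Set.mem_ofPred_eq]
  rw [inner_smul_left, inner_sub_left, hg]
  simp only [conj_trivial]
  rw [mul_le_mul_iff_right₀ (inv_pos.2 hpos), sub_le_iff_le_add, add_comm]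

end Threshold

end FlatGraph

/-! ### The threshold function for a subgraph -/

section LocalThreshold

set_option linter.unusedSectionVars false

variable {V : Type*} [NormedAddCommGroup V] [InnerProductSpace ℝ V] [FiniteDimensional ℝ V]
  [MeasurableSpace V] [BorelSpace V]
variable {ν : V} {f : V → ℝ} {L : ℝ}

/-- The solution at time `h⁴` with initial datum the indicator of `A`, up to terms of order `h⁴`:
the profile is replaced by its first-order expansion in `lam * h²`. -/
noncomputable def approxSolution (lam : ℝ) (A : Set V) (x : V) (h : ℝ) : ℝ :=
  ∫ z, (mainProfile z + lam * h ^ 2 * correctionProfile z) *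
    A.indicator (fun _ => (1 : ℝ)) (x + h • z)

/-- The lower bound on both half-lines, `halfSpaceThreshold` being odd. -/
theorem abs_halfSpaceThreshold_ge {c : ℝ} (hc : ∀ s, 0 ≤ s → c * min s 1 ≤ halfSpaceThreshold s)
    (s : ℝ) : c * min |s| 1 ≤ |halfSpaceThreshold s| := by
  rcases le_total 0 s with h | h
  · rw [abs_of_nonneg h]
    exact (hc s h).trans (le_abs_self _)
  · rw [abs_of_nonpos h, ← abs_neg, ← halfSpaceThreshold_neg]
    exact (hc _ (by linarith)).trans (le_abs_self _)

theorem mul_combination_eq (c τ : ℝ) :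
    3 * (1 - lineTail (c * τ)) - 3 * (1 - lineTail (c * (τ / 2))) + (1 - lineTail (c * (τ / 3))) =
      1 / 2 + halfSpaceThreshold (c * τ) := by
  rw [halfSpaceThreshold, mul_div_assoc, mul_div_assoc]
  ring

/-- Blowing up a subgraph around `x` gives a subgraph at height `(f x - ⟪ν, x⟫) / h`. -/
theorem approxSolution_subgraph_eq (hf : FlatGraph ν f L) {P₀ P₁ : 𝓢(V, ℝ)} {lam : ℝ}
    (h₀ : ∀ z, P₀ z = mainProfile z) (h₁ : ∀ z, P₁ z = lam * correctionProfile z) (x : V) {h : ℝ}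
    (hh : 0 < h) :
    approxSolution lam {y | inner ℝ ν y ≤ f y} x h =
      FlatGraph.graphIntegral ν f P₀ P₁ x h ((f x - inner ℝ ν x) / h) := by
  have h1 := setIntegral_subgraph_eq hf.norm_eq_one
    (q := fun w => scaledGraph f x h w + (f x - inner ℝ ν x) / h)
    ((hf.differentiable_scaledGraph x h).add_const _)
    (fun w s => by rw [hf.scaledGraph_add_normal])
    (fun z => P₀ z + h ^ 2 * P₁ z)
  rw [FlatGraph.graphIntegral, ← h1, ← integral_indicator, approxSolution]
  · congr 1
    funext z
    have hiff : x + h • z ∈ {y | inner ℝ ν y ≤ f y} ↔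
        z ∈ {z : V | inner ℝ ν z ≤ scaledGraph f x h z + (f x - inner ℝ ν x) / h} := by
      simp only [Set.mem_ofPred_eq]
      rw [scaledGraph, ← add_div, le_div_iff₀ hh, inner_add_right, inner_smul_right]
      constructor <;> intro h <;> linarith
    by_cases hz : x + h • z ∈ {y | inner ℝ ν y ≤ f y}
    · rw [Set.indicator_of_mem hz, Set.indicator_of_mem (hiff.1 hz), h₀, h₁]
      ring
    · rw [Set.indicator_of_notMem hz, Set.indicator_of_notMem fun h => hz (hiff.2 h), mul_zero]
  · have := (hf.differentiable_scaledGraph x h).continuous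
    exact measurableSet_le (by fun_prop) (by fun_prop)

theorem exists_schwartz_re_profile (j : ℕ) : ∃ P : 𝓢(V, ℝ), ∀ z, P z = (profile j 0 z).re :=
  ⟨SchwartzMap.postcompCLM Complex.reCLM (profile j 0), fun z => by
    rw [SchwartzMap.postcompCLM_apply]; rfl⟩

/-- If the combination of the three solutions for the region below a graph is within `E` of `1/2`
at `x`, then the height of the graph over `x`, in units of `h`, is `O(h³ + E)`. -/
theorem FlatGraph.exists_height_le (hf : FlatGraph ν f L) (lam : ℝ) :
    ∃ C h₀ : ℝ, 0 ≤ C ∧ 0 < h₀ ∧ h₀ ≤ 1 ∧ ∀ (x : V) (h E : ℝ), 0 < h → h ≤ h₀ →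
      |3 * approxSolution lam {y | inner ℝ ν y ≤ f y} x h -
        3 * approxSolution lam {y | inner ℝ ν y ≤ f y} x (2 * h) +
        approxSolution lam {y | inner ℝ ν y ≤ f y} x (3 * h) - 1 / 2| ≤ E →
      min |(f x - inner ℝ ν x) / h| 1 ≤ C * (h ^ 3 + E) := by
  obtain ⟨P₀, hP₀⟩ := exists_schwartz_re_profile (V := V) 0
  obtain ⟨P, hP⟩ := exists_schwartz_re_profile (V := V) 1
  set P₁ : 𝓢(V, ℝ) := (-lam) • P with hP₁def
  have hP₁ : ∀ z, P₁ z = lam * correctionProfile z := by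
    intro z
    rw [hP₁def, smul_apply, hP, correctionProfile, smul_eq_mul]; ring
  obtain ⟨C, hC, hG⟩ := hf.exists_abs_graphIntegral_sub_le P₀ P₁
  obtain ⟨c₀, hc₀, hth⟩ := exists_le_halfSpaceThreshold
  have hL := hf.nonneg
  set κ := c₀ * (1 + L)⁻¹ with hκ
  have hκ0 : 0 < κ := by positivity
  refine ⟨2 * (C + 1) / κ, min 1 (κ / (2 * (C + 1))), by positivity, by positivity,
    min_le_left _ _, fun x h E hh hh0 hE => ?_⟩
  set τ := (f x - inner ℝ ν x) / h with hτ
  set m := min |τ| 1 with hm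
  have hm0 : 0 ≤ m := by positivity
  have hh1 : h ≤ 1 := hh0.trans (min_le_left _ _)
  have hhκ : h * (2 * (C + 1)) ≤ κ :=
    (le_div_iff₀ (by positivity)).1 (hh0.trans (min_le_right _ _))
  have h1 := hG x h τ hh hh1
  have e2 : τ / 2 = (f x - inner ℝ ν x) / (2 * h) := by rw [hτ]; field_simp
  have e3 : τ / 3 = (f x - inner ℝ ν x) / (3 * h) := by rw [hτ]; field_simp
  rw [e2, e3, hτ, ← approxSolution_subgraph_eq hf hP₀ hP₁ x hh,
    ← approxSolution_subgraph_eq hf hP₀ hP₁ x (by positivity),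
    ← approxSolution_subgraph_eq hf hP₀ hP₁ x (by positivity), ← e2, ← e3, ← hτ] at h1
  obtain ⟨c, hc1, hc2, hc⟩ := hf.exists_setIntegral_tangent_eq x
  have ht : ∀ τ, tangentIntegral ν f P₀ x τ = 1 - lineTail (c * τ) := by
    intro τ
    rw [← hc, tangentIntegral]
    congr 1
    funext w
    rw [hP₀]; rfl
  rw [ht, ht, ht, mul_combination_eq, ← hm] at h1
  have h2 := abs_halfSpaceThreshold_ge hth (c * τ)
  have hc0 : 0 < c := lt_of_lt_of_le (by positivity) hc1
  -- The scale `h₀` was chosen so that the error `C h m` is absorbed by half of `κ m`.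
  have h3 : κ * m ≤ c₀ * min |c * τ| 1 := by
    rw [hκ, mul_assoc]
    refine mul_le_mul_of_nonneg_left ?_ hc₀.le
    refine le_min ?_ ?_
    · rw [abs_mul, abs_of_pos hc0]
      exact mul_le_mul hc1 (min_le_left _ _) hm0 hc0.le
    · calc (1 + L)⁻¹ * m ≤ 1 * 1 :=
            mul_le_mul (hc1.trans hc2) (min_le_right _ _) hm0 zero_le_one
        _ = 1 := one_mul 1
  have h4 : |halfSpaceThreshold (c * τ)| ≤ E + C * (h ^ 3 + h * m) := by
    rw [abs_le] at h1 hE ⊢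
    constructor <;> linarith [h1.1, h1.2, hE.1, hE.2]
  have hE0 : 0 ≤ E := (abs_nonneg _).trans hE
  have h5 : h * (2 * (C + 1)) * m ≤ κ * m := mul_le_mul_of_nonneg_right hhκ hm0
  have h6 : κ * m ≤ 2 * (C + 1) * (h ^ 3 + E) := by
    have : 0 ≤ h ^ 3 := by positivity
    have : 0 ≤ C * E := by positivity
    have : 0 ≤ h * m := by positivity
    linarith
  rw [div_mul_eq_mul_div, le_div_iff₀ hκ0]
  linarith

end LocalThreshold

/-! ### Boundary charts with bounded derivatives -/

section Charts

set_option linter.unusedSectionVars false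

variable {V : Type*} [NormedAddCommGroup V] [InnerProductSpace ℝ V] [FiniteDimensional ℝ V]

/-- The orthogonal projection onto `ν^⊥`, for a unit vector `ν`. -/
noncomputable def projNormal (ν : V) : V →L[ℝ] V :=
  ContinuousLinearMap.id ℝ V - (innerSL ℝ ν).smulRight ν

theorem projNormal_apply (ν y : V) : projNormal ν y = y - (inner ℝ ν y : ℝ) • ν := by
  simp [projNormal]

theorem norm_projNormal_le {ν : V} (hν : ‖ν‖ = 1) (y : V) : ‖projNormal ν y‖ ≤ ‖y‖ := by
  rw [projNormal_apply]
  refine le_of_sq_le_sq ?_ (norm_nonneg _)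
  rw [norm_sub_sq_real, inner_smul_right, norm_smul, hν, mul_one, Real.norm_eq_abs, sq_abs,
    real_inner_comm]
  nlinarith [sq_nonneg (inner ℝ ν y : ℝ)]

theorem projNormal_add_normal {ν : V} (hν : ‖ν‖ = 1) (y : V) (s : ℝ) :
    projNormal ν (y + s • ν) = projNormal ν y := by
  rw [map_add, map_smul, projNormal_apply ν ν, real_inner_self_eq_norm_sq, hν]
  simp

/-- Cutting off the graph function outside a ball makes all derivatives up to order four bounded,
without changing the region near the centre. -/
theorem exists_flatGraph {ν : V} (hν : ‖ν‖ = 1) {f : V → ℝ} (hf : ContDiff ℝ 5 f) (x₀ : V) {r : ℝ}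
    (hr : 0 < r) : ∃ (g : V → ℝ) (L : ℝ), FlatGraph ν g L ∧
      ∀ y ∈ Metric.ball x₀ r, g y = f (y - (inner ℝ ν y : ℝ) • ν) := by
  let χ : ContDiffBump (projNormal ν x₀) := ⟨r, r + 1, hr, by linarith⟩
  set G : V → ℝ := fun y => χ y * f y with hG
  have hGc : ContDiff ℝ 4 G := χ.contDiff.mul (hf.of_le (by norm_num))
  have hGs : HasCompactSupport G := χ.hasCompactSupport.mul_right
  have hb : ∀ k : ℕ, k ≤ 4 → ∃ B : ℝ, 0 ≤ B ∧ ∀ y, ‖iteratedFDeriv ℝ k G y‖ ≤ B := by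
    intro k hk
    obtain ⟨B, hB⟩ := (hGs.iteratedFDeriv (𝕜 := ℝ) k).exists_bound_of_continuous
      (hGc.continuous_iteratedFDeriv (by exact_mod_cast hk))
    exact ⟨B, (norm_nonneg _).trans (hB 0), hB⟩
  choose! B hB0 hB using hb
  have h1 := hB0 1 (by norm_num)
  have h2 := hB0 2 (by norm_num)
  have h3 := hB0 3 (by norm_num)
  have h4 := hB0 4 (by norm_num)
  refine ⟨G ∘ projNormal ν, B 1 + B 2 + B 3 + B 4,
    ⟨hν, hGc.comp (projNormal ν).contDiff, fun y s => ?_, by positivity,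
      fun k hk1 hk4 x w => ?_⟩, fun y hy => ?_⟩
  · rw [Function.comp_apply, projNormal_add_normal hν]; rfl
  · rw [(projNormal ν).iteratedFDeriv_comp_right hGc x (by exact_mod_cast hk4),
      ContinuousMultilinearMap.compContinuousLinearMap_apply, ← Real.norm_eq_abs]
    refine (ContinuousMultilinearMap.le_opNorm _ _).trans ?_
    rw [Finset.prod_const, Finset.card_univ, Fintype.card_fin]
    refine mul_le_mul ((hB k hk4 _).trans ?_) ?_ (by positivity) (by positivity)
    · interval_cases k <;> linarith
    · gcongr
      exact norm_projNormal_le hν w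
  · have : χ (projNormal ν y) = 1 := by
      apply χ.one_of_mem_closedBall
      rw [Metric.mem_closedBall, dist_eq_norm, ← map_sub]
      refine (norm_projNormal_le hν _).trans ?_
      rw [← dist_eq_norm]
      exact (Metric.mem_ball.1 hy).le
    rw [Function.comp_apply, hG, ← projNormal_apply]
    simp only
    rw [this, one_mul]

end Charts

/-! ### Localization of the solution -/

section Localization

set_option linter.unusedSectionVars false

variable {V : Type*} [NormedAddCommGroup V] [InnerProductSpace ℝ V] [FiniteDimensional ℝ V]
  [MeasurableSpace V] [BorelSpace V]

theorem exists_abs_profile_le_decayWeight (lam : ℝ) (M : ℕ) : ∃ C : ℝ, 0 ≤ C ∧ ∀ h : ℝ, 0 < h →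
    h ≤ 1 → ∀ z : V, |mainProfile z + lam * h ^ 2 * correctionProfile z| ≤ C * decayWeight M z := by
  obtain ⟨P₀, hP₀⟩ := exists_schwartz_re_profile (V := V) 0
  obtain ⟨P, hP⟩ := exists_schwartz_re_profile (V := V) 1
  obtain ⟨C₀, hC₀, h0⟩ := P₀.exists_abs_le_decayWeight M
  obtain ⟨C₁, hC₁, h1⟩ := P.exists_abs_le_decayWeight M
  refine ⟨C₀ + |lam| * C₁, by positivity, fun h hh hh1 z => ?_⟩
  have hm := h0 z
  have hc := h1 z
  rw [hP₀] at hm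
  rw [hP] at hc
  refine (abs_add_le _ _).trans ?_
  rw [abs_mul, abs_mul, abs_of_pos (by positivity : 0 < h ^ 2), correctionProfile, abs_neg,
    mainProfile, add_mul]
  have hW := decayWeight_pos M z
  have hsq : h ^ 2 ≤ 1 := pow_le_one₀ hh.le hh1
  refine add_le_add hm ?_
  calc |lam| * h ^ 2 * |(profile 1 0 z).re| ≤ |lam| * 1 * (C₁ * decayWeight M z) := by gcongr
    _ = _ := by ring

theorem integrable_mul_indicator {F : V → ℝ} (hF : Integrable F) {A : Set V} (hA : MeasurableSet A)
    (x : V) (h : ℝ) : Integrable fun z => F z * A.indicator (fun _ => (1 : ℝ)) (x + h • z) := by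
  refine hF.norm.mono' (hF.1.mul ?_) (Filter.Eventually.of_forall fun z => ?_)
  · exact ((measurable_const.indicator hA).comp (by fun_prop)).aestronglyMeasurable
  · rw [norm_mul]
    refine mul_le_of_le_one_right (norm_nonneg _) ?_
    by_cases hz : x + h • z ∈ A <;> simp [hz]

theorem integrable_expansion (lam h : ℝ) :
    Integrable fun z : V => mainProfile z + lam * h ^ 2 * correctionProfile z :=
  integrable_mainProfile.add (integrable_correctionProfile.const_mul _)

/-- The value of the approximate solution at a point is determined, up to `O((h / ρ)³)`, by the
datum in the ball of radius `ρ` around the point. -/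
theorem exists_abs_approxSolution_sub_le (lam : ℝ) : ∃ C : ℝ, 0 ≤ C ∧ ∀ (A B : Set V),
    MeasurableSet A → MeasurableSet B → ∀ (x : V) (ρ h : ℝ), 0 < ρ → 0 < h → h ≤ 1 →
      (∀ y ∈ Metric.ball x ρ, y ∈ A ↔ y ∈ B) →
      |approxSolution lam A x h - approxSolution lam B x h| ≤ C * (h / ρ) ^ 3 := by
  obtain ⟨C, hC, hP⟩ := exists_abs_profile_le_decayWeight (V := V) lam (Module.finrank ℝ V + 1 + 3)
  have hWi := integrable_decayWeight (V := V)
  set M := Module.finrank ℝ V + 1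
  have hI0 : 0 ≤ ∫ w : V, decayWeight M w := integral_nonneg fun w => (decayWeight_pos _ w).le
  refine ⟨C * ∫ w : V, decayWeight M w, by positivity, fun A B hA hB x ρ h hρ hh hh1 hAB => ?_⟩
  rw [approxSolution, approxSolution, ← integral_sub
    (integrable_mul_indicator (integrable_expansion lam h) hA x h)
    (integrable_mul_indicator (integrable_expansion lam h) hB x h), mul_right_comm, mul_comm C,
    mul_assoc, ← integral_const_mul, ← integral_const_mul]
  rw [← Real.norm_eq_abs]
  refine norm_integral_le_of_norm_le ((hWi.const_mul C).const_mul _)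
    (Filter.Eventually.of_forall fun z => ?_)
  have hW := decayWeight_pos M z
  rw [Real.norm_eq_abs, ← mul_sub, abs_mul]
  by_cases hz : x + h • z ∈ Metric.ball x ρ
  · have : A.indicator (fun _ => (1 : ℝ)) (x + h • z) = B.indicator (fun _ => (1 : ℝ)) (x + h • z) := by
      by_cases hzA : x + h • z ∈ A
      · rw [Set.indicator_of_mem hzA, Set.indicator_of_mem ((hAB _ hz).1 hzA)]
      · rw [Set.indicator_of_notMem hzA, Set.indicator_of_notMem fun h => hzA ((hAB _ hz).2 h)]
    rw [this, sub_self, abs_zero, mul_zero]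
    positivity
  · have h1 : ρ / h ≤ 1 + ‖z‖ := by
      rw [Metric.mem_ball, dist_eq_norm, add_sub_cancel_left, norm_smul, Real.norm_of_nonneg hh.le,
        not_lt] at hz
      rw [div_le_iff₀ hh]
      nlinarith
    have h2 : decayWeight (M + 3) z ≤ (h / ρ) ^ 3 * decayWeight M z := by
      rw [← pow_mul_decayWeight M 3 z, ← mul_assoc]
      refine le_mul_of_one_le_left (decayWeight_pos _ _).le ?_
      rw [← mul_pow]
      refine one_le_pow₀ ?_
      calc (1 : ℝ) = h / ρ * (ρ / h) := by field_simp
        _ ≤ _ := by gcongr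
    have h3 : |A.indicator (fun _ => (1 : ℝ)) (x + h • z) -
        B.indicator (fun _ => (1 : ℝ)) (x + h • z)| ≤ 1 := by
      by_cases hzA : x + h • z ∈ A <;> by_cases hzB : x + h • z ∈ B <;> simp [hzA, hzB]
    calc _ ≤ C * decayWeight (M + 3) z * 1 :=
          mul_le_mul (hP h hh hh1 z) h3 (abs_nonneg _)
            (mul_nonneg hC (decayWeight_pos _ _).le)
      _ ≤ C * ((h / ρ) ^ 3 * decayWeight M z) * 1 := by gcongr
      _ = _ := by ring

theorem exists_abs_approxSolution_univ_sub_le (lam : ℝ) : ∃ C : ℝ, 0 ≤ C ∧ ∀ (x : V) (h : ℝ),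
    |approxSolution lam Set.univ x h - 1| ≤ C * h ^ 2 := by
  refine ⟨|lam * ∫ z : V, correctionProfile z|, abs_nonneg _, fun x h => ?_⟩
  simp only [approxSolution, Set.indicator_univ, mul_one]
  rw [integral_add integrable_mainProfile (integrable_correctionProfile.const_mul _),
    integral_mainProfile, integral_const_mul, add_sub_cancel_left, mul_right_comm, abs_mul,
    abs_of_nonneg (sq_nonneg h)]

theorem approxSolution_empty (lam : ℝ) (x : V) (h : ℝ) : approxSolution lam ∅ x h = 0 := by
  simp [approxSolution]

end Localization

/-! ### Expansion of the solution in the parameter -/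

section Cauchy

variable {N : ℕ}

theorem exists_abs_cauchySolution_sub_le (lam : ℝ) : ∃ C : ℝ, 0 ≤ C ∧
    ∀ Ω : Set (EuclideanSpace ℝ (Fin N)), MeasurableSet Ω → ∀ (x : EuclideanSpace ℝ (Fin N)) (h : ℝ),
      0 < h → |lam| * h ^ 2 ≤ 1 →
      |cauchySolution lam Ω x (h ^ 4) - approxSolution lam Ω x h| ≤ C * h ^ 4 := by
  have hWi := integrable_decayWeight (V := EuclideanSpace ℝ (Fin N))
  set M := Module.finrank ℝ (EuclideanSpace ℝ (Fin N)) + 1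
  obtain ⟨C, hC, hP⟩ := profile_expansion (V := EuclideanSpace ℝ (Fin N)) M
  set I := ∫ w : EuclideanSpace ℝ (Fin N), decayWeight M w with hI
  have hI0 : 0 ≤ I := integral_nonneg fun w => (decayWeight_pos _ w).le
  refine ⟨C * lam ^ 2 * I, by positivity, fun Ω hΩ x h hh hlam => ?_⟩
  have i₁ : Integrable fun z : EuclideanSpace ℝ (Fin N) =>
      (profile 0 (lam * h ^ 2) z).re * Ω.indicator (fun _ => (1 : ℝ)) (x + h • z) :=
    integrable_mul_indicator
      ((profile (V := EuclideanSpace ℝ (Fin N)) 0 (lam * h ^ 2)).integrable (μ := volume)).re hΩ x h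
  rw [cauchySolution_eq_integral_profile lam Ω x hh, approxSolution, ← integral_sub i₁
    (integrable_mul_indicator (integrable_expansion lam h) hΩ x h)]
  have e : C * lam ^ 2 * I * h ^ 4 =
      ∫ z : EuclideanSpace ℝ (Fin N), C * (lam * h ^ 2) ^ 2 * decayWeight M z := by
    rw [integral_const_mul, ← hI]; ring
  rw [e]
  rw [← Real.norm_eq_abs]
  refine norm_integral_le_of_norm_le (hWi.const_mul _) (Filter.Eventually.of_forall fun z => ?_)
  have h1 := hP (lam * h ^ 2) (by rwa [abs_mul, abs_of_nonneg (sq_nonneg h)]) z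
  rw [Real.norm_eq_abs, ← sub_mul, abs_mul]
  have h2 : |Ω.indicator (fun _ => (1 : ℝ)) (x + h • z)| ≤ 1 := by
    by_cases hz : x + h • z ∈ Ω <;> simp [hz]
  refine (mul_le_of_le_one_right (abs_nonneg _) h2).trans ?_
  rw [decayWeight, ← div_eq_mul_inv, le_div_iff₀ (by positivity), mul_comm]
  refine le_trans (le_of_eq ?_) h1
  rw [mainProfile, correctionProfile]
  congr 2
  ring

end Cauchy

/-! ### The boundary inside a chart -/

section BoundaryChart

variable {V : Type*} [NormedAddCommGroup V] [InnerProductSpace ℝ V]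

/-- A point on the graph, inside the chart, is a boundary point. -/
theorem mem_frontier_of_graph {ν : V} {f : V → ℝ} {L : ℝ} (hf : FlatGraph ν f L) {Ω : Set V}
    {x₀ : V} {r : ℝ} (hΩ : ∀ y ∈ Metric.ball x₀ r, (y ∈ Ω ↔ inner ℝ ν y ≤ f y)) {p : V}
    (hp : p ∈ Metric.ball x₀ r) (hgraph : inner ℝ ν p = f p) : p ∈ frontier Ω := by
  have hpΩ : p ∈ Ω := (hΩ p hp).2 hgraph.le
  refine ⟨subset_closure hpΩ, fun hint => ?_⟩
  have hc : Filter.Tendsto (fun s : ℝ => p + s • ν) (nhdsWithin 0 (Set.Ioi 0)) (nhds p) := by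
    have : Continuous fun s : ℝ => p + s • ν := by fun_prop
    have := this.tendsto 0
    rw [zero_smul, add_zero] at this
    exact this.mono_left nhdsWithin_le_nhds
  have h1 := hc.eventually (mem_interior_iff_mem_nhds.1 hint)
  have h2 := hc.eventually (Metric.isOpen_ball.mem_nhds hp)
  obtain ⟨s, ⟨hs1, hs2⟩, hs0⟩ := ((h1.and h2).and self_mem_nhdsWithin).exists
  have h3 := (hΩ _ hs2).1 hs1
  rw [hf.invariant, inner_add_right, inner_smul_right, real_inner_self_eq_norm_sq,
    hf.norm_eq_one, hgraph] at h3
  have : 0 < s := hs0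
  linarith

/-- Moving along `ν` to the graph bounds the distance to the boundary by the height. -/
theorem infDist_frontier_le_of_graph {ν : V} {f : V → ℝ} {L : ℝ} (hf : FlatGraph ν f L)
    {Ω : Set V} {x₀ : V} {r : ℝ} (hΩ : ∀ y ∈ Metric.ball x₀ r, (y ∈ Ω ↔ inner ℝ ν y ≤ f y)) {x : V}
    (hx : dist x x₀ + |f x - inner ℝ ν x| < r) :
    Metric.infDist x (frontier Ω) ≤ |f x - inner ℝ ν x| := by
  set σ := f x - inner ℝ ν x with hσ
  have hd : dist x (x + σ • ν) = |σ| := by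
    rw [dist_eq_norm, sub_add_cancel_left, norm_neg, norm_smul, hf.norm_eq_one, mul_one,
      Real.norm_eq_abs]
  rw [← hd]
  refine Metric.infDist_le_dist_of_mem (mem_frontier_of_graph hf hΩ ?_ ?_)
  · have := dist_triangle (x + σ • ν) x x₀
    rw [dist_comm (x + σ • ν) x, hd] at this
    rw [Metric.mem_ball]; linarith
  · rw [hf.invariant, inner_add_right, inner_smul_right, real_inner_self_eq_norm_sq,
      hf.norm_eq_one, hσ]
    ring

/-- A ball is connected, so it cannot leave `Ω` without meeting the frontier. -/
theorem ball_subset_or_subset_compl {Ω : Set V} {x : V} {ε : ℝ}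
    (h : Disjoint (Metric.ball x ε) (frontier Ω)) :
    Metric.ball x ε ⊆ Ω ∨ Metric.ball x ε ⊆ Ωᶜ := by
  have hpre : IsPreconnected (Metric.ball x ε) := (convex_ball x ε).isPreconnected
  refine (IsPreconnected.subset_or_subset isOpen_interior isOpen_interior ?_ ?_ hpre).imp
    (fun h => h.trans (interior_subset (s := Ω))) (fun h => h.trans (interior_subset (s := Ωᶜ)))
  · exact disjoint_compl_right.mono interior_subset interior_subset
  · intro y hy
    by_contra hy'
    rw [Set.mem_union, not_or, interior_compl, Set.mem_compl_iff, not_not] at hy'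
    exact Set.disjoint_left.1 h hy ⟨hy'.2, hy'.1⟩

end BoundaryChart

/-! ### Patching over the boundary -/

section Global

variable {N : ℕ}

/-- The threshold function in terms of the length scale `h`: its value at time `(h / a)⁴`. -/
noncomputable def scaleCombination (lam : ℝ) (Ω : Set (EuclideanSpace ℝ (Fin N)))
    (x : EuclideanSpace ℝ (Fin N)) (h : ℝ) : ℝ :=
  3 * cauchySolution lam Ω x (h ^ 4) - 3 * cauchySolution lam Ω x ((2 * h) ^ 4) +
    cauchySolution lam Ω x ((3 * h) ^ 4)

/-- At any point whose `ρ`-ball sees the datum `Ω` as `A`, the combination for `Ω` is the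
approximate combination for `A` up to `O(h³)`. -/
theorem exists_abs_scaleCombination_sub_le (lam : ℝ) {ρ : ℝ} (hρ : 0 < ρ) :
    ∃ C h₀ : ℝ, 0 ≤ C ∧ 0 < h₀ ∧ ∀ Ω A : Set (EuclideanSpace ℝ (Fin N)), MeasurableSet Ω →
      MeasurableSet A → ∀ (x : EuclideanSpace ℝ (Fin N)) (h : ℝ), 0 < h → h ≤ h₀ →
        (∀ y ∈ Metric.ball x ρ, y ∈ Ω ↔ y ∈ A) →
        |scaleCombination lam Ω x h - (3 * approxSolution lam A x h -
          3 * approxSolution lam A x (2 * h) + approxSolution lam A x (3 * h))| ≤ C * h ^ 3 := by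
  obtain ⟨C₁, hC₁, h1⟩ := exists_abs_cauchySolution_sub_le (N := N) lam
  obtain ⟨C₂, hC₂, h2⟩ := exists_abs_approxSolution_sub_le (V := EuclideanSpace ℝ (Fin N)) lam
  set K := C₁ + C₂ / ρ ^ 3 with hK
  have hK0 : 0 ≤ K := by positivity
  refine ⟨54 * K, min (1 / 3) (1 / (3 * (1 + |lam|))), by positivity, by positivity,
    fun Ω A hΩ hA x h hh hh0 hΩA => ?_⟩
  have hh1 : 3 * h ≤ 1 := by linarith [hh0.trans (min_le_left _ _)]
  have hh2 : h * (3 * (1 + |lam|)) ≤ 1 :=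
    (le_div_iff₀ (by positivity)).1 (hh0.trans (min_le_right _ _))
  have key : ∀ k : ℝ, 0 < k → k ≤ 3 * h →
      |cauchySolution lam Ω x (k ^ 4) - approxSolution lam A x k| ≤ K * k ^ 3 := by
    intro k hk hk3
    have hk1 : k ≤ 1 := hk3.trans hh1
    have hlam : |lam| * k ^ 2 ≤ 1 := by
      have a1 : |lam| * k ≤ 1 := by
        have : |lam| * k ≤ |lam| * (3 * h) := by gcongr
        linarith
      calc |lam| * k ^ 2 = |lam| * k * k := by ring
        _ ≤ 1 * 1 := by gcongr
        _ = 1 := one_mul 1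
    have b1 := h1 Ω hΩ x k hk hlam
    have b2 := h2 Ω A hΩ hA x ρ k hρ hk hk1 hΩA
    have b3 : C₁ * k ^ 4 ≤ C₁ * k ^ 3 :=
      mul_le_mul_of_nonneg_left (pow_le_pow_of_le_one hk.le hk1 (by norm_num)) hC₁
    have b4 : C₂ * (k / ρ) ^ 3 = C₂ / ρ ^ 3 * k ^ 3 := by rw [div_pow]; ring
    have b5 : K * k ^ 3 = C₁ * k ^ 3 + C₂ / ρ ^ 3 * k ^ 3 := by rw [hK]; ring
    have b6 := abs_add_le (cauchySolution lam Ω x (k ^ 4) - approxSolution lam Ω x k)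
      (approxSolution lam Ω x k - approxSolution lam A x k)
    rw [sub_add_sub_cancel] at b6
    linarith
  have k1 := key h hh (by linarith)
  have k2 := key (2 * h) (by linarith) (by linarith)
  have k3 := key (3 * h) (by linarith) le_rfl
  have e2 : K * (2 * h) ^ 3 = 8 * (K * h ^ 3) := by ring
  have e3 : K * (3 * h) ^ 3 = 27 * (K * h ^ 3) := by ring
  rw [e2] at k2
  rw [e3] at k3
  rw [scaleCombination, mul_assoc]
  rw [abs_le] at k1 k2 k3 ⊢
  constructor <;> linarith [k1.1, k1.2, k2.1, k2.2, k3.1, k3.2]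

/-- Near a boundary point, the points where the threshold function equals `1/2` lie within `O(h⁴)`
of the boundary. -/
theorem exists_infDist_le_near {Ω : Set (EuclideanSpace ℝ (Fin N))} (hΩ : MeasurableSet Ω)
    (hb : HasCkBoundary 5 Ω) (lam : ℝ) {x₀ : EuclideanSpace ℝ (Fin N)} (hx₀ : x₀ ∈ frontier Ω) :
    ∃ r C h₀ : ℝ, 0 < r ∧ 0 ≤ C ∧ 0 < h₀ ∧ ∀ x ∈ Metric.ball x₀ r, ∀ h : ℝ, 0 < h → h ≤ h₀ →
      scaleCombination lam Ω x h = 1 / 2 → Metric.infDist x (frontier Ω) ≤ C * h ^ 4 := by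
  obtain ⟨ν, hν, f, hf, r, hr, hΩf⟩ := hb x₀ hx₀
  obtain ⟨g, L, hg, hgf⟩ := exists_flatGraph hν (by exact_mod_cast hf) x₀ hr
  have hΩg : ∀ y ∈ Metric.ball x₀ r, (y ∈ Ω ↔ inner ℝ ν y ≤ g y) := by
    intro y hy
    rw [hΩf y hy, hgf y hy]
  have hr2 : 0 < r / 2 := by linarith
  obtain ⟨C₁, h₁, hC₁, hh₁, H1⟩ := exists_abs_scaleCombination_sub_le (N := N) lam hr2
  obtain ⟨C₂, h₂, hC₂, hh₂, hh₂1, H2⟩ := hg.exists_height_le lam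
  set K := C₂ * (1 + C₁) with hK
  have hK0 : 0 ≤ K := by positivity
  have hAm : MeasurableSet {y : EuclideanSpace ℝ (Fin N) | inner ℝ ν y ≤ g y} := by
    have := hg.differentiable.continuous
    exact measurableSet_le (by fun_prop) (by fun_prop)
  refine ⟨r / 2, K, min (min h₁ h₂) (min (1 / (K + 1)) (r / 2 / (K + 1))), hr2, hK0, by positivity,
    fun x hx h hh hh0 hU => ?_⟩
  have hm1 : h ≤ h₁ := hh0.trans ((min_le_left _ _).trans (min_le_left _ _))
  have hm2 : h ≤ h₂ := hh0.trans ((min_le_left _ _).trans (min_le_right _ _))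
  have hm3 : h * (K + 1) ≤ 1 := (le_div_iff₀ (by positivity)).1
    (hh0.trans ((min_le_right _ _).trans (min_le_left _ _)))
  have hm4 : h * (K + 1) ≤ r / 2 := (le_div_iff₀ (by positivity)).1
    (hh0.trans ((min_le_right _ _).trans (min_le_right _ _)))
  have hh1 : h ≤ 1 := hm2.trans hh₂1
  rw [Metric.mem_ball] at hx
  have hloc : ∀ y ∈ Metric.ball x (r / 2), y ∈ Ω ↔ y ∈ {y | inner ℝ ν y ≤ g y} := by
    intro y hy
    refine hΩg y ?_
    have := dist_triangle y x x₀
    rw [Metric.mem_ball] at hy ⊢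
    linarith
  have a1 := H1 Ω _ hΩ hAm x h hh hm1 hloc
  rw [hU, abs_sub_comm] at a1
  have a2 := H2 x h (C₁ * h ^ 3) hh hm2 a1
  have a3 : min |(g x - inner ℝ ν x) / h| 1 ≤ K * h ^ 3 := by
    rw [hK]; refine a2.trans (le_of_eq (by ring))
  have hh3 : h ^ 3 ≤ h := by
    calc h ^ 3 ≤ h ^ 1 := pow_le_pow_of_le_one hh.le hh1 (by norm_num)
      _ = h := pow_one h
  have hh4 : h ^ 4 ≤ h := by
    calc h ^ 4 ≤ h ^ 1 := pow_le_pow_of_le_one hh.le hh1 (by norm_num)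
      _ = h := pow_one h
  have a4 : K * h ^ 3 < 1 := by
    have : K * h ^ 3 ≤ K * h := by gcongr
    linarith
  have a5 : |(g x - inner ℝ ν x) / h| ≤ K * h ^ 3 := by
    rcases min_le_iff.1 a3 with h | h
    · exact h
    · linarith
  rw [abs_div, abs_of_pos hh, div_le_iff₀ hh] at a5
  have a6 : |g x - inner ℝ ν x| ≤ K * h ^ 4 := by
    refine a5.trans (le_of_eq (by ring))
  refine (infDist_frontier_le_of_graph hg hΩg ?_).trans a6
  have : K * h ^ 4 ≤ K * h := by gcongr
  linarith

/-- The local estimates near boundary points patch together by compactness of the boundary. -/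
theorem exists_infDist_le_nhds {Ω : Set (EuclideanSpace ℝ (Fin N))} (hΩ : IsCompact Ω)
    (hb : HasCkBoundary 5 Ω) (lam : ℝ) :
    ∃ U : Set (EuclideanSpace ℝ (Fin N)), IsOpen U ∧ frontier Ω ⊆ U ∧
    ∃ C h₀ : ℝ, 0 ≤ C ∧ 0 < h₀ ∧ ∀ x ∈ U, ∀ h : ℝ, 0 < h → h ≤ h₀ →
      scaleCombination lam Ω x h = 1 / 2 → Metric.infDist x (frontier Ω) ≤ C * h ^ 4 := by
  have hF : IsCompact (frontier Ω) :=
    hΩ.of_isClosed_subset isClosed_frontier hΩ.isClosed.frontier_subset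
  refine hF.induction_on (p := fun s => ∃ U : Set (EuclideanSpace ℝ (Fin N)), IsOpen U ∧ s ⊆ U ∧
    ∃ C h₀ : ℝ, 0 ≤ C ∧ 0 < h₀ ∧ ∀ x ∈ U, ∀ h : ℝ, 0 < h → h ≤ h₀ →
      scaleCombination lam Ω x h = 1 / 2 → Metric.infDist x (frontier Ω) ≤ C * h ^ 4) ?_ ?_ ?_ ?_
  · exact ⟨∅, isOpen_empty, subset_rfl, 0, 1, le_rfl, one_pos, fun x hx => hx.elim⟩
  · rintro s t hst ⟨U, hU, htU, H⟩
    exact ⟨U, hU, hst.trans htU, H⟩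
  · rintro s t ⟨U, hU, hsU, C, h₀, hC, hh₀, H⟩ ⟨U', hU', hsU', C', h₀', hC', hh₀', H'⟩
    refine ⟨U ∪ U', hU.union hU', Set.union_subset_union hsU hsU', C + C', min h₀ h₀', by positivity,
      by positivity, fun x hx h hh hh0 hx2 => ?_⟩
    have hp : 0 ≤ h ^ 4 := by positivity
    rcases hx with hx | hx
    · have := H x hx h hh (hh0.trans (min_le_left _ _)) hx2
      have := mul_nonneg hC' hp
      linarith
    · have := H' x hx h hh (hh0.trans (min_le_right _ _)) hx2
      have := mul_nonneg hC hp
      linarith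
  · intro x hx
    obtain ⟨r, C, h₀, hr, hC, hh₀, H⟩ := exists_infDist_le_near hΩ.measurableSet hb lam hx
    exact ⟨Metric.ball x r, mem_nhdsWithin_of_mem_nhds (Metric.ball_mem_nhds x hr),
      Metric.ball x r, Metric.isOpen_ball, subset_rfl, C, h₀, hC, hh₀, H⟩

/-- Away from the boundary the threshold function is close to `0` or `1`, hence not `1/2`. -/
theorem exists_scaleCombination_ne {Ω : Set (EuclideanSpace ℝ (Fin N))} (hΩ : MeasurableSet Ω)
    (lam : ℝ) {ε : ℝ} (hε : 0 < ε) :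
    ∃ h₀ : ℝ, 0 < h₀ ∧ ∀ (x : EuclideanSpace ℝ (Fin N)) (h : ℝ), 0 < h → h ≤ h₀ →
      Disjoint (Metric.ball x ε) (frontier Ω) → scaleCombination lam Ω x h ≠ 1 / 2 := by
  obtain ⟨C₁, h₁, hC₁, hh₁, H1⟩ := exists_abs_scaleCombination_sub_le (N := N) lam hε
  obtain ⟨C₂, hC₂, H2⟩ := exists_abs_approxSolution_univ_sub_le (V := EuclideanSpace ℝ (Fin N)) lam
  set K := C₁ + 24 * C₂ with hK
  have hK0 : 0 ≤ K := by positivity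
  refine ⟨min h₁ (min 1 (1 / (4 * (K + 1)))), by positivity, fun x h hh hh0 hd hU => ?_⟩
  have hm1 : h ≤ h₁ := hh0.trans (min_le_left _ _)
  have hm2 : h ≤ 1 := hh0.trans ((min_le_right _ _).trans (min_le_left _ _))
  have hm3 : h * (4 * (K + 1)) ≤ 1 := (le_div_iff₀ (by positivity)).1
    (hh0.trans ((min_le_right _ _).trans (min_le_right _ _)))
  have hh3 : h ^ 3 ≤ h := by
    calc h ^ 3 ≤ h ^ 1 := pow_le_pow_of_le_one hh.le hm2 (by norm_num)
      _ = h := pow_one h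
  have hh2 : h ^ 2 ≤ h := by
    calc h ^ 2 ≤ h ^ 1 := pow_le_pow_of_le_one hh.le hm2 (by norm_num)
      _ = h := pow_one h
  have c1 : C₁ * h ^ 3 ≤ C₁ * h := by gcongr
  have c2 : C₂ * h ^ 2 ≤ C₂ * h := by gcongr
  have c3 : C₁ * h + 24 * (C₂ * h) < 1 / 2 := by
    have : C₁ * h + 24 * (C₂ * h) = K * h := by rw [hK]; ring
    linarith
  have c4 : 0 ≤ C₂ * h := by positivity
  rcases ball_subset_or_subset_compl hd with hs | hs
  · have a1 := H1 Ω Set.univ hΩ MeasurableSet.univ x h hh hm1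
      fun y hy => ⟨fun _ => trivial, fun _ => hs hy⟩
    have b1 := H2 x h
    have b2 := H2 x (2 * h)
    have b3 := H2 x (3 * h)
    rw [mul_pow, mul_left_comm] at b2 b3
    rw [hU] at a1
    rw [abs_le] at a1 b1 b2 b3
    linarith [a1.1, a1.2, b1.1, b1.2, b2.1, b2.2, b3.1, b3.2]
  · have a1 := H1 Ω ∅ hΩ MeasurableSet.empty x h hh hm1
      fun y hy => ⟨fun h => (hs hy h).elim, fun h => h.elim⟩
    rw [hU, approxSolution_empty, approxSolution_empty, approxSolution_empty] at a1
    norm_num at a1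
    linarith

theorem exists_infDist_le {Ω : Set (EuclideanSpace ℝ (Fin N))} (hΩ : IsCompact Ω)
    (hb : HasCkBoundary 5 Ω) (lam : ℝ) :
    ∃ C h₀ : ℝ, 0 ≤ C ∧ 0 < h₀ ∧ ∀ (x : EuclideanSpace ℝ (Fin N)) (h : ℝ), 0 < h → h ≤ h₀ →
      scaleCombination lam Ω x h = 1 / 2 → Metric.infDist x (frontier Ω) ≤ C * h ^ 4 := by
  obtain ⟨U, hU, hFU, C, h₀, hC, hh₀, H⟩ := exists_infDist_le_nhds hΩ hb lam
  have hF : IsCompact (frontier Ω) :=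
    hΩ.of_isClosed_subset isClosed_frontier hΩ.isClosed.frontier_subset
  obtain ⟨ε, hε, hεU⟩ := hF.exists_thickening_subset_open hU hFU
  obtain ⟨h₁, hh₁, H1⟩ := exists_scaleCombination_ne hΩ.measurableSet lam hε
  refine ⟨C, min h₀ h₁, hC, by positivity, fun x h hh hh0 hx => ?_⟩
  by_cases hxU : x ∈ Metric.thickening ε (frontier Ω)
  · exact H x (hεU hxU) h hh (hh0.trans (min_le_left _ _)) hx
  · refine absurd hx (H1 x h hh (hh0.trans (min_le_right _ _)) ?_)
    rw [Set.disjoint_left]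
    intro y hy hyF
    exact hxU (Metric.mem_thickening_iff.2 ⟨y, hyF, by rwa [dist_comm]⟩)

theorem continuous_cauchySolution {Ω : Set (EuclideanSpace ℝ (Fin N))} (hΩ : IsCompact Ω)
    (lam : ℝ) {h : ℝ} (hh : 0 < h) : Continuous fun x => cauchySolution lam Ω x (h ^ 4) := by
  obtain ⟨C, hC, hP⟩ := profile_decay (V := EuclideanSpace ℝ (Fin N)) 0 |lam * h ^ 2| 0
  have hc : Continuous fun x : EuclideanSpace ℝ (Fin N) => fundamentalSolution lam x (h ^ 4) := by
    simp_rw [fundamentalSolution_eq_profile lam _ hh]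
    exact continuous_const.mul (Complex.continuous_re.comp
      ((profile (V := EuclideanSpace ℝ (Fin N)) 0 (lam * h ^ 2)).continuous.comp (by fun_prop)))
  have hb : ∀ x : EuclideanSpace ℝ (Fin N),
      |fundamentalSolution lam x (h ^ 4)| ≤ (h ^ N)⁻¹ * C := by
    intro x
    rw [fundamentalSolution_eq_profile lam _ hh, abs_mul, abs_of_pos (by positivity)]
    gcongr
    refine (Complex.abs_re_le_norm _).trans ?_
    simpa using hP (lam * h ^ 2) le_rfl (h⁻¹ • x)
  have hm : Measurable (Ω.indicator fun _ => (1 : ℝ)) := measurable_const.indicator hΩ.measurableSet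
  have hi : Integrable (Ω.indicator fun _ => (1 : ℝ)) :=
    (integrable_indicator_iff hΩ.measurableSet).2 (integrableOn_const hΩ.measure_lt_top.ne)
  refine continuous_of_dominated (bound := fun y => (h ^ N)⁻¹ * C * Ω.indicator (fun _ => (1 : ℝ)) y)
    (fun x => ?_) (fun x => Filter.Eventually.of_forall fun y => ?_) (hi.const_mul _)
    (Filter.Eventually.of_forall fun y => ?_)
  · exact (hc.comp (by fun_prop)).aestronglyMeasurable.mul hm.aestronglyMeasurable
  · rw [norm_mul, Real.norm_eq_abs, Real.norm_eq_abs,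
      abs_of_nonneg (Set.indicator_nonneg (fun _ _ => zero_le_one) y)]
    exact mul_le_mul_of_nonneg_right (hb _) (Set.indicator_nonneg (fun _ _ => zero_le_one) y)
  · exact (hc.comp (by fun_prop)).mul continuous_const

theorem thresholdFunction_eq_scaleCombination (lam : ℝ) (Ω : Set (EuclideanSpace ℝ (Fin N)))
    (a s : ℝ) (x : EuclideanSpace ℝ (Fin N)) :
    thresholdFunction lam Ω a x (s ^ 4) = scaleCombination lam Ω x (a * s) := by
  rw [thresholdFunction, rescaledSolution, rescaledSolution, rescaledSolution, scaleCombination,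
    ← mul_pow, ← mul_pow, ← mul_pow, mul_assoc, mul_assoc]
  ring

theorem abs_signedDistBoundary (Ω : Set (EuclideanSpace ℝ (Fin N)))
    (x : EuclideanSpace ℝ (Fin N)) :
    |signedDistBoundary Ω x| = Metric.infDist x (frontier Ω) := by
  rw [signedDistBoundary]
  split_ifs
  · exact abs_of_nonneg Metric.infDist_nonneg
  · rw [abs_neg, abs_of_nonneg Metric.infDist_nonneg]

end Global

/-! ### The distance of the interface to the boundary -/

theorem theorem4p5 (N : ℕ) (hN : 2 ≤ N) (lam : ℝ)
    (Ω₀ : Set (EuclideanSpace ℝ (Fin N))) (hcompact : IsCompact Ω₀)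
    (hboundary : HasCkBoundary 5 Ω₀)
    (a : ℝ) (ha : 0 < a) (ha4 : 18 * a ^ 4 / 11 = 1) :
    ∃ C₀ : ℝ, 0 < C₀ ∧ ∃ t₀ : ℝ, 0 < t₀ ∧ ∀ t : ℝ, 0 < t → t < t₀ →
      ∀ x ∈ frontier (thresholdSet lam Ω₀ a t), |signedDistBoundary Ω₀ x| ≤ C₀ * t := by
  obtain ⟨C, h₀, hC, hh₀, H⟩ := exists_infDist_le hcompact hboundary lam
  refine ⟨C * a ^ 4 + 1, by positivity, (h₀ / a) ^ 4, by positivity, fun t ht ht0 x hx => ?_⟩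
  -- The length scale is `h = a s` with `s = t ^ (1 / 4)`.
  obtain ⟨s, hs, rfl⟩ : ∃ s : ℝ, 0 < s ∧ s ^ 4 = t := by
    refine ⟨√(√t), by positivity, ?_⟩
    rw [show 4 = 2 * 2 by norm_num, pow_mul, Real.sq_sqrt (Real.sqrt_nonneg t), Real.sq_sqrt ht.le]
  have hs0 : s < h₀ / a := lt_of_pow_lt_pow_left₀ 4 (by positivity) ht0
  have has : a * s ≤ h₀ := by
    rw [lt_div_iff₀ ha] at hs0; linarith
  have hcont : Continuous fun x => thresholdFunction lam Ω₀ a x (s ^ 4) := by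
    have hpos : 0 < a * s := by positivity
    simp_rw [thresholdFunction_eq_scaleCombination, scaleCombination]
    exact ((continuous_const.mul (continuous_cauchySolution hcompact lam hpos)).sub
      (continuous_const.mul (continuous_cauchySolution hcompact lam (by positivity)))).add
      (continuous_cauchySolution hcompact lam (by positivity))
  have hhalf : 1 / 2 = thresholdFunction lam Ω₀ a x (s ^ 4) :=
    frontier_le_subset_eq continuous_const hcont hx
  rw [thresholdFunction_eq_scaleCombination] at hhalf
  rw [abs_signedDistBoundary]
  refine (H x (a * s) (by positivity) has hhalf.symm).trans ?_
  rw [mul_pow, add_mul, ← mul_assoc]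
  have : 0 < s ^ 4 := by positivity
  linarith
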